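/- Let $\Sigma$ be a compact connected Riemann surface of genus $g\ge 0$ (i.e. $H_1(\Sigma;\mathbb Z)$ has rank $2g$), let $s\ge 0$, and assume the following. (D1) $C_0,\dots,C_g$ are pairwise disjoint $C^1$-smooth (regular) simple closed curves on $\Sigma$ that divide it into two connected components: $\Sigma\setminus\bigsqcup_{k=0}^g C_k=\Sigma^+\sqcup\Sigma^-$ with $\Sigma^\pm$ open, connected and non-empty. Each $C_k$, $0\le k\le g$, carries the boundary orientation induced from $\Sigma^+$ with its complex orientation ($\Sigma^+$ lies to the left of $C_k$). (D2) $\imath:\Sigma\to\Sigma$ is a holomorphic involution with $\imath(\Sigma^\pm)\subseteq\Sigma^\mp$ and $\imath(C_k)=C_k$ as sets for all $0\le k\le g$. (D3) $P_1^+,\dots,P_s^+$ are pairwise different points of $\Sigma^+$, and $P_k^-:=\imath(P_k^+)$ for $1\le k\le s$. (D4) For $1\le k\le s$, $C_{g+k}$ is a $C^1$-smooth (regular) simple closed curve that bounds an open disk $U_k$ with $P_k^+\in U_k$, the closures $\overline{U_k}$ are contained in $\Sigma^+$ and pairwise disjoint, and $C_{g+k}$ carries the boundary orientation induced from $U_k$.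 (D5) $\eta_1,\dots,\eta_{g+s}$ are meromorphic differentials on $\Sigma$, linearly independent over $\mathbb C$, such that for every $1\le j\le g+s$ one has $\imath^*\eta_j=-\eta_j$ and the divisor of $\eta_j$ satisfies $(\eta_j)\ge-\sum_{k=1}^s(P_k^-+P_k^+)$; that is, $\eta_j$ has at most simple poles at the points $P_k^\pm$ and no other poles. Then for every $0\le k_0\le g+s$ the $(g+s)\times(g+s)$-matrix $$X_{k_0}=\Big(\oint_{C_m}\eta_j\Big)_{1\le j\le g+s,\;0\le m\le g+s,\;m\ne k_0}$$ is non-degenerate, i.e. $\det X_{k_0}\ne 0$. -/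

import Mathlib

open scoped Manifold Topology ContDiff

noncomputable section

namespace RiemannSurface

/-- The topological genus of a connected surface: `X` has genus `g` if its first homology group
`H₁(X; ℤ)`, that is, the abelianised fundamental group, has rank `2 g`. -/
def HasGenus (X : Type*) [TopologicalSpace X] (g : ℕ) : Prop :=
  ∀ x : X, Module.rank ℤ (Additive (Abelianization (FundamentalGroup X x))) = ((2 * g : ℕ) : Cardinal)

section

variable {X : Type*} [TopologicalSpace X] [ChartedSpace ℂ X]

/-! ### Meromorphic differentials -/

variable (X) in
/-- A (representative of a) differential of type `(1,0)` on `X`: a `ℂ`-linear form on each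
holomorphic tangent space. A meromorphic differential is represented by such a field, whose values
on a discrete set (for instance at the poles) carry no information. -/
abbrev Differential : Type _ := (x : X) → (TangentSpace 𝓘(ℂ, ℂ) x →L[ℂ] ℂ)

/-- The coefficient `f` in the local expression `η = f(z) dz` in the chart around `x`. -/
def Differential.coeff (η : Differential X) (x : X) (z : ℂ) : ℂ :=
  η ((chartAt ℂ x).symm z) (mfderiv 𝓘(ℂ, ℂ) 𝓘(ℂ, ℂ) (chartAt ℂ x).symm z (1 : ℂ))

/-- `η` is a meromorphic differential: around each point it is `f(z) dz` with `f` meromorphic. -/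
def Differential.IsMeromorphic (η : Differential X) : Prop :=
  ∀ x : X, MeromorphicAt (η.coeff x) (chartAt ℂ x x)

/-- The order of a meromorphic differential at a point, i.e. the coefficient of `x` in its divisor
(`⊤` if `η` vanishes identically around `x`). -/
def Differential.orderAt (η : Differential X) (x : X) : WithTop ℤ :=
  meromorphicOrderAt (η.coeff x) (chartAt ℂ x x)

/-- `(η) ≥ -D` for a divisor `D`. -/
def Differential.DivisorGeNeg (η : Differential X) (D : X →₀ ℤ) : Prop :=
  ∀ x : X, ((-(D x) : ℤ) : WithTop ℤ) ≤ η.orderAt x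

/-- The pullback `f^* η`. -/
def Differential.pullback (f : X → X) (η : Differential X) : Differential X :=
  fun x => (η (f x)).comp (mfderiv 𝓘(ℂ, ℂ) 𝓘(ℂ, ℂ) f x)

/-- Equality of meromorphic differentials: equality off a closed discrete set. -/
def Differential.Equal (η θ : Differential X) : Prop :=
  ∀ᶠ x in Filter.codiscrete X, η x = θ x

/-- Linear independence over `ℂ` in the space of meromorphic differentials. -/
def Differential.LinIndep {n : ℕ} (η : Fin n → Differential X) : Prop :=
  ∀ c : Fin n → ℂ, Differential.Equal (fun x => ∑ j, c j • η j x) (fun _ => 0) → ∀ j, c j = 0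

/-! ### Closed curves and contour integrals -/

/-- The velocity `γ'(t)`. The tangent spaces of `X` as a real and as a complex manifold are the same
(both are `ℂ`, through the preferred chart at `γ t`). -/
def velocity (γ : ℝ → X) (t : ℝ) : TangentSpace 𝓘(ℂ, ℂ) (γ t) :=
  (mfderiv 𝓘(ℝ, ℝ) 𝓘(ℝ, ℂ) γ t (1 : ℝ) : TangentSpace 𝓘(ℝ, ℂ) (γ t))

/-- `γ` is a (`1`-periodic, regular) parametrisation of an oriented `C¹`-smooth simple closed
curve. -/
structure IsSimpleClosedCurve (γ : ℝ → X) : Prop where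
  contMDiff : ContMDiff 𝓘(ℝ, ℝ) 𝓘(ℝ, ℂ) 1 γ
  periodic : Function.Periodic γ 1
  injOn : Set.InjOn γ (Set.Ico 0 1)
  velocity_ne_zero : ∀ t, velocity γ t ≠ 0

/-- The region `U` lies on the left of the curve `γ`: the direction `i γ'(t)` points into `U` at
every point of the curve. For a curve contained in the boundary of `U` this says that it carries
the boundary orientation induced from the complex orientation of `U`. -/
def LiesOnLeft (U : Set X) (γ : ℝ → X) : Prop :=
  ∀ t : ℝ, ∀ᶠ ε : ℝ in 𝓝[>] 0,
    let v : ℂ := velocity γ t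
    (chartAt ℂ (γ t)).symm (chartAt ℂ (γ t) (γ t) + (ε : ℂ) * (Complex.I * v)) ∈ U

/-- The contour integral `∮_γ η`. -/
def contourIntegral (γ : ℝ → X) (η : Differential X) : ℂ :=
  ∫ t in (0 : ℝ)..1, η (γ t) (velocity γ t)

/-- The matrix `(∮_{C_m} η_j)`, `1 ≤ j ≤ n`, `0 ≤ m ≤ n`, `m ≠ k₀`; the columns are listed in
increasing order of `m`. -/
def periodMatrix {n : ℕ} (C : Fin (n + 1) → ℝ → X) (η : Fin n → Differential X)
    (k₀ : Fin (n + 1)) : Matrix (Fin n) (Fin n) ℂ :=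
  Matrix.of fun j m => contourIntegral (C (k₀.succAbove m)) (η j)

end

/-- The index of the curve `C_k`, `0 ≤ k ≤ g`, in the list `C_0, …, C_{g+s}`. -/
def boundaryIdx {g : ℕ} (s : ℕ) (k : Fin (g + 1)) : Fin (g + s + 1) := ⟨k, by omega⟩

/-- The index of the curve `C_{g+k}`, `1 ≤ k ≤ s`, in the list `C_0, …, C_{g+s}`
(the element `k - 1` of `Fin s` stands for `k`). -/
def circleIdx (g : ℕ) {s : ℕ} (k : Fin s) : Fin (g + s + 1) := ⟨g + 1 + k, by omega⟩

end RiemannSurface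

end

open RiemannSurface

/-!
Suppose that the period matrix is degenerate, and let `ω ≠ 0` be a combination of the `η j` all of
whose periods vanish, except possibly the one along the omitted curve. The residue theorem
(`sum_contourIntegral_eq_residues`) for the disks `U k` and for `Xp` then shows that the residues of
`ω` at the points `P k` vanish, and that the omitted period vanishes, too. Since `ω` is odd, it has no
residues at the points `ι (P k)` either (`IsNormalizedAt.eq_zero_of_odd`). So `ω` is a holomorphic
differential without periods along `C_0, …, C_g`.

It remains to see that such a differential is zero (`eq_zero_of_contourIntegral_eq_zero`). For
this, one looks at functions `h` on the surface that satisfy `dh = ω₁ + conj ω₂` off the curves, for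
holomorphic differentials `ω₁` and `ω₂`, and have a constant jump `lam k` along each `C_k`
(`IsJumpPrimitive`). By Stokes' theorem (`stokes`), the integral of `d(h ω₂)` over the cut surface is
on the one hand `± 2i ‖ω₂‖²`, and on the other hand the sum of `lam k` times the period of `ω₂` along
`C_k`. If these periods vanish, so does `ω₂` (`IsJumpPrimitive.right_eq_zero`). Moreover, `h` is
differentiable along the curves, so that `∮ ω₁ = - conj ∮ ω₂` on each of them; hence, if `ω₂ = 0`,
then `ω₁` has no periods, the same argument applied to `conj h` gives `ω₁ = 0`, and all jumps are
equal (`IsJumpPrimitive.eq_zero_of_right_eq_zero`).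

That `ω` occurs as `ω₂` in a jump primitive is a count of dimensions. The combinations of the `η j`
without residues form a space `E` of holomorphic differentials of complex dimension at least `g`.
Given `ω₁`, `ω₂` in `E` and the jumps, a jump primitive exists locally, and its continuation is
obstructed by a homomorphism from the first homology group to `ℂ`, that is, by `2 g` complex numbers
(`exists_period_map`). The triples with a jump primitive thus form a real vector space of dimension at
least `4 dim E + 2 (g + 1) - 4 g ≥ 2 dim E + 2`, while by the above `(ω₁, ω₂, lam) ↦ (ω₂, lam k)` is
injective on it for any `k`. So this map is onto `E × ℂ`. Neither Riemann–Roch nor the symplectic structure of the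
homology enters.

The energy and the integrals of Stokes' theorem are written in charts, with a partition of unity:
`stokes` is obtained by summing the local statements, for which boundary curves are straightened by
`BoundaryBox`.
-/

namespace RiemannSurface

open Set Filter MeasureTheory
open scoped ComplexConjugate

/-! ### Charts and coefficients of differentials -/

section Charts

variable {X : Type*} [TopologicalSpace X] [ChartedSpace ℂ X]

/-- The coordinate change from the chart around `p` to the chart around `q`. -/
noncomputable def trans (p q : X) (z : ℂ) : ℂ := chartAt ℂ q ((chartAt ℂ p).symm z)

/-- The tangent vector `∂/∂z` of the chart around `p`, at the point with coordinate `z`, expressed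
in the preferred chart of that point. -/
noncomputable def chartVec (p : X) (z : ℂ) : ℂ :=
  mfderiv 𝓘(ℂ, ℂ) 𝓘(ℂ, ℂ) (chartAt ℂ p).symm z (1 : ℂ)

theorem trans_self {p : X} {z : ℂ} (hz : z ∈ (chartAt ℂ p).target) : trans p p z = z :=
  (chartAt ℂ p).right_inv hz

theorem trans_chart {p q x : X} (hx : x ∈ (chartAt ℂ p).source) :
    trans p q (chartAt ℂ p x) = chartAt ℂ q x := by
  rw [trans, (chartAt ℂ p).left_inv hx]

theorem trans_trans {p q r : X} {z : ℂ} (hq : (chartAt ℂ p).symm z ∈ (chartAt ℂ q).source) :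
    trans q r (trans p q z) = trans p r z := by
  rw [trans, trans, (chartAt ℂ q).left_inv hq, trans]

theorem symm_trans {p q : X} {z : ℂ} (hq : (chartAt ℂ p).symm z ∈ (chartAt ℂ q).source) :
    (chartAt ℂ q).symm (trans p q z) = (chartAt ℂ p).symm z :=
  (chartAt ℂ q).left_inv hq

theorem trans_mem_target {p q : X} {z : ℂ} (hq : (chartAt ℂ p).symm z ∈ (chartAt ℂ q).source) :
    trans p q z ∈ (chartAt ℂ q).target := (chartAt ℂ q).map_source hq

theorem chart_mem_target (p : X) : chartAt ℂ p p ∈ (chartAt ℂ p).target :=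
  mem_chart_target ℂ p

theorem target_mem_nhds {p : X} {z : ℂ} (hz : z ∈ (chartAt ℂ p).target) :
    (chartAt ℂ p).target ∈ 𝓝 z := (chartAt ℂ p).open_target.mem_nhds hz

theorem eventually_symm_mem {p : X} {z : ℂ} (hz : z ∈ (chartAt ℂ p).target) {N : Set X}
    (hN : N ∈ 𝓝 ((chartAt ℂ p).symm z)) : ∀ᶠ w in 𝓝 z, (chartAt ℂ p).symm w ∈ N :=
  ((chartAt ℂ p).continuousAt_symm hz).eventually hN

theorem eventually_symm_mem_source {p q : X} {z : ℂ} (hz : z ∈ (chartAt ℂ p).target)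
    (hq : (chartAt ℂ p).symm z ∈ (chartAt ℂ q).source) :
    ∀ᶠ w in 𝓝 z, w ∈ (chartAt ℂ p).target ∧ (chartAt ℂ p).symm w ∈ (chartAt ℂ q).source :=
  Filter.Eventually.and (target_mem_nhds hz)
    (eventually_symm_mem hz ((chartAt ℂ q).open_source.mem_nhds hq))

theorem isOpen_overlap (p q : X) :
    IsOpen ((chartAt ℂ p).target ∩ (chartAt ℂ p).symm ⁻¹' (chartAt ℂ q).source) :=
  (chartAt ℂ p).isOpen_inter_preimage_symm (chartAt ℂ q).open_source

theorem deriv_trans_self {p : X} {z : ℂ} (hz : z ∈ (chartAt ℂ p).target) :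
    deriv (trans p p) z = 1 := by
  have : trans p p =ᶠ[𝓝 z] id := by
    filter_upwards [target_mem_nhds hz] with w hw using trans_self hw
  rw [this.deriv_eq, deriv_id]

theorem coeff_eq (η : Differential X) (p : X) (z : ℂ) :
    η.coeff p z = chartVec p z * η ((chartAt ℂ p).symm z) (1 : ℂ) := by
  have : (mfderiv 𝓘(ℂ, ℂ) 𝓘(ℂ, ℂ) (chartAt ℂ p).symm z (1 : ℂ) : ℂ) = chartVec p z • (1 : ℂ) := by
    rw [smul_eq_mul, mul_one]; rfl
  rw [Differential.coeff]
  erw [this]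
  exact (η ((chartAt ℂ p).symm z)).map_smul (chartVec p z) (1 : ℂ)

theorem coeff_add (η θ : Differential X) (p : X) (z : ℂ) :
    (η + θ).coeff p z = η.coeff p z + θ.coeff p z := by
  rw [coeff_eq, coeff_eq, coeff_eq, ← mul_add]; rfl

theorem coeff_smul (c : ℂ) (η : Differential X) (p : X) (z : ℂ) :
    (c • η).coeff p z = c * η.coeff p z := by
  rw [coeff_eq, coeff_eq, mul_left_comm]; rfl

theorem coeff_zero (p : X) (z : ℂ) : (0 : Differential X).coeff p z = 0 := by
  rw [coeff_eq]; exact mul_zero _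

theorem coeff_sum {ι : Type*} (s : Finset ι) (c : ι → ℂ) (η : ι → Differential X) (p : X) (z : ℂ) :
    (∑ j ∈ s, c j • η j).coeff p z = ∑ j ∈ s, c j * (η j).coeff p z := by
  classical
  induction s using Finset.induction_on with
  | empty => simp [coeff_zero]
  | insert a s ha ih => rw [Finset.sum_insert ha, Finset.sum_insert ha, coeff_add, ih, coeff_smul]

/-- The differential `η` is holomorphic at the point `x`, with its given value there. -/
def HolAt (η : Differential X) (x : X) : Prop := AnalyticAt ℂ (η.coeff x) (chartAt ℂ x x)

theorem HolAt.add {η θ : Differential X} {x : X} (h : HolAt η x) (h' : HolAt θ x) :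
    HolAt (η + θ) x :=
  (AnalyticAt.add h h').congr (Eventually.of_forall fun z => (coeff_add η θ x z).symm)

theorem HolAt.smul {η : Differential X} {x : X} (c : ℂ) (h : HolAt η x) : HolAt (c • η) x :=
  (analyticAt_const.mul h).congr (Eventually.of_forall fun z => (coeff_smul c η x z).symm)

theorem HolAt.zero (x : X) : HolAt (0 : Differential X) x :=
  (analyticAt_const (v := (0 : ℂ))).congr (Eventually.of_forall fun z => (coeff_zero x z).symm)

variable (X) in
/-- The space of holomorphic differentials. -/
noncomputable def holForms : Submodule ℂ (Differential X) where
  carrier := {η | ∀ x, HolAt η x}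
  add_mem' h h' x := (h x).add (h' x)
  zero_mem' x := HolAt.zero x
  smul_mem' c _ h x := (h x).smul c

variable [IsManifold 𝓘(ℂ, ℂ) ω X]

theorem contDiffOn_trans (p q : X) : ContDiffOn ℂ ω (trans p q)
    ((chartAt ℂ p).target ∩ (chartAt ℂ p).symm ⁻¹' (chartAt ℂ q).source) := by
  have h := contDiffOn_ext_coord_change (I := 𝓘(ℂ, ℂ)) (n := ω) (x := q) (x' := p)
  have e : trans p q = fun z => chartAt ℂ q ((chartAt ℂ p).symm z) := rfl
  rw [e]
  simpa [mfld_simps, Function.comp_def] using h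

theorem analyticAt_trans {p q : X} {z : ℂ} (hz : z ∈ (chartAt ℂ p).target)
    (hq : (chartAt ℂ p).symm z ∈ (chartAt ℂ q).source) : AnalyticAt ℂ (trans p q) z :=
  ((contDiffOn_trans p q).contDiffAt ((isOpen_overlap p q).mem_nhds ⟨hz, hq⟩)).analyticAt

theorem differentiableAt_trans {p q : X} {z : ℂ} (hz : z ∈ (chartAt ℂ p).target)
    (hq : (chartAt ℂ p).symm z ∈ (chartAt ℂ q).source) : DifferentiableAt ℂ (trans p q) z :=
  (analyticAt_trans hz hq).differentiableAt

theorem deriv_trans_trans {p q r : X} {z : ℂ} (hz : z ∈ (chartAt ℂ p).target)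
    (hq : (chartAt ℂ p).symm z ∈ (chartAt ℂ q).source)
    (hr : (chartAt ℂ p).symm z ∈ (chartAt ℂ r).source) :
    deriv (trans p r) z = deriv (trans q r) (trans p q z) * deriv (trans p q) z := by
  have h : trans p r =ᶠ[𝓝 z] trans q r ∘ trans p q := by
    filter_upwards [eventually_symm_mem_source hz hq] with w hw
    exact (trans_trans hw.2).symm
  rw [h.deriv_eq, deriv_comp]
  · exact differentiableAt_trans (trans_mem_target hq) (by rwa [symm_trans hq])
  · exact differentiableAt_trans hz hq

theorem deriv_trans_ne_zero {p q : X} {z : ℂ} (hz : z ∈ (chartAt ℂ p).target)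
    (hq : (chartAt ℂ p).symm z ∈ (chartAt ℂ q).source) : deriv (trans p q) z ≠ 0 := by
  have h := deriv_trans_trans hz hq ((chartAt ℂ p).map_target hz)
  rw [deriv_trans_self hz] at h
  intro h0
  rw [h0, mul_zero] at h
  exact one_ne_zero h

theorem chartVec_eq {p : X} {z : ℂ} (hz : z ∈ (chartAt ℂ p).target) :
    chartVec p z = deriv (trans p ((chartAt ℂ p).symm z)) z := by
  have hm : MDifferentiableAt 𝓘(ℂ, ℂ) 𝓘(ℂ, ℂ) (chartAt ℂ p).symm z :=
    haveI : IsManifold 𝓘(ℂ, ℂ) 1 X := IsManifold.of_le (n := ω) (by simp)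
    mdifferentiableAt_atlas_symm (chart_mem_atlas ℂ p) hz
  rw [chartVec, hm.mfderiv]
  simp only [writtenInExtChartAt, mfld_simps, fderivWithin_univ]
  rfl

theorem chartVec_trans {p q : X} {z : ℂ} (hz : z ∈ (chartAt ℂ p).target)
    (hq : (chartAt ℂ p).symm z ∈ (chartAt ℂ q).source) :
    chartVec p z = chartVec q (trans p q z) * deriv (trans p q) z := by
  rw [chartVec_eq hz, chartVec_eq (trans_mem_target hq), symm_trans hq]
  exact deriv_trans_trans hz hq (mem_chart_source ℂ _)

theorem chartVec_ne_zero {p : X} {z : ℂ} (hz : z ∈ (chartAt ℂ p).target) : chartVec p z ≠ 0 := by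
  rw [chartVec_eq hz]
  exact deriv_trans_ne_zero hz (mem_chart_source ℂ _)

theorem chartVec_self (p : X) : chartVec p (chartAt ℂ p p) = 1 := by
  rw [chartVec_eq (chart_mem_target p), (chartAt ℂ p).left_inv (mem_chart_source ℂ p)]
  exact deriv_trans_self (chart_mem_target p)

theorem coeff_self (η : Differential X) (p : X) : η.coeff p (chartAt ℂ p p) = η p (1 : ℂ) := by
  rw [coeff_eq, chartVec_self, one_mul, (chartAt ℂ p).left_inv (mem_chart_source ℂ p)]

theorem coeff_trans (η : Differential X) {p q : X} {z : ℂ} (hz : z ∈ (chartAt ℂ p).target)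
    (hq : (chartAt ℂ p).symm z ∈ (chartAt ℂ q).source) :
    η.coeff p z = η.coeff q (trans p q z) * deriv (trans p q) z := by
  rw [coeff_eq, coeff_eq, symm_trans hq, chartVec_trans hz hq]
  ring

theorem eq_of_coeff_eq {η θ : Differential X} {p : X} {z : ℂ} (hz : z ∈ (chartAt ℂ p).target)
    (h : η.coeff p z = θ.coeff p z) : η ((chartAt ℂ p).symm z) = θ ((chartAt ℂ p).symm z) := by
  rw [coeff_eq, coeff_eq] at h
  have h1 := mul_left_cancel₀ (chartVec_ne_zero hz) h
  exact ContinuousLinearMap.ext_ring h1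

theorem HolAt.analyticAt {η : Differential X} {p x : X} (h : HolAt η x)
    (hx : x ∈ (chartAt ℂ p).source) : AnalyticAt ℂ (η.coeff p) (chartAt ℂ p x) := by
  have hz := (chartAt ℂ p).map_source hx
  have hq : (chartAt ℂ p).symm (chartAt ℂ p x) ∈ (chartAt ℂ x).source := by
    rw [(chartAt ℂ p).left_inv hx]; exact mem_chart_source ℂ x
  have h1 := analyticAt_trans (q := x) hz hq
  have h2 : AnalyticAt ℂ (η.coeff x) (trans p x (chartAt ℂ p x)) := by
    rw [trans_chart hx]; exact h
  have h3 := (h2.comp h1).mul h1.deriv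
  refine h3.congr ?_
  filter_upwards [eventually_symm_mem_source hz hq] with w hw
  exact (coeff_trans η hw.1 hw.2).symm

theorem HolAt.analyticAt_symm {η : Differential X} {p : X} {z : ℂ}
    (hz : z ∈ (chartAt ℂ p).target) (h : HolAt η ((chartAt ℂ p).symm z)) :
    AnalyticAt ℂ (η.coeff p) z := by
  have := h.analyticAt ((chartAt ℂ p).map_target hz)
  rwa [(chartAt ℂ p).right_inv hz] at this

end Charts

/-! ### The Cauchy–Riemann operator in the plane -/

/-- The Cauchy–Riemann operator `∂/∂x + i ∂/∂y = 2 ∂/∂z̄`. The factor `2` is kept in order to avoid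
denominators. -/
noncomputable def dbar (u : ℂ → ℂ) (z : ℂ) : ℂ :=
  fderiv ℝ u z 1 + Complex.I * fderiv ℝ u z Complex.I

theorem dbar_congr {u v : ℂ → ℂ} {z : ℂ} (h : u =ᶠ[𝓝 z] v) : dbar u z = dbar v z := by
  rw [dbar, dbar, h.fderiv_eq]

theorem dbar_mul {u v : ℂ → ℂ} {z : ℂ} (hu : DifferentiableAt ℝ u z) (hv : DifferentiableAt ℝ v z) :
    dbar (fun w => u w * v w) z = dbar u z * v z + u z * dbar v z := by
  simp only [dbar]
  rw [fderiv_fun_mul hu hv]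
  simp only [add_apply, smul_apply, smul_eq_mul]
  ring

theorem dbar_add {u v : ℂ → ℂ} {z : ℂ} (hu : DifferentiableAt ℝ u z) (hv : DifferentiableAt ℝ v z) :
    dbar (fun w => u w + v w) z = dbar u z + dbar v z := by
  simp only [dbar]
  rw [fderiv_fun_add hu hv]
  simp only [add_apply]
  ring

theorem dbar_const (c z : ℂ) : dbar (fun _ => c) z = 0 := by simp [dbar]

theorem dbar_sum {ι : Type*} (s : Finset ι) {u : ι → ℂ → ℂ} {z : ℂ}
    (hu : ∀ i ∈ s, DifferentiableAt ℝ (u i) z) :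
    dbar (fun w => ∑ i ∈ s, u i w) z = ∑ i ∈ s, dbar (u i) z := by
  simp only [dbar]
  rw [fderiv_fun_sum hu]
  simp [Finset.mul_sum, Finset.sum_add_distrib]

theorem hasFDerivAt_real_of_hasDerivAt {f : ℂ → ℂ} {f' z : ℂ} (h : HasDerivAt f f' z) :
    HasFDerivAt f (f' • (1 : ℂ →L[ℝ] ℂ)) z := by
  simpa using h.complexToReal_fderiv

theorem dbar_eq_zero {f : ℂ → ℂ} {z : ℂ} (h : DifferentiableAt ℂ f z) : dbar f z = 0 := by
  rw [dbar, (hasFDerivAt_real_of_hasDerivAt h.hasDerivAt).fderiv]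
  simp only [smul_apply, one_apply_eq_self, smul_eq_mul]
  linear_combination deriv f z * Complex.I_mul_I

theorem dbar_comp {u τ : ℂ → ℂ} {z : ℂ} (hu : DifferentiableAt ℝ u (τ z))
    (hτ : DifferentiableAt ℂ τ z) :
    dbar (fun w => u (τ w)) z = dbar u (τ z) * conj (deriv τ z) := by
  have h1 : HasFDerivAt (fun w => u (τ w)) ((fderiv ℝ u (τ z)).comp
      (deriv τ z • (1 : ℂ →L[ℝ] ℂ))) z :=
    hu.hasFDerivAt.comp z (hasFDerivAt_real_of_hasDerivAt hτ.hasDerivAt)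
  rw [dbar, dbar, h1.fderiv]
  simp only [ContinuousLinearMap.comp_apply, smul_apply,
    one_apply_eq_self, smul_eq_mul, mul_one]
  set L := fderiv ℝ u (τ z)
  set d := deriv τ z
  have key : ∀ w : ℂ, L w = w.re * L 1 + w.im * L Complex.I := by
    intro w
    have e : w = w.re • (1 : ℂ) + w.im • Complex.I := by simp [Complex.re_add_im]
    conv_lhs => rw [e]
    rw [map_add, map_smul, map_smul, Complex.real_smul, Complex.real_smul]
  have e3 : conj d = (d.re : ℂ) - d.im * Complex.I := by
    apply Complex.ext <;> simp
  rw [e3, key d, key (d * Complex.I)]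
  have e4 : (d * Complex.I).re = - d.im := by simp
  have e5 : (d * Complex.I).im = d.re := by simp
  rw [e4, e5]
  push_cast
  linear_combination ((L Complex.I) * (d.im : ℂ)) * Complex.I_mul_I

theorem dbar_conj {F : ℂ → ℂ} {F' z : ℂ} (h : HasDerivAt F F' z) :
    dbar (fun w => conj (F w)) z = 2 * conj F' := by
  have h1 : HasFDerivAt (fun w => conj (F w)) ((Complex.conjCLE : ℂ →L[ℝ] ℂ).comp
      (F' • (1 : ℂ →L[ℝ] ℂ))) z :=
    Complex.conjCLE.hasFDerivAt.comp z (hasFDerivAt_real_of_hasDerivAt h)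
  rw [dbar, h1.fderiv]
  simp only [ContinuousLinearMap.comp_apply, smul_apply,
    one_apply_eq_self, smul_eq_mul, mul_one]
  change conj F' + Complex.I * conj (F' * Complex.I) = _
  rw [map_mul, Complex.conj_I]
  linear_combination (-(conj F')) * Complex.I_mul_I

theorem continuous_dbar {u : ℂ → ℂ} (hu : ContDiff ℝ 1 u) : Continuous (dbar u) := by
  have := hu.continuous_fderiv one_ne_zero
  unfold dbar
  fun_prop

theorem continuousAt_dbar_of_contDiffAt {u : ℂ → ℂ} {z : ℂ} (hu : ContDiffAt ℝ 1 u z) :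
    ContinuousAt (dbar u) z := by
  have := (hu.fderiv_right (m := 0) le_rfl).continuousAt
  unfold dbar
  fun_prop

theorem support_dbar_subset (u : ℂ → ℂ) : Function.support (dbar u) ⊆ tsupport u := by
  intro z hz
  by_contra h
  exact hz (by rw [dbar, fderiv_of_notMem_tsupport ℝ h]; simp)

theorem tsupport_dbar_subset (u : ℂ → ℂ) : tsupport (dbar u) ⊆ tsupport u :=
  closure_minimal (support_dbar_subset u) (isClosed_tsupport u)

theorem hasCompactSupport_dbar {u : ℂ → ℂ} (hc : HasCompactSupport u) :
    HasCompactSupport (dbar u) :=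
  hc.of_isClosed_subset (isClosed_tsupport _) (tsupport_dbar_subset u)

theorem integral_fderiv_apply_eq_zero {u : ℂ → ℂ} (hu : ContDiff ℝ 1 u) (hc : HasCompactSupport u)
    (v : ℂ) : ∫ z, fderiv ℝ u z v = 0 := by
  have hcont : Continuous fun z => fderiv ℝ u z v :=
    (hu.continuous_fderiv one_ne_zero).clm_apply continuous_const
  have hcs : HasCompactSupport fun z => fderiv ℝ u z v := hc.fderiv_apply ℝ v
  have h := integral_mul_fderiv_eq_neg_fderiv_mul_of_integrable (μ := volume)
    (f := fun _ : ℂ => (1 : ℂ)) (g := u) (v := v)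
    (by simp) (by simpa using hcont.integrable_of_hasCompactSupport hcs)
    (by simpa using hu.continuous.integrable_of_hasCompactSupport hc)
    (fun _ _ => differentiableAt_const _) (fun z _ => hu.differentiable one_ne_zero z)
  simpa using h

theorem integral_dbar_eq_zero {u : ℂ → ℂ} (hu : ContDiff ℝ 1 u) (hc : HasCompactSupport u) :
    ∫ z, dbar u z = 0 := by
  have hcont : ∀ v, Continuous fun z => fderiv ℝ u z v := fun v =>
    (hu.continuous_fderiv one_ne_zero).clm_apply continuous_const
  have hi : ∀ v, Integrable fun z => fderiv ℝ u z v := fun v =>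
    (hcont v).integrable_of_hasCompactSupport (hc.fderiv_apply ℝ v)
  simp only [dbar]
  rw [integral_add (hi 1) ((hi Complex.I).const_mul _), integral_const_mul,
    integral_fderiv_apply_eq_zero hu hc, integral_fderiv_apply_eq_zero hu hc]
  simp

/-! ### The residue constant -/

/-- A smooth radial function that is `1` on the unit disk and has compact support. -/
noncomputable def radialBump (z : ℂ) : ℂ := (Real.smoothTransition (2 - Complex.normSq z) : ℝ)

theorem contDiff_radialBump : ContDiff ℝ 1 radialBump := by
  have h1 : ContDiff ℝ 1 fun z : ℂ => 2 - Complex.normSq z := by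
    simp only [Complex.normSq_apply]
    have h2 : ContDiff ℝ 1 (fun z : ℂ => z.re) := Complex.reCLM.contDiff
    have h3 : ContDiff ℝ 1 (fun z : ℂ => z.im) := Complex.imCLM.contDiff
    fun_prop
  exact Complex.ofRealCLM.contDiff.comp (Real.smoothTransition.contDiff.comp h1)

theorem radialBump_eq_one {z : ℂ} (hz : ‖z‖ ≤ 1) : radialBump z = 1 := by
  have : Complex.normSq z ≤ 1 := by
    rw [Complex.normSq_eq_norm_sq]; nlinarith [norm_nonneg z]
  rw [radialBump, Real.smoothTransition.one_of_one_le (by linarith)]; simp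

theorem radialBump_eq_zero {z : ℂ} (hz : 2 ≤ ‖z‖) : radialBump z = 0 := by
  have : 2 ≤ Complex.normSq z := by
    rw [Complex.normSq_eq_norm_sq]; nlinarith [norm_nonneg z]
  rw [radialBump, Real.smoothTransition.zero_of_nonpos (by linarith)]; simp

theorem hasCompactSupport_radialBump : HasCompactSupport radialBump := by
  refine HasCompactSupport.intro (isCompact_closedBall (0 : ℂ) 2) fun z hz => ?_
  apply radialBump_eq_zero
  simp at hz
  exact hz.le

/-- The constant by which the residue of a simple pole contributes to contour integrals: it equals
`-2π`, but only `residueConst_ne_zero` matters. -/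
noncomputable def residueConst : ℂ := ∫ z, dbar radialBump z / z

theorem dbar_radialBump (z : ℂ) :
    dbar radialBump z / z = ((-2 * deriv Real.smoothTransition (2 - Complex.normSq z) : ℝ) : ℂ) := by
  rcases eq_or_ne z 0 with rfl | hz
  · have h : Real.smoothTransition =ᶠ[𝓝 2] fun _ => 1 := by
      filter_upwards [Ici_mem_nhds (show (1 : ℝ) < 2 by norm_num)] with x hx
      exact Real.smoothTransition.one_of_one_le hx
    simp [h.deriv_eq]
  have hs : HasDerivAt Real.smoothTransition
      (deriv Real.smoothTransition (2 - Complex.normSq z)) (2 - Complex.normSq z) :=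
    ((Real.smoothTransition.contDiff (n := 1)).differentiable one_ne_zero _).hasDerivAt
  have hre : HasFDerivAt (fun w : ℂ => w.re) Complex.reCLM z := Complex.reCLM.hasFDerivAt
  have him : HasFDerivAt (fun w : ℂ => w.im) Complex.imCLM z := Complex.imCLM.hasFDerivAt
  have hn : HasFDerivAt (fun w : ℂ => 2 - Complex.normSq w)
      (-((z.re • Complex.reCLM + z.re • Complex.reCLM) +
        (z.im • Complex.imCLM + z.im • Complex.imCLM))) z := by
    simp only [Complex.normSq_apply]
    exact ((hre.mul hre).add (him.mul him)).const_sub 2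
  have h2 : HasFDerivAt (fun w : ℂ => Real.smoothTransition (2 - Complex.normSq w)) _ z :=
    HasDerivAt.comp_hasFDerivAt (f := fun w : ℂ => 2 - Complex.normSq w) z hs hn
  have h3 : HasFDerivAt radialBump _ z :=
    (Complex.ofRealCLM.hasFDerivAt (x := Real.smoothTransition (2 - Complex.normSq z))).comp z h2
  rw [div_eq_iff hz, dbar, h3.fderiv]
  apply Complex.ext <;> simp <;> ring

theorem continuous_deriv_smoothTransition : Continuous (deriv Real.smoothTransition) :=
  (Real.smoothTransition.contDiff (n := 1)).continuous_deriv le_rfl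

theorem residueConst_ne_zero : residueConst ≠ 0 := by
  have hf : Continuous fun z : ℂ => 2 * deriv Real.smoothTransition (2 - Complex.normSq z) :=
    continuous_const.mul (continuous_deriv_smoothTransition.comp
      (continuous_const.sub Complex.continuous_normSq))
  have hd0 : ∀ x : ℝ, x < 0 → deriv Real.smoothTransition x = 0 := by
    intro x hx
    have h : Real.smoothTransition =ᶠ[𝓝 x] fun _ => 0 := by
      filter_upwards [Iic_mem_nhds hx] with y hy
      exact Real.smoothTransition.zero_of_nonpos hy
    simp [h.deriv_eq]
  have hsupp : HasCompactSupport
      fun z : ℂ => 2 * deriv Real.smoothTransition (2 - Complex.normSq z) := by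
    refine HasCompactSupport.intro (isCompact_closedBall (0 : ℂ) 2) fun z hz => ?_
    simp at hz
    have : 2 < Complex.normSq z := by rw [Complex.normSq_eq_norm_sq]; nlinarith
    rw [hd0 _ (by linarith), mul_zero]
  obtain ⟨u, hu, hu'⟩ := exists_deriv_eq_slope Real.smoothTransition (zero_lt_one (α := ℝ))
    Real.smoothTransition.continuous.continuousOn
    ((Real.smoothTransition.contDiff (n := 1)).differentiable one_ne_zero).differentiableOn
  rw [Real.smoothTransition.one, Real.smoothTransition.zero] at hu'
  have hpos := hf.integral_pos_of_hasCompactSupport_nonneg_nonzero (μ := volume) hsupp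
    (x := (Real.sqrt (2 - u) : ℂ))
    (fun z => mul_nonneg zero_le_two Real.smoothTransition.monotone.deriv_nonneg) (by
      rw [Complex.normSq_ofReal, Real.mul_self_sqrt (by linarith [hu.2]), sub_sub_cancel, hu']
      norm_num)
  have : residueConst = -((∫ z : ℂ, 2 * deriv Real.smoothTransition (2 - Complex.normSq z) : ℝ) : ℂ)
      := by
    rw [residueConst, ← integral_complex_ofReal, ← integral_neg]
    congr 1
    ext z
    rw [dbar_radialBump]
    push_cast
    ring
  rw [this]
  exact neg_ne_zero.mpr (Complex.ofReal_ne_zero.mpr hpos.ne')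

theorem integrable_dbar_div {ρ : ℂ → ℂ} {a : ℂ} (hρ : ContDiff ℝ 1 ρ) (hc : HasCompactSupport ρ)
    (h1 : ∀ᶠ z in 𝓝 a, ρ z = 1) : Integrable fun z => dbar ρ z / (z - a) := by
  have h0 : ∀ᶠ z in 𝓝 a, dbar ρ z / (z - a) = 0 := by
    filter_upwards [h1.eventually_nhds] with z hz
    rw [dbar_congr (v := fun _ => 1) hz, dbar_const, zero_div]
  refine Continuous.integrable_of_hasCompactSupport ?_ ?_
  · rw [continuous_iff_continuousAt]
    intro z
    rcases eq_or_ne z a with rfl | hz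
    · exact (continuousAt_const (y := (0 : ℂ))).congr (h0.mono fun _ h => h.symm)
    · exact (continuous_dbar hρ).continuousAt.div (by fun_prop) (sub_ne_zero.mpr hz)
  · exact (hasCompactSupport_dbar hc).mono fun z hz => by
      simp only [Function.mem_support] at hz ⊢
      exact fun h => hz (by rw [h, zero_div])

/-- Cauchy–Pompeiu for a cut-off function that is constant near the pole. -/
theorem integral_dbar_div {ρ : ℂ → ℂ} {a : ℂ} (hρ : ContDiff ℝ 1 ρ) (hc : HasCompactSupport ρ)
    (h1 : ∀ᶠ z in 𝓝 a, ρ z = 1) : ∫ z, dbar ρ z / (z - a) = residueConst := by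
  set b : ℂ → ℂ := fun z => radialBump (z - a) with hb
  have hbC : ContDiff ℝ 1 b := contDiff_radialBump.comp (contDiff_id.sub contDiff_const)
  have hbc : HasCompactSupport b :=
    hasCompactSupport_radialBump.comp_homeomorph (Homeomorph.subRight a)
  have hb1 : ∀ᶠ z in 𝓝 a, b z = 1 := by
    filter_upwards [Metric.closedBall_mem_nhds a zero_lt_one] with z hz
    exact radialBump_eq_one (by simpa [dist_eq_norm] using hz)
  have hdb : ∀ z, dbar b z = dbar radialBump (z - a) := by
    intro z
    have := dbar_comp (u := radialBump) (τ := fun w => w - a) (z := z)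
      (contDiff_radialBump.differentiable one_ne_zero _) (by fun_prop)
    simpa using this
  have hconst : ∫ z, dbar b z / (z - a) = residueConst := by
    simp only [hdb]
    exact integral_sub_right_eq_self (μ := volume) (fun z => dbar radialBump z / z) a
  rw [← hconst, ← sub_eq_zero, ← integral_sub (integrable_dbar_div hρ hc h1)
    (integrable_dbar_div hbC hbc hb1)]
  set v : ℂ → ℂ := fun z => (ρ z - b z) * (z - a)⁻¹ with hv
  have hv0 : v =ᶠ[𝓝 a] fun _ => 0 := by
    filter_upwards [h1, hb1] with z h2 h3
    simp [hv, h2, h3]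
  have hvC : ContDiff ℝ 1 v := by
    rw [contDiff_iff_contDiffAt]
    intro z
    rcases eq_or_ne z a with rfl | hz
    · exact contDiffAt_const.congr_of_eventuallyEq hv0
    · exact (hρ.contDiffAt.sub hbC.contDiffAt).mul
        ((contDiffAt_id.sub contDiffAt_const).inv (sub_ne_zero.mpr hz))
  have hvc : HasCompactSupport v := (hc.sub hbc).mul_right
  rw [← integral_dbar_eq_zero hvC hvc]
  congr 1
  ext z
  rcases eq_or_ne z a with rfl | hz
  · rw [dbar_congr hv0, dbar_const]; simp
  · have hd : DifferentiableAt ℂ (fun w : ℂ => (w - a)⁻¹) z :=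
      (differentiableAt_id.sub_const a).inv (sub_ne_zero.mpr hz)
    have hρd := hρ.differentiable one_ne_zero z
    have hbd := hbC.differentiable one_ne_zero z
    rw [hv, dbar_mul (u := fun z => ρ z - b z) (hρd.sub hbd) (hd.restrictScalars ℝ),
      dbar_eq_zero hd]
    have : dbar (fun w => ρ w - b w) z = dbar ρ z - dbar b z := by
      simp only [dbar]
      rw [fderiv_fun_sub hρd hbd]
      simp only [sub_apply]
      ring
    rw [this]
    field_simp
    ring

/-! ### Stokes' theorem for one side of an arc in the plane -/

theorem integral_upperHalfPlane {F : ℂ → ℂ} (hF : Integrable F) :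
    ∫ z in {z : ℂ | 0 < z.im}, F z = ∫ t : ℝ, ∫ s in Ioi (0 : ℝ), F (t + s * Complex.I) := by
  have hmp := Complex.volume_preserving_equiv_real_prod.symm
  have he : ∀ p : ℝ × ℝ, Complex.measurableEquivRealProd.symm p = p.1 + p.2 * Complex.I := by
    intro p
    rw [Complex.measurableEquivRealProd_symm_apply]
    apply Complex.ext <;> simp
  have h1 := hmp.setIntegral_preimage_emb Complex.measurableEquivRealProd.symm.measurableEmbedding
    F {z : ℂ | 0 < z.im}
  have hpre : Complex.measurableEquivRealProd.symm ⁻¹' {z : ℂ | 0 < z.im} = univ ×ˢ Ioi (0 : ℝ) := by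
    ext p
    simp [he]
  have hint : Integrable (fun p : ℝ × ℝ => F (p.1 + p.2 * Complex.I)) := by
    have := (hmp.integrable_comp_emb
      Complex.measurableEquivRealProd.symm.measurableEmbedding).mpr hF
    simpa only [Function.comp_def, he] using this
  rw [← h1, hpre]
  simp only [he]
  rw [Measure.volume_eq_prod, setIntegral_prod _ hint.integrableOn]
  simp

theorem integral_halfPlane_fderiv_one {v : ℂ → ℂ} (hv : ContDiff ℝ 1 v) (hc : HasCompactSupport v) :
    ∫ z in {z : ℂ | 0 < z.im}, fderiv ℝ v z 1 = 0 := by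
  have hcont : Continuous fun z => fderiv ℝ v z 1 :=
    (hv.continuous_fderiv one_ne_zero).clm_apply continuous_const
  have hcs : HasCompactSupport fun z => fderiv ℝ v z 1 := hc.fderiv_apply ℝ 1
  have hint := hcont.integrable_of_hasCompactSupport hcs (μ := volume)
  rw [integral_upperHalfPlane hint]
  have hmp := Complex.volume_preserving_equiv_real_prod.symm
  have he : ∀ p : ℝ × ℝ, Complex.measurableEquivRealProd.symm p = p.1 + p.2 * Complex.I := by
    intro p
    rw [Complex.measurableEquivRealProd_symm_apply]
    apply Complex.ext <;> simp
  have hint2 : Integrable (fun p : ℝ × ℝ => fderiv ℝ v (p.1 + p.2 * Complex.I) 1) := by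
    have := (hmp.integrable_comp_emb
      Complex.measurableEquivRealProd.symm.measurableEmbedding).mpr hint
    simpa only [Function.comp_def, he] using this
  have hint3 : Integrable (Function.uncurry fun t s : ℝ => fderiv ℝ v (t + s * Complex.I) 1)
      (volume.prod (volume.restrict (Ioi 0))) := by
    have h := hint2.integrableOn (s := univ ×ˢ Ioi (0 : ℝ))
    rw [IntegrableOn, Measure.volume_eq_prod, ← Measure.prod_restrict, Measure.restrict_univ] at h
    exact h
  rw [integral_integral_swap hint3]
  have : ∀ s : ℝ, ∫ t : ℝ, fderiv ℝ v (t + s * Complex.I) 1 = 0 := by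
    intro s
    have hemb : Topology.IsClosedEmbedding fun t : ℝ => (t : ℂ) + s * Complex.I :=
      (Homeomorph.addRight ((s : ℂ) * Complex.I)).isClosedEmbedding.comp
        Complex.isometry_ofReal.isClosedEmbedding
    refine integral_eq_zero_of_hasDerivAt_of_integrable
      (f := fun t : ℝ => v (t + s * Complex.I)) (fun t => ?_) ?_ ?_
    · have h1 : HasDerivAt (fun t : ℝ => (t : ℂ) + s * Complex.I) 1 t :=
        (Complex.ofRealCLM.hasDerivAt (x := t)).add_const _
      exact (hv.differentiable one_ne_zero _).hasFDerivAt.comp_hasDerivAt t h1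
    · exact (hcont.comp hemb.continuous).integrable_of_hasCompactSupport
        (hcs.comp_isClosedEmbedding hemb)
    · exact (hv.continuous.comp hemb.continuous).integrable_of_hasCompactSupport
        (hc.comp_isClosedEmbedding hemb)
  simp [this]

theorem integral_halfPlane_fderiv_I {v : ℂ → ℂ} (hv : ContDiff ℝ 1 v) (hc : HasCompactSupport v)
    {k : ℝ → ℂ} (hk : Continuous k) :
    ∫ z in {z : ℂ | 0 < z.im}, fderiv ℝ v z Complex.I * k z.re = - ∫ t : ℝ, v t * k t := by
  have hcont : Continuous fun z => fderiv ℝ v z Complex.I :=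
    (hv.continuous_fderiv one_ne_zero).clm_apply continuous_const
  have hcs : HasCompactSupport fun z => fderiv ℝ v z Complex.I := hc.fderiv_apply ℝ _
  have hint := (hcont.mul (hk.comp Complex.continuous_re)).integrable_of_hasCompactSupport
    hcs.mul_right (μ := volume)
  rw [integral_upperHalfPlane (F := fun z => fderiv ℝ v z Complex.I * k z.re) hint, ← integral_neg]
  congr 1
  ext t
  have hemb : Topology.IsClosedEmbedding fun s : ℝ => (t : ℂ) + s * Complex.I := by
    refine (Homeomorph.addLeft (t : ℂ)).isClosedEmbedding.comp ?_
    exact (Homeomorph.mulRight₀ Complex.I Complex.I_ne_zero).isClosedEmbedding.comp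
        Complex.isometry_ofReal.isClosedEmbedding
  have hd : ∀ s : ℝ, HasDerivAt (fun s : ℝ => v (t + s * Complex.I))
      (fderiv ℝ v (t + s * Complex.I) Complex.I) s := by
    intro s
    have h1 : HasDerivAt (fun s : ℝ => (t : ℂ) + s * Complex.I) Complex.I s := by
      simpa using ((Complex.ofRealCLM.hasDerivAt (x := s)).mul_const Complex.I).const_add (t : ℂ)
    exact (hv.differentiable one_ne_zero _).hasFDerivAt.comp_hasDerivAt s h1
  have h2 : ∫ s in Ioi (0 : ℝ), fderiv ℝ v (t + s * Complex.I) Complex.I =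
      0 - v (t + (0 : ℝ) * Complex.I) := by
    refine integral_Ioi_of_hasDerivAt_of_tendsto' (f := fun s : ℝ => v (t + s * Complex.I))
      (fun s _ => hd s) ?_ ?_
    · exact ((hcont.comp hemb.continuous).integrable_of_hasCompactSupport
        (hcs.comp_isClosedEmbedding hemb)).integrableOn
    · have h3 : HasCompactSupport fun s : ℝ => v (t + s * Complex.I) :=
        hc.comp_isClosedEmbedding hemb
      have h4 : Tendsto (fun s : ℝ => v (t + s * Complex.I)) (cocompact ℝ) (𝓝 0) :=
        (hasCompactSupport_iff_eventuallyEq.mp h3).tendsto.mono_left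
          (by rw [coclosedCompact_eq_cocompact])
      exact h4.mono_left _root_.atTop_le_cocompact
  have h5 : ∀ s : ℝ, ((t : ℂ) + s * Complex.I).re = t := by intro s; simp
  simp only [h5]
  rw [integral_mul_const, h2]
  simp

theorem det_complex (A : ℂ →L[ℝ] ℂ) : A.det = (conj (A 1) * A Complex.I).im := by
  rw [ContinuousLinearMap.det, ← LinearMap.det_toMatrix Complex.basisOneI, Matrix.det_fin_two]
  simp [LinearMap.toMatrix_apply]
  ring

/-- The map that straightens the arc `c` near `c t₀`: the real axis goes to `c`, and the vertical
lines go to lines in the direction of the normal at `c t₀`. -/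
noncomputable def straighten (c : ℝ → ℂ) (t₀ : ℝ) (w : ℂ) : ℂ :=
  c w.re + w.im * (Complex.I * deriv c t₀)

/-- An open box centred at `t₀` on the real axis. -/
def box (t₀ δ : ℝ) : Set ℂ := {w | |w.re - t₀| < δ ∧ |w.im| < δ}

theorem isOpen_box (t₀ δ : ℝ) : IsOpen (box t₀ δ) := by
  have h1 : IsOpen {w : ℂ | |w.re - t₀| < δ} := isOpen_lt (by fun_prop) continuous_const
  have h2 : IsOpen {w : ℂ | |w.im| < δ} := isOpen_lt (by fun_prop) continuous_const
  exact h1.inter h2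

theorem box_subset {t₀ δ δ' : ℝ} (h : δ' ≤ δ) : box t₀ δ' ⊆ box t₀ δ :=
  fun _ hw => ⟨hw.1.trans_le h, hw.2.trans_le h⟩

theorem exists_box_subset {t₀ : ℝ} {s : Set ℂ} (hs : s ∈ 𝓝 (t₀ : ℂ)) : ∃ δ > 0, box t₀ δ ⊆ s := by
  obtain ⟨ε, hε, h⟩ := Metric.mem_nhds_iff.mp hs
  refine ⟨ε / 2, by positivity, fun w hw => h ?_⟩
  rw [Metric.mem_ball, dist_eq_norm]
  have := Complex.norm_le_abs_re_add_abs_im (w - t₀)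
  simp only [Complex.sub_re, Complex.ofReal_re, Complex.sub_im, Complex.ofReal_im, sub_zero] at this
  linarith [hw.1, hw.2]

variable {c : ℝ → ℂ} {t₀ : ℝ}

theorem straighten_ofReal (t : ℝ) : straighten c t₀ t = c t := by simp [straighten]

theorem contDiff_straighten (hc : ContDiff ℝ 1 c) : ContDiff ℝ 1 (straighten c t₀) := by
  have h2 : ContDiff ℝ 1 (fun z : ℂ => z.re) := Complex.reCLM.contDiff
  have h3 : ContDiff ℝ 1 (fun z : ℂ => (z.im : ℂ)) :=
    Complex.ofRealCLM.contDiff.comp Complex.imCLM.contDiff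
  exact (hc.comp h2).add (h3.mul contDiff_const)

theorem hasFDerivAt_straighten (hc : ContDiff ℝ 1 c) (w : ℂ) :
    HasFDerivAt (straighten c t₀) ((Complex.reCLM.smulRight (deriv c w.re)) +
      (Complex.imCLM.smulRight (Complex.I * deriv c t₀))) w := by
  have h1 : HasFDerivAt (fun z : ℂ => c z.re) (Complex.reCLM.smulRight (deriv c w.re)) w := by
    have := (hc.differentiable one_ne_zero w.re).hasDerivAt.hasFDerivAt.comp w
      (Complex.reCLM.hasFDerivAt (x := w))
    refine this.congr_fderiv ?_
    ext z; simp
  have h2 : HasFDerivAt (fun z : ℂ => (z.im : ℂ) * (Complex.I * deriv c t₀))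
      (Complex.imCLM.smulRight (Complex.I * deriv c t₀)) w := by
    have := (Complex.imCLM.smulRight (Complex.I * deriv c t₀)).hasFDerivAt (x := w)
    exact this.congr_of_eventuallyEq (Eventually.of_forall fun z => by simp)
  exact h1.add h2

theorem fderiv_straighten_one (hc : ContDiff ℝ 1 c) (w : ℂ) :
    fderiv ℝ (straighten c t₀) w 1 = deriv c w.re := by
  rw [(hasFDerivAt_straighten hc w).fderiv]; simp

theorem fderiv_straighten_I (hc : ContDiff ℝ 1 c) (w : ℂ) :
    fderiv ℝ (straighten c t₀) w Complex.I = Complex.I * deriv c t₀ := by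
  rw [(hasFDerivAt_straighten hc w).fderiv]; simp

theorem det_straighten (hc : ContDiff ℝ 1 c) (w : ℂ) :
    (fderiv ℝ (straighten c t₀) w).det = (conj (deriv c w.re) * deriv c t₀).re := by
  rw [det_complex, fderiv_straighten_one hc, fderiv_straighten_I hc]
  simp

/-- On a small box the straightening map is a positively oriented coordinate system. -/
theorem exists_straightening (hc : ContDiff ℝ 1 c) (h0 : deriv c t₀ ≠ 0) :
    ∃ e : OpenPartialHomeomorph ℂ ℂ, (⇑e = straighten c t₀) ∧ ∃ δ > 0, box t₀ δ ⊆ e.source ∧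
      ∀ w ∈ box t₀ δ, 0 < (fderiv ℝ (straighten c t₀) w).det := by
  have hC := (contDiff_straighten (t₀ := t₀) hc).contDiffAt (x := (t₀ : ℂ))
  have hdet : 0 < (fderiv ℝ (straighten c t₀) t₀).det := by
    rw [det_straighten hc, Complex.ofReal_re, ← Complex.normSq_eq_conj_mul_self, Complex.ofReal_re]
    exact Complex.normSq_pos.mpr h0
  have hf : HasFDerivAt (straighten c t₀)
      ((fderiv ℝ (straighten c t₀) t₀).toContinuousLinearEquivOfDetNeZero hdet.ne' : ℂ →L[ℝ] ℂ)
      (t₀ : ℂ) := by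
    exact (hC.differentiableAt one_ne_zero).hasFDerivAt
  refine ⟨hC.toOpenPartialHomeomorph _ hf one_ne_zero, rfl, ?_⟩
  have h1 := (hC.toOpenPartialHomeomorph _ hf one_ne_zero).open_source.mem_nhds
    (hC.mem_toOpenPartialHomeomorph_source hf one_ne_zero)
  have h2 : ∀ᶠ w in 𝓝 (t₀ : ℂ), 0 < (fderiv ℝ (straighten c t₀) w).det := by
    have hcd := hc.continuous_deriv le_rfl
    simp only [det_straighten hc] at hdet ⊢
    refine ContinuousAt.eventually_lt continuousAt_const ?_ hdet
    fun_prop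
  obtain ⟨δ, hδ, h⟩ := exists_box_subset (inter_mem h1 h2)
  exact ⟨δ, hδ, fun w hw => (h hw).1, fun w hw => (h hw).2⟩

/-- Stokes' theorem for the form `u dz` on the left-hand side of a `C¹` arc, where `u` vanishes
outside the image of a box. -/
theorem integral_dbar_left_side (hc : ContDiff ℝ 1 c) {e : OpenPartialHomeomorph ℂ ℂ}
    (he : ⇑e = straighten c t₀) {δ : ℝ} (hb : box t₀ δ ⊆ e.source)
    (hdet : ∀ w ∈ box t₀ δ, 0 < (fderiv ℝ (straighten c t₀) w).det)
    {u : ℂ → ℂ} (hu : ContDiff ℝ 1 u) (huc : HasCompactSupport u)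
    (hus : tsupport u ⊆ straighten c t₀ '' box t₀ δ) :
    Complex.I * ∫ z in straighten c t₀ '' (box t₀ δ ∩ {w | 0 < w.im}), dbar u z =
      ∫ t in {t : ℝ | |t - t₀| < δ}, u (c t) * deriv c t := by
  classical
  by_cases hδ : 0 < δ
  swap
  · have hb0 : box t₀ δ = ∅ := by
      ext w
      simp only [box, mem_ofPred_eq, mem_empty_iff_false, iff_false, not_and]
      intro h
      exact absurd ((abs_nonneg _).trans_lt h) hδ
    have hs0 : {t : ℝ | |t - t₀| < δ} = ∅ := by
      ext w
      simp only [mem_ofPred_eq, mem_empty_iff_false, iff_false]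
      intro h
      exact absurd ((abs_nonneg _).trans_lt h) hδ
    simp [hb0, hs0]
  set Φ := straighten c t₀ with hΦ
  have hΦC : ContDiff ℝ 1 Φ := contDiff_straighten hc
  have hinj : InjOn Φ (box t₀ δ) := by
    rw [← he]; exact e.injOn.mono hb
  -- The pull-back of `u`, cut off outside the box.
  set v : ℂ → ℂ := (box t₀ δ).indicator (u ∘ Φ) with hv
  set K : Set ℂ := e.symm '' tsupport u with hK
  have hKe : ∀ z ∈ tsupport u, e.symm z ∈ box t₀ δ := by
    intro z hz
    obtain ⟨w, hw, rfl⟩ := hus hz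
    rw [← he, e.left_inv (hb hw)]
    exact hw
  have hKbox : K ⊆ box t₀ δ := by
    rintro _ ⟨z, hz, rfl⟩
    exact hKe z hz
  have hKc : IsCompact K := by
    refine huc.image_of_continuousOn (e.continuousOn_symm.mono ?_)
    intro z hz
    obtain ⟨w, hw, rfl⟩ := hus hz
    rw [← he]
    exact e.map_source (hb hw)
  have hvK : ∀ w, w ∉ K → v w = 0 := by
    intro w hw
    by_cases hwb : w ∈ box t₀ δ
    · rw [hv, indicator_of_mem hwb, Function.comp_apply]
      by_contra h
      refine hw ⟨Φ w, subset_tsupport u h, ?_⟩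
      rw [← he, e.left_inv (hb hwb)]
    · exact indicator_of_notMem hwb _
  have hveq : ∀ w ∈ box t₀ δ, v =ᶠ[𝓝 w] u ∘ Φ := by
    intro w hw
    filter_upwards [(isOpen_box t₀ δ).mem_nhds hw] with w' hw'
    exact indicator_of_mem hw' _
  have hvC : ContDiff ℝ 1 v := by
    rw [contDiff_iff_contDiffAt]
    intro w
    by_cases hw : w ∈ K
    · exact (hu.comp hΦC).contDiffAt.congr_of_eventuallyEq (hveq w (hKbox hw))
    · refine (contDiffAt_const (c := (0 : ℂ))).congr_of_eventuallyEq ?_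
      filter_upwards [hKc.isClosed.isOpen_compl.mem_nhds hw] with w' hw'
      exact hvK w' hw'
  have hvc : HasCompactSupport v := HasCompactSupport.intro hKc hvK
  have hB : MeasurableSet (box t₀ δ ∩ {w : ℂ | 0 < w.im}) :=
    (isOpen_box t₀ δ).measurableSet.inter
      (isOpen_lt continuous_const Complex.continuous_im).measurableSet
  rw [integral_image_eq_integral_abs_det_fderiv_smul volume hB
    (f' := fun w => fderiv ℝ Φ w)
    (fun w _ => (hΦC.differentiable one_ne_zero w).hasFDerivAt.hasFDerivWithinAt)
    (hinj.mono inter_subset_left), ← integral_const_mul]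
  have hcd : Continuous (deriv c) := hc.continuous_deriv le_rfl
  -- The pulled-back form, computed from `dz = c'(t) dt + i c'(t₀) ds`.
  have hpt : ∀ w ∈ box t₀ δ ∩ {w : ℂ | 0 < w.im},
      Complex.I * (|(fderiv ℝ Φ w).det| • dbar u (Φ w)) =
      fderiv ℝ v w 1 * (Complex.I * deriv c t₀) - fderiv ℝ v w Complex.I * deriv c w.re := by
    intro w hw
    have h1 : fderiv ℝ v w = (fderiv ℝ u (Φ w)).comp (fderiv ℝ Φ w) := by
      rw [(hveq w hw.1).fderiv_eq]
      exact fderiv_comp w (hu.differentiable one_ne_zero _) (hΦC.differentiable one_ne_zero w)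
    rw [abs_of_pos (hdet w hw.1), h1, ContinuousLinearMap.comp_apply,
      ContinuousLinearMap.comp_apply, hΦ, det_straighten hc, fderiv_straighten_one hc,
      fderiv_straighten_I hc, dbar]
    set L := fderiv ℝ u (straighten c t₀ w)
    set a := deriv c t₀
    set b := deriv c w.re
    have key : ∀ w : ℂ, L w = w.re * L 1 + w.im * L Complex.I := by
      intro w
      have e : w = w.re • (1 : ℂ) + w.im • Complex.I := by simp [Complex.re_add_im]
      conv_lhs => rw [e]
      rw [map_add, map_smul, map_smul, Complex.real_smul, Complex.real_smul]
    rw [key b, key (Complex.I * a), Complex.real_smul]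
    have ea : a = a.re + a.im * Complex.I := (Complex.re_add_im a).symm
    have eb : b = b.re + b.im * Complex.I := (Complex.re_add_im b).symm
    have h2 : (conj b * a).re = b.re * a.re + b.im * a.im := by simp
    have h3 : (Complex.I * a).re = -a.im := by simp
    have h4 : (Complex.I * a).im = a.re := by simp
    rw [h2, h3, h4]
    generalize a.re = a1 at *
    generalize a.im = a2 at *
    generalize b.re = b1 at *
    generalize b.im = b2 at *
    rw [ea, eb]
    push_cast
    ring_nf
    simp only [Complex.I_sq]
    ring
  rw [setIntegral_congr_fun hB hpt]
  have hf1 : Continuous fun z => fderiv ℝ v z 1 :=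
    (hvC.continuous_fderiv one_ne_zero).clm_apply continuous_const
  have hfI : Continuous fun z => fderiv ℝ v z Complex.I :=
    (hvC.continuous_fderiv one_ne_zero).clm_apply continuous_const
  have hi1 : Integrable fun w => fderiv ℝ v w 1 * (Complex.I * deriv c t₀) :=
    (hf1.mul continuous_const).integrable_of_hasCompactSupport (hvc.fderiv_apply ℝ 1).mul_right
  have hiI : Integrable fun w => fderiv ℝ v w Complex.I * deriv c w.re :=
    (hfI.mul (hcd.comp Complex.continuous_re)).integrable_of_hasCompactSupport
      (hvc.fderiv_apply ℝ _).mul_right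
  have hout : ∀ w ∈ {w : ℂ | 0 < w.im} \ (box t₀ δ ∩ {w : ℂ | 0 < w.im}),
      fderiv ℝ v w 1 * (Complex.I * deriv c t₀) - fderiv ℝ v w Complex.I * deriv c w.re = 0 := by
    intro w hw
    have hwb : w ∉ tsupport v := by
      intro h
      have : tsupport v ⊆ K :=
        closure_minimal (fun w h => by_contra fun h' => h (hvK w h')) hKc.isClosed
      exact hw.2 ⟨hKbox (this h), hw.1⟩
    rw [fderiv_of_notMem_tsupport ℝ hwb]
    simp
  rw [← setIntegral_eq_of_subset_of_forall_sdiff_eq_zero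
    (isOpen_lt continuous_const Complex.continuous_im).measurableSet inter_subset_right hout,
    integral_sub hi1.integrableOn hiI.integrableOn, integral_mul_const,
    integral_halfPlane_fderiv_one hvC hvc, integral_halfPlane_fderiv_I hvC hvc hcd, zero_mul,
    zero_sub, neg_neg]
  have hms : MeasurableSet {t : ℝ | |t - t₀| < δ} :=
    (isOpen_lt (by fun_prop) (by fun_prop)).measurableSet
  rw [← integral_indicator hms]
  congr 1
  ext t
  by_cases ht : |t - t₀| < δ
  · rw [indicator_of_mem (show t ∈ {t : ℝ | |t - t₀| < δ} from ht), hv,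
      indicator_of_mem (by simpa [box, hδ] using ht), Function.comp_apply, hΦ, straighten_ofReal]
  · rw [indicator_of_notMem (show t ∉ {t : ℝ | |t - t₀| < δ} from ht), hv,
      indicator_of_notMem (by simpa [box, hδ] using ht), zero_mul]

/-! ### Curves in charts -/

section Curves

variable {X : Type*} [TopologicalSpace X] [ChartedSpace ℂ X]

theorem isManifold_real [IsManifold 𝓘(ℂ, ℂ) ω X] : IsManifold 𝓘(ℝ, ℂ) ∞ X := by
  refine isManifold_of_contDiffOn 𝓘(ℝ, ℂ) ∞ X fun e e' he he' => ?_
  have h := HasGroupoid.compatible (G := contDiffGroupoid ω 𝓘(ℂ, ℂ)) he he'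
  rw [contDiffGroupoid, mem_groupoid_of_pregroupoid] at h
  have h1 : ContDiffOn ℂ ω _ _ := h.1
  exact (h1.restrict_scalars ℝ).of_le (by simp)

theorem IsSimpleClosedCurve.continuous {γ : ℝ → X} (hγ : IsSimpleClosedCurve γ) : Continuous γ :=
  hγ.contMDiff.continuous

theorem IsSimpleClosedCurve.image_Icc {γ : ℝ → X} (hγ : IsSimpleClosedCurve γ) (t₀ : ℝ) :
    γ '' Icc t₀ (t₀ + 1) = range γ := hγ.periodic.image_Icc one_pos t₀

theorem IsSimpleClosedCurve.isCompact_range {γ : ℝ → X} (hγ : IsSimpleClosedCurve γ) :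
    IsCompact (range γ) := by
  rw [← hγ.image_Icc 0]
  exact isCompact_Icc.image hγ.continuous

theorem IsSimpleClosedCurve.eq_of_mem_Ico {γ : ℝ → X} (hγ : IsSimpleClosedCurve γ) {t t₀ : ℝ}
    (ht : |t - t₀| < 1) (h : γ t = γ t₀) : t = t₀ := by
  have hfract : Int.fract t = Int.fract t₀ := by
    apply hγ.injOn ⟨Int.fract_nonneg _, Int.fract_lt_one _⟩ ⟨Int.fract_nonneg _, Int.fract_lt_one _⟩
    have e : ∀ s : ℝ, γ (Int.fract s) = γ s := by
      intro s
      have := hγ.periodic.sub_int_mul_eq (x := s) ⌊s⌋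
      rwa [mul_one] at this
    rw [e, e, h]
  obtain ⟨z, hz⟩ := Int.fract_eq_fract.mp hfract
  rw [hz, ← Int.cast_abs] at ht
  have : |z| < 1 := by exact_mod_cast ht
  rw [Int.abs_lt_one_iff.mp this] at hz
  simpa [sub_eq_zero] using hz

theorem velocity_eq {γ : ℝ → X} (hγ : IsSimpleClosedCurve γ) (t : ℝ) :
    (velocity γ t : ℂ) = deriv (fun s => chartAt ℂ (γ t) (γ s)) t := by
  have h : MDifferentiableAt 𝓘(ℝ, ℝ) 𝓘(ℝ, ℂ) γ t :=
    (hγ.contMDiff t).mdifferentiableAt one_ne_zero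
  rw [velocity, h.mfderiv]
  simp only [writtenInExtChartAt, mfld_simps, fderivWithin_univ]
  rfl

theorem IsSimpleClosedCurve.deriv_ne_zero {γ : ℝ → X} (hγ : IsSimpleClosedCurve γ) (t : ℝ) :
    deriv (fun s => chartAt ℂ (γ t) (γ s)) t ≠ 0 := by
  rw [← velocity_eq hγ]
  exact hγ.velocity_ne_zero t

theorem clm_apply_eq {x : X} (L : TangentSpace 𝓘(ℂ, ℂ) x →L[ℂ] ℂ) (v : ℂ) :
    L v = L (1 : ℂ) * v := by
  let L' : ℂ →L[ℂ] ℂ := L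
  change L' v = L' 1 * v
  rw [mul_comm, ← smul_eq_mul, ← L'.map_smul, smul_eq_mul, mul_one]

theorem IsSimpleClosedCurve.periodic_apply_velocity {γ : ℝ → X} (hγ : IsSimpleClosedCurve γ)
    (η : Differential X) : Function.Periodic (fun s => η (γ s) (velocity γ s)) 1 := by
  intro t
  have h1 : ∀ s, η (γ s) (velocity γ s) =
      η (γ s) (1 : ℂ) * deriv (fun r => chartAt ℂ (γ s) (γ r)) s := fun s => by
    rw [← velocity_eq hγ]; exact clm_apply_eq _ _
  simp only [h1]
  rw [hγ.periodic t, ← deriv_comp_add_const]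
  congr 2
  ext r
  rw [hγ.periodic r]

variable [IsManifold 𝓘(ℂ, ℂ) ω X]

theorem IsSimpleClosedCurve.contDiffAt {γ : ℝ → X} (hγ : IsSimpleClosedCurve γ) {p : X} {t : ℝ}
    (ht : γ t ∈ (chartAt ℂ p).source) : ContDiffAt ℝ 1 (fun s => chartAt ℂ p (γ s)) t := by
  have : IsManifold 𝓘(ℝ, ℂ) 1 X :=
    have := isManifold_real (X := X)
    IsManifold.of_le (n := ∞) (by simp)
  have h := (contMDiffAt_iff_of_mem_source (I := 𝓘(ℝ, ℝ)) (I' := 𝓘(ℝ, ℂ)) (n := 1)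
    (x := t) (x' := t) (y := p) (f := γ) (mem_chart_source ℝ t) ht).mp (hγ.contMDiff t)
  have h2 := h.2
  simp only [mfld_simps] at h2
  exact h2.contDiffAt univ_mem

theorem IsSimpleClosedCurve.apply_velocity {γ : ℝ → X} (hγ : IsSimpleClosedCurve γ) {p : X} {t : ℝ}
    (ht : γ t ∈ (chartAt ℂ p).source) (η : Differential X) :
    η (γ t) (velocity γ t) = η.coeff p (chartAt ℂ p (γ t)) *
      deriv (fun s => chartAt ℂ p (γ s)) t := by
  have h1 := clm_apply_eq (η (γ t)) (velocity γ t)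
  have hsrc := mem_chart_source ℂ (γ t)
  have hz := (chartAt ℂ p).map_source ht
  have hq : (chartAt ℂ p).symm (chartAt ℂ p (γ t)) ∈ (chartAt ℂ (γ t)).source := by
    rw [(chartAt ℂ p).left_inv ht]; exact hsrc
  rw [h1, velocity_eq hγ, ← coeff_self, coeff_trans η hz hq, trans_chart ht, mul_assoc]
  congr 1
  have h2 : (fun s => chartAt ℂ (γ t) (γ s)) =ᶠ[𝓝 t]
      (trans p (γ t)) ∘ (fun s => chartAt ℂ p (γ s)) := by
    filter_upwards [hγ.continuous.continuousAt.preimage_mem_nhds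
      ((chartAt ℂ p).open_source.mem_nhds ht)] with s hs
    exact (trans_chart hs).symm
  rw [h2.deriv_eq]
  exact ((differentiableAt_trans hz hq).hasDerivAt.scomp t
    ((hγ.contDiffAt ht).differentiableAt one_ne_zero).hasDerivAt).deriv.trans (mul_comm _ _)

theorem IsSimpleClosedCurve.continuousAt_apply_velocity {γ : ℝ → X} (hγ : IsSimpleClosedCurve γ)
    {t : ℝ} {η : Differential X} (h : HolAt η (γ t)) :
    ContinuousAt (fun s => η (γ s) (velocity γ s)) t := by
  have hsrc := mem_chart_source ℂ (γ t)
  have h1 : ∀ᶠ s in 𝓝 t, γ s ∈ (chartAt ℂ (γ t)).source :=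
    hγ.continuous.continuousAt.preimage_mem_nhds ((chartAt ℂ (γ t)).open_source.mem_nhds hsrc)
  have h2 : ContinuousAt (fun s => η.coeff (γ t) (chartAt ℂ (γ t) (γ s)) *
      deriv (fun s => chartAt ℂ (γ t) (γ s)) s) t := by
    have hc := hγ.contDiffAt hsrc
    refine ContinuousAt.mul ?_ ?_
    · exact ContinuousAt.comp (g := η.coeff (γ t)) h.continuousAt hc.continuousAt
    · exact (hc.derivWithin (m := 0) (by simp)).continuousAt
  exact h2.congr (h1.mono fun s hs => (hγ.apply_velocity hs η).symm)

theorem IsSimpleClosedCurve.continuous_apply_velocity {γ : ℝ → X} (hγ : IsSimpleClosedCurve γ)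
    {η : Differential X} (h : ∀ t, HolAt η (γ t)) :
    Continuous (fun s => η (γ s) (velocity γ s)) :=
  continuous_iff_continuousAt.mpr fun t => hγ.continuousAt_apply_velocity (h t)

end Curves

/-! ### Regions bounded by curves -/

theorem exists_eq_of_periodic {α : Type*} {γ : ℝ → α} (h : Function.Periodic γ 1) (t t₀ : ℝ) :
    ∃ s, γ s = γ t ∧ |s - t₀| ≤ 1 / 2 := by
  refine ⟨t - round (t - t₀), ?_, ?_⟩
  · have := h.sub_int_mul_eq (x := t) (round (t - t₀))
    rwa [mul_one] at this
  · have := abs_sub_round (t - t₀)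
    rwa [show t - round (t - t₀) - t₀ = t - t₀ - round (t - t₀) by ring]

theorem isPreconnected_subset_or {Y : Type*} [TopologicalSpace Y] {D S : Set Y} (hD : IsOpen D)
    (hS : IsPreconnected S)
    (h : Disjoint S (frontier D)) : S ⊆ D ∨ S ⊆ (closure D)ᶜ := by
  have hc : IsOpen (closure D)ᶜ := isClosed_closure.isOpen_compl
  refine hS.subset_or_subset hD hc ?_ ?_
  · exact disjoint_compl_right.mono_left subset_closure
  · intro x hx
    by_cases hxD : x ∈ closure D
    · left
      by_contra hx'
      exact h.le_bot ⟨hx, by rw [hD.frontier_eq]; exact ⟨hxD, hx'⟩⟩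
    · exact Or.inr hxD

section Boundary

variable {X : Type*} [TopologicalSpace X] [ChartedSpace ℂ X] {ι : Type*}

/-- The open set `D` has as frontier the disjoint simple closed curves `γ k`, which have `D` on
their left. The set `D` may still lie on both sides of a curve. -/
structure IsBoundedBy (D : Set X) (γ : ι → ℝ → X) : Prop where
  isOpen : IsOpen D
  curve : ∀ k, IsSimpleClosedCurve (γ k)
  disj : ∀ k l, k ≠ l → Disjoint (range (γ k)) (range (γ l))
  left : ∀ k, LiesOnLeft D (γ k)
  frontier_eq : frontier D = ⋃ k, range (γ k)

/-- A coordinate box around the point `γ k t₀` of the boundary of `D`, in which the curve is the real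
axis and `D` contains the upper half. -/
structure BoundaryBox (D : Set X) (γ : ι → ℝ → X) (k : ι) (t₀ : ℝ) where
  /-- The curve in the chart around `γ k t₀`. -/
  c : ℝ → ℂ
  /-- The size of the box. -/
  δ : ℝ
  /-- The straightening map as a homeomorphism. -/
  e : OpenPartialHomeomorph ℂ ℂ
  contDiff : ContDiff ℝ 1 c
  pos : 0 < δ
  le_half : δ ≤ 1 / 2
  coe_e : ⇑e = straighten c t₀
  subset_source : box t₀ δ ⊆ e.source
  det_pos : ∀ w ∈ box t₀ δ, 0 < (fderiv ℝ (straighten c t₀) w).det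
  image_subset : straighten c t₀ '' box t₀ δ ⊆ (chartAt ℂ (γ k t₀)).target
  c_eq : ∀ t, |t - t₀| < δ → γ k t ∈ (chartAt ℂ (γ k t₀)).source ∧ c t = chartAt ℂ (γ k t₀) (γ k t)
  mem_curve : ∀ w ∈ box t₀ δ, ∀ l t, γ l t = (chartAt ℂ (γ k t₀)).symm (straighten c t₀ w) →
    l = k ∧ (|t - t₀| ≤ 1 / 2 → (t : ℂ) = w)
  upper : ∀ w ∈ box t₀ δ, 0 < w.im → (chartAt ℂ (γ k t₀)).symm (straighten c t₀ w) ∈ D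
  lower : (∀ w ∈ box t₀ δ, w.im < 0 → (chartAt ℂ (γ k t₀)).symm (straighten c t₀ w) ∈ D) ∨
    (∀ w ∈ box t₀ δ, w.im < 0 → (chartAt ℂ (γ k t₀)).symm (straighten c t₀ w) ∈ (closure D)ᶜ)

theorem exists_contDiff_eq_near {f : ℝ → ℂ} {t₀ ε : ℝ} (hε : 0 < ε)
    (hf : ∀ t, |t - t₀| < ε → ContDiffAt ℝ 1 f t) :
    ∃ c : ℝ → ℂ, ContDiff ℝ 1 c ∧ ∀ t, |t - t₀| < ε / 4 → c t = f t := by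
  let b : ContDiffBump t₀ := ⟨ε / 4, ε / 2, by positivity, by linarith⟩
  refine ⟨fun t => b t • f t, ?_, fun t ht => ?_⟩
  · rw [contDiff_iff_contDiffAt]
    intro t
    by_cases ht : |t - t₀| < ε
    · exact b.contDiffAt.smul (hf t ht)
    · refine (contDiffAt_const (c := (0 : ℂ))).congr_of_eventuallyEq ?_
      have hts : t ∉ tsupport b := by
        rw [b.tsupport_eq, Metric.mem_closedBall, Real.dist_eq]
        change ¬ |t - t₀| ≤ ε / 2
        linarith
      filter_upwards [notMem_tsupport_iff_eventuallyEq.mp hts] with s hs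
      rw [hs]; simp
  · have : b t = 1 := b.one_of_mem_closedBall (by
      rw [Metric.mem_closedBall, Real.dist_eq]
      exact ht.le)
    simp [this]

theorem isPreconnected_upper_box (t₀ δ : ℝ) : IsPreconnected (box t₀ δ ∩ {w | 0 < w.im}) := by
  apply Convex.isPreconnected
  intro x hx y hy a b ha hb hab
  simp only [box, mem_inter_iff, mem_ofPred_eq, abs_lt] at hx hy ⊢
  simp only [Complex.add_re, Complex.add_im, Complex.real_smul, Complex.mul_re, Complex.ofReal_re,
    Complex.ofReal_im, zero_mul, sub_zero, Complex.mul_im, add_zero]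
  obtain rfl : b = 1 - a := by linarith
  rcases ha.eq_or_lt with rfl | ha
  · simpa using hy
  · refine ⟨⟨⟨?_, ?_⟩, ?_, ?_⟩, ?_⟩ <;> nlinarith

theorem isPreconnected_lower_box (t₀ δ : ℝ) : IsPreconnected (box t₀ δ ∩ {w | w.im < 0}) := by
  apply Convex.isPreconnected
  intro x hx y hy a b ha hb hab
  simp only [box, mem_inter_iff, mem_ofPred_eq, abs_lt] at hx hy ⊢
  simp only [Complex.add_re, Complex.add_im, Complex.real_smul, Complex.mul_re, Complex.ofReal_re,
    Complex.ofReal_im, zero_mul, sub_zero, Complex.mul_im, add_zero]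
  obtain rfl : b = 1 - a := by linarith
  rcases ha.eq_or_lt with rfl | ha
  · simpa using hy
  · refine ⟨⟨⟨?_, ?_⟩, ?_, ?_⟩, ?_⟩ <;> nlinarith

variable [T2Space X] [IsManifold 𝓘(ℂ, ℂ) ω X] [Finite ι]

theorem IsBoundedBy.nonempty_boundaryBox {D : Set X} {γ : ι → ℝ → X} (h : IsBoundedBy D γ) (k : ι)
    (t₀ : ℝ) : Nonempty (BoundaryBox D γ k t₀) := by
  have hγ := h.curve k
  set p := γ k t₀ with hp
  set φ := chartAt ℂ p with hφ
  have hps : p ∈ φ.source := mem_chart_source ℂ p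
  -- the curve in the chart, extended to a globally differentiable curve
  obtain ⟨ε, hε, hεs⟩ : ∃ ε > 0, ∀ t, |t - t₀| < ε → γ k t ∈ φ.source := by
    obtain ⟨ε, hε, h1⟩ := Metric.mem_nhds_iff.mp
      (hγ.continuous.continuousAt.preimage_mem_nhds (φ.open_source.mem_nhds hps))
    exact ⟨ε, hε, fun t ht => h1 (by rwa [Metric.mem_ball, Real.dist_eq])⟩
  obtain ⟨c, hc, hcε⟩ := exists_contDiff_eq_near (f := fun t => φ (γ k t)) hε
    (fun t ht => hγ.contDiffAt (hεs t ht))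
  have hc0 : c t₀ = φ p := hcε t₀ (by simpa using hε)
  have hcev : c =ᶠ[𝓝 t₀] fun t => φ (γ k t) := by
    filter_upwards [Metric.ball_mem_nhds t₀ (show 0 < ε / 4 by positivity)] with t ht
    exact hcε t (by rwa [Metric.mem_ball, Real.dist_eq] at ht)
  have hd : deriv c t₀ = deriv (fun t => φ (γ k t)) t₀ := hcev.deriv_eq
  have hd0 : deriv c t₀ ≠ 0 := by rw [hd]; exact hγ.deriv_ne_zero t₀
  obtain ⟨e, he, δ₀, hδ₀, hsrc, hdet⟩ := exists_straightening hc hd0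
  set Φ := straighten c t₀ with hΦ
  have hΦc : Continuous Φ := (contDiff_straighten hc).continuous
  have hΦ0 : Φ t₀ = φ p := by rw [hΦ, straighten_ofReal, hc0]
  have htgt : Φ ⁻¹' φ.target ∈ 𝓝 (t₀ : ℂ) :=
    hΦc.continuousAt.preimage_mem_nhds (φ.open_target.mem_nhds (by rw [hΦ0]; exact φ.map_source hps))
  obtain ⟨δ₃, hδ₃, htgt'⟩ := exists_box_subset htgt
  set δ₁ := min (min δ₀ δ₃) (min (ε / 4) (1 / 2)) with hδ₁
  have hδ₁pos : 0 < δ₁ := by positivity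
  -- the rest of the curves stays away from the point
  set K : Set X := (⋃ l ∈ {l | l ≠ k}, range (γ l)) ∪
    γ k '' {t | δ₁ ≤ |t - t₀| ∧ |t - t₀| ≤ 1 / 2} with hK
  have hKc : IsClosed K := by
    refine IsClosed.union ?_ ?_
    · exact (toFinite _).isClosed_biUnion fun l _ => (h.curve l).isCompact_range.isClosed
    · refine IsCompact.isClosed (IsCompact.image ?_ hγ.continuous)
      refine (isCompact_closedBall t₀ (1 / 2)).of_isClosed_subset ?_ ?_
      · have h1 : IsClosed {t : ℝ | δ₁ ≤ |t - t₀|} := isClosed_le continuous_const (by fun_prop)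
        have h2 : IsClosed {t : ℝ | |t - t₀| ≤ 1 / 2} := isClosed_le (by fun_prop) continuous_const
        exact h1.inter h2
      · intro t ht
        rw [Metric.mem_closedBall, Real.dist_eq]
        exact ht.2
  have hpK : p ∉ K := by
    rintro (hx | ⟨t, ht, hx⟩)
    · simp only [mem_iUnion] at hx
      obtain ⟨l, hl, hx⟩ := hx
      exact (h.disj l k hl).le_bot ⟨hx, t₀, rfl⟩
    · have := hγ.eq_of_mem_Ico (t₀ := t₀) (by linarith [ht.2]) hx
      rw [this] at ht
      have h1 := ht.1
      rw [sub_self, abs_zero] at h1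
      linarith
  have hnK : ∀ᶠ w in 𝓝 (t₀ : ℂ), φ.symm (Φ w) ∈ Kᶜ := by
    have h1 : ContinuousAt (fun w => φ.symm (Φ w)) t₀ :=
      ContinuousAt.comp (g := φ.symm)
        (φ.continuousAt_symm (by rw [hΦ0]; exact φ.map_source hps)) hΦc.continuousAt
    refine h1.eventually (hKc.isOpen_compl.mem_nhds ?_)
    change φ.symm (Φ t₀) ∈ Kᶜ
    rw [hΦ0, φ.left_inv hps]
    exact hpK
  obtain ⟨δ₂, hδ₂, hbK⟩ := exists_box_subset hnK
  set δ := min δ₁ δ₂ with hδ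
  have hδpos : 0 < δ := by positivity
  have h01 : δ ≤ δ₀ := (min_le_left _ _).trans ((min_le_left _ _).trans (min_le_left _ _))
  have h03 : δ ≤ δ₃ := (min_le_left _ _).trans ((min_le_left _ _).trans (min_le_right _ _))
  have h10 : δ₁ ≤ δ₀ := (min_le_left _ _).trans (min_le_left _ _)
  have h14 : δ₁ ≤ ε / 4 := (min_le_right _ _).trans (min_le_left _ _)
  have hinj : InjOn Φ (box t₀ δ₀) := by rw [← he]; exact e.injOn.mono hsrc
  have hceq : ∀ t, |t - t₀| < δ₁ → γ k t ∈ φ.source ∧ c t = φ (γ k t) := fun t ht =>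
    ⟨hεs t (by linarith), hcε t (by linarith)⟩
  have hmem : ∀ w ∈ box t₀ δ, ∀ l t, γ l t = φ.symm (Φ w) →
      l = k ∧ (|t - t₀| ≤ 1 / 2 → (t : ℂ) = w) := by
    intro w hw l t hlt
    have hwK : φ.symm (Φ w) ∉ K := hbK (box_subset (min_le_right _ _) hw)
    have hlk : l = k := by
      by_contra hlk
      exact hwK (Or.inl (by
        rw [← hlt]
        simp only [mem_iUnion]
        exact ⟨l, hlk, t, rfl⟩))
    subst hlk
    refine ⟨rfl, fun ht => ?_⟩
    have htδ : |t - t₀| < δ₁ := by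
      by_contra htn
      exact hwK (Or.inr ⟨t, ⟨not_lt.mp htn, ht⟩, hlt⟩)
    obtain ⟨h1, h2⟩ := hceq t htδ
    have hwt : Φ w ∈ φ.target := htgt' (box_subset h03 hw)
    refine hinj ?_ (box_subset h01 hw) ?_
    · simpa [box, hδ₀] using htδ.trans_le h10
    · rw [hΦ, straighten_ofReal, h2, hlt, φ.right_inv hwt]
  have hoff : ∀ w ∈ box t₀ δ, w.im ≠ 0 → φ.symm (Φ w) ∉ frontier D := by
    intro w hw him hfr
    rw [h.frontier_eq] at hfr
    obtain ⟨l, t, hlt⟩ := mem_iUnion.mp hfr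
    obtain ⟨s, hs, hs'⟩ := exists_eq_of_periodic (h.curve l).periodic t t₀
    have := (hmem w hw l s (hs.trans hlt)).2 hs'
    rw [← this] at him
    simp at him
  have hcontOn : ContinuousOn (fun w => φ.symm (Φ w)) (box t₀ δ) := by
    refine φ.continuousOn_symm.comp hΦc.continuousOn fun w hw => htgt' (box_subset h03 hw)
  have hup := isPreconnected_subset_or h.isOpen
    ((isPreconnected_upper_box t₀ δ).image _ (hcontOn.mono inter_subset_left)) (by
      rw [Set.disjoint_left]
      rintro _ ⟨w, hw, rfl⟩
      exact hoff w hw.1 (ne_of_gt hw.2))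
  have hlo := isPreconnected_subset_or h.isOpen
    ((isPreconnected_lower_box t₀ δ).image _ (hcontOn.mono inter_subset_left)) (by
      rw [Set.disjoint_left]
      rintro _ ⟨w, hw, rfl⟩
      exact hoff w hw.1 (ne_of_lt hw.2))
  -- one point of the upper half of the box lies in `D`, because `D` is on the left of the curve
  obtain ⟨w₀, hw₀, hw₀D⟩ : ∃ w ∈ box t₀ δ ∩ {w | 0 < w.im}, φ.symm (Φ w) ∈ D := by
    have h1 := h.left k t₀
    have h2 : ∀ᶠ r : ℝ in 𝓝[>] 0, r < δ := mem_nhdsWithin_of_mem_nhds (Iio_mem_nhds hδpos)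
    obtain ⟨r, ⟨hr1, hr2⟩, hr3⟩ := ((h1.and h2).and self_mem_nhdsWithin).exists
    refine ⟨t₀ + r * Complex.I, ⟨⟨?_, ?_⟩, ?_⟩, ?_⟩
    · simpa using hδpos
    · have : (0 : ℝ) < r := hr3
      simpa [abs_of_pos this] using hr2
    · simpa using hr3
    · let v : ℂ := velocity (γ k) t₀
      have hv : v = deriv (fun t => φ (γ k t)) t₀ := velocity_eq hγ t₀
      have : Φ (t₀ + r * Complex.I) = φ p + (r : ℂ) * (Complex.I * v) := by
        rw [hv, hΦ, straighten]
        simp [hc0, hd, hφ, hp]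
      rw [this]
      exact hr1
  refine ⟨⟨c, δ, e, hc, hδpos,
    (min_le_left _ _).trans ((min_le_right _ _).trans (min_le_right _ _)), he,
    (box_subset h01).trans hsrc,
    fun w hw => hdet w (box_subset h01 hw), ?_, fun t ht => hceq t (ht.trans_le (min_le_left _ _)),
    hmem, ?_, ?_⟩⟩
  · rintro _ ⟨w, hw, rfl⟩
    exact htgt' (box_subset h03 hw)
  · intro w hw him
    rcases hup with hup | hup
    · exact hup ⟨w, ⟨hw, him⟩, rfl⟩
    · exact absurd (subset_closure hw₀D) (hup ⟨w₀, hw₀, rfl⟩)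
  · rcases hlo with hlo | hlo
    · exact Or.inl fun w hw him => hlo ⟨w, ⟨hw, him⟩, rfl⟩
    · exact Or.inr fun w hw him => hlo ⟨w, ⟨hw, him⟩, rfl⟩

end Boundary

/-! ### Boundary boxes -/

section Boundary

variable {X : Type*} [TopologicalSpace X] [ChartedSpace ℂ X] {ι : Type*}
  {D : Set X} {γ : ι → ℝ → X} {k : ι} {t₀ : ℝ}

/-- The neighbourhood of `γ k t₀` with coordinate box `b`. -/
def BoundaryBox.nhd (b : BoundaryBox D γ k t₀) : Set X :=
  (chartAt ℂ (γ k t₀)).source ∩ chartAt ℂ (γ k t₀) ⁻¹' (straighten b.c t₀ '' box t₀ b.δ)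

theorem BoundaryBox.isOpen_image (b : BoundaryBox D γ k t₀) :
    IsOpen (straighten b.c t₀ '' box t₀ b.δ) := by
  rw [← b.coe_e]
  exact b.e.isOpen_image_of_subset_source (isOpen_box t₀ b.δ) b.subset_source

theorem BoundaryBox.isOpen_nhd (b : BoundaryBox D γ k t₀) : IsOpen b.nhd :=
  (chartAt ℂ (γ k t₀)).isOpen_inter_preimage b.isOpen_image

theorem BoundaryBox.straighten_eq (b : BoundaryBox D γ k t₀) {t : ℝ} (ht : |t - t₀| < b.δ) :
    straighten b.c t₀ t = chartAt ℂ (γ k t₀) (γ k t) := by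
  rw [straighten_ofReal, (b.c_eq t ht).2]

theorem BoundaryBox.mem_nhd_curve (b : BoundaryBox D γ k t₀) {t : ℝ} (ht : |t - t₀| < b.δ) :
    γ k t ∈ b.nhd :=
  ⟨(b.c_eq t ht).1, t, by simpa [box, b.pos] using ht, b.straighten_eq ht⟩

theorem BoundaryBox.mem_nhd_self (b : BoundaryBox D γ k t₀) : γ k t₀ ∈ b.nhd :=
  b.mem_nhd_curve (by simpa using b.pos)

theorem BoundaryBox.exists_of_mem_nhd (b : BoundaryBox D γ k t₀) {x : X} (hx : x ∈ b.nhd) :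
    ∃ w ∈ box t₀ b.δ, x = (chartAt ℂ (γ k t₀)).symm (straighten b.c t₀ w) := by
  obtain ⟨h1, w, hw, h2⟩ := hx
  exact ⟨w, hw, by rw [h2, (chartAt ℂ (γ k t₀)).left_inv h1]⟩

theorem BoundaryBox.eq_of_curve_mem (b : BoundaryBox D γ k t₀) {l : ι} {t : ℝ}
    (h : γ l t ∈ b.nhd) : l = k ∧ (|t - t₀| ≤ 1 / 2 → |t - t₀| < b.δ) := by
  obtain ⟨w, hw, hx⟩ := b.exists_of_mem_nhd h
  obtain ⟨h1, h2⟩ := b.mem_curve w hw l t hx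
  refine ⟨h1, fun ht => ?_⟩
  have := h2 ht
  rw [← this] at hw
  simpa using hw.1

theorem BoundaryBox.mem_frontier (b : BoundaryBox D γ k t₀) (h : IsBoundedBy D γ) {w : ℂ}
    (hw : w ∈ box t₀ b.δ) (him : w.im = 0) :
    (chartAt ℂ (γ k t₀)).symm (straighten b.c t₀ w) ∈ frontier D := by
  have e : w = (w.re : ℂ) := Complex.ext rfl (by simp [him])
  have ht : |w.re - t₀| < b.δ := hw.1
  rw [h.frontier_eq, e, b.straighten_eq ht, (chartAt ℂ (γ k t₀)).left_inv (b.c_eq _ ht).1]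
  exact mem_iUnion.mpr ⟨k, mem_range_self _⟩

theorem BoundaryBox.lower_of_notMem_interior (b : BoundaryBox D γ k t₀) (h : IsBoundedBy D γ)
    (hx : γ k t₀ ∉ interior (closure D)) :
    ∀ w ∈ box t₀ b.δ, w.im < 0 → (chartAt ℂ (γ k t₀)).symm (straighten b.c t₀ w) ∈ (closure D)ᶜ := by
  refine b.lower.resolve_left fun hlow => hx ?_
  refine mem_interior.mpr ⟨b.nhd, fun x hx => ?_, b.isOpen_nhd, b.mem_nhd_self⟩
  obtain ⟨w, hw, rfl⟩ := b.exists_of_mem_nhd hx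
  rcases lt_trichotomy w.im 0 with him | him | him
  · exact subset_closure (hlow w hw him)
  · exact frontier_subset_closure (b.mem_frontier h hw him)
  · exact subset_closure (b.upper w hw him)

/-- The open set `D` is a region with boundary curves `γ k`: it lies on the left of each curve, and
only there. -/
structure IsRegularBoundary (D : Set X) (γ : ι → ℝ → X) : Prop extends IsBoundedBy D γ where
  exterior : ∀ k t, γ k t ∉ interior (closure D)

theorem BoundaryBox.mem_iff (b : BoundaryBox D γ k t₀) (h : IsRegularBoundary D γ) {w : ℂ}
    (hw : w ∈ box t₀ b.δ) :
    (chartAt ℂ (γ k t₀)).symm (straighten b.c t₀ w) ∈ D ↔ 0 < w.im := by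
  refine ⟨fun hD => ?_, b.upper w hw⟩
  rcases lt_trichotomy w.im 0 with him | him | him
  · exact absurd (subset_closure hD)
      (b.lower_of_notMem_interior h.toIsBoundedBy (h.exterior k t₀) w hw him)
  · have := b.mem_frontier h.toIsBoundedBy hw him
    rw [h.isOpen.frontier_eq] at this
    exact absurd hD this.2
  · exact him

/-- Stokes' theorem in a boundary box, for the form `u dz` with `u` supported in the box. -/
theorem BoundaryBox.integral_dbar (b : BoundaryBox D γ k t₀) (h : IsRegularBoundary D γ)
    {u : ℂ → ℂ} (hu : ContDiff ℝ 1 u) (huc : HasCompactSupport u)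
    (hus : tsupport u ⊆ straighten b.c t₀ '' box t₀ b.δ) :
    Complex.I * ∫ z in straighten b.c t₀ '' box t₀ b.δ,
        dbar u z * D.indicator 1 ((chartAt ℂ (γ k t₀)).symm z) =
      ∫ t in {t : ℝ | |t - t₀| < b.δ}, u (chartAt ℂ (γ k t₀) (γ k t)) *
        deriv (fun s => chartAt ℂ (γ k t₀) (γ k s)) t := by
  have hopen : IsOpen (straighten b.c t₀ '' (box t₀ b.δ ∩ {w : ℂ | 0 < w.im})) := by
    rw [← b.coe_e]
    exact b.e.isOpen_image_of_subset_source ((isOpen_box t₀ b.δ).inter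
      (isOpen_lt continuous_const Complex.continuous_im)) (inter_subset_left.trans b.subset_source)
  have hsub : straighten b.c t₀ '' (box t₀ b.δ ∩ {w : ℂ | 0 < w.im}) ⊆
    straighten b.c t₀ '' box t₀ b.δ := image_mono inter_subset_left
  have h1 : ∫ z in straighten b.c t₀ '' box t₀ b.δ,
        dbar u z * D.indicator 1 ((chartAt ℂ (γ k t₀)).symm z) =
      ∫ z in straighten b.c t₀ '' (box t₀ b.δ ∩ {w : ℂ | 0 < w.im}), dbar u z := by
    rw [← integral_indicator b.isOpen_image.measurableSet,
      ← integral_indicator hopen.measurableSet]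
    congr 1
    ext z
    by_cases hz : z ∈ straighten b.c t₀ '' box t₀ b.δ
    · rw [indicator_of_mem hz]
      obtain ⟨w, hw, rfl⟩ := hz
      by_cases him : 0 < w.im
      · rw [indicator_of_mem ((b.mem_iff h hw).mpr him),
          indicator_of_mem (mem_image_of_mem _
            (show w ∈ box t₀ b.δ ∩ {w : ℂ | 0 < w.im} from ⟨hw, him⟩))]
        simp
      · rw [indicator_of_notMem (fun hD => him ((b.mem_iff h hw).mp hD)), indicator_of_notMem]
        · simp
        · rintro ⟨w', ⟨hw', him'⟩, he⟩
          exact him ((b.mem_iff h hw).mp (by rw [← he]; exact (b.mem_iff h hw').mpr him'))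
    · rw [indicator_of_notMem hz, indicator_of_notMem fun hz' => hz (hsub hz')]
  rw [h1, integral_dbar_left_side b.contDiff b.coe_e b.subset_source b.det_pos hu huc hus]
  have hms : IsOpen {t : ℝ | |t - t₀| < b.δ} := isOpen_lt (by fun_prop) continuous_const
  refine setIntegral_congr_fun hms.measurableSet fun t ht => ?_
  have ht' : |t - t₀| < b.δ := ht
  have hev : b.c =ᶠ[𝓝 t] fun s => chartAt ℂ (γ k t₀) (γ k s) := by
    filter_upwards [hms.mem_nhds ht] with s hs using (b.c_eq s hs).2
  rw [hev.deriv_eq, (b.c_eq t ht').2]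

/-- The integral of a 1-periodic function over a circle reduces to a short interval around `t₀`
outside of which the function vanishes. -/
theorem intervalIntegral_eq_setIntegral_of_periodic {g : ℝ → ℂ} (hg : Function.Periodic g 1)
    {t₀ δ : ℝ} (hδ : δ ≤ 1 / 2) (h0 : ∀ t, |t - t₀| ≤ 1 / 2 → δ ≤ |t - t₀| → g t = 0) :
    ∫ t in (0 : ℝ)..1, g t = ∫ t in {t : ℝ | |t - t₀| < δ}, g t := by
  have h1 := hg.intervalIntegral_add_eq 0 (t₀ - 1 / 2)
  rw [zero_add] at h1
  rw [h1, intervalIntegral.integral_of_le (by linarith)]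
  refine setIntegral_eq_of_subset_of_forall_sdiff_eq_zero measurableSet_Ioc ?_ ?_
  · intro t ht
    have : |t - t₀| < δ := ht
    rw [abs_lt] at this
    constructor <;> linarith
  · rintro t ⟨⟨ht1, ht2⟩, ht3⟩
    refine h0 t (abs_le.mpr ⟨by linarith, by linarith⟩) (not_lt.mp ht3)

variable [T2Space X] [IsManifold 𝓘(ℂ, ℂ) ω X]

/-- If the complement of the closure of `D` is non-empty, an open set `D` bounded by a single curve
lies only on one side of it. -/
theorem IsBoundedBy.isRegularBoundary_of_unique [Unique ι] [PreconnectedSpace X]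
    (h : IsBoundedBy D γ) (hD : closure D ≠ univ) : IsRegularBoundary D γ := by
  refine ⟨h, fun k t ht => ?_⟩
  obtain rfl : k = default := Subsingleton.elim _ _
  set c := γ default with hc
  have hcc : Continuous c := (h.curve default).continuous
  have hclopen : IsClopen (c ⁻¹' interior (closure D)) := by
    refine ⟨?_, isOpen_interior.preimage hcc⟩
    rw [← isOpen_compl_iff, isOpen_iff_mem_nhds]
    intro t₀ ht₀
    obtain ⟨b⟩ := h.nonempty_boundaryBox default t₀
    have hlow := b.lower_of_notMem_interior h ht₀
    filter_upwards [Metric.ball_mem_nhds t₀ b.pos] with s hs hsint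
    rw [Metric.mem_ball, Real.dist_eq] at hs
    have hsb : (s : ℂ) ∈ box t₀ b.δ := by simpa [box, b.pos] using hs
    have hcont : ContinuousAt (fun w => (chartAt ℂ (γ default t₀)).symm (straighten b.c t₀ w)) s :=
      ContinuousAt.comp (g := (chartAt ℂ (γ default t₀)).symm)
        ((chartAt ℂ (γ default t₀)).continuousAt_symm (b.image_subset ⟨_, hsb, rfl⟩))
        (contDiff_straighten b.contDiff).continuous.continuousAt
    have hval : (chartAt ℂ (γ default t₀)).symm (straighten b.c t₀ s) = c s := by
      rw [b.straighten_eq hs, (chartAt ℂ (γ default t₀)).left_inv (b.c_eq _ hs).1]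
    have h1 : ∀ᶠ w in 𝓝 (s : ℂ), (chartAt ℂ (γ default t₀)).symm (straighten b.c t₀ w) ∈
        interior (closure D) := by
      refine hcont.eventually (isOpen_interior.mem_nhds ?_)
      simp only [hval]
      exact hsint
    have h2 : ∀ᶠ w in 𝓝 (s : ℂ), w ∈ box t₀ b.δ := (isOpen_box t₀ b.δ).mem_nhds hsb
    have h3 : Tendsto (fun r : ℝ => (s : ℂ) - r * Complex.I) (𝓝[>] 0) (𝓝 s) := by
      have : ContinuousAt (fun r : ℝ => (s : ℂ) - r * Complex.I) 0 := by fun_prop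
      have h4 := this.tendsto
      simp only [Complex.ofReal_zero, zero_mul, sub_zero] at h4
      exact h4.mono_left nhdsWithin_le_nhds
    obtain ⟨r, ⟨hr1, hr2⟩, hr3⟩ := ((h3.eventually (h1.and h2)).and self_mem_nhdsWithin).exists
    exact hlow _ hr2 (by simpa using hr3) (interior_subset hr1)
  have huniv : c ⁻¹' interior (closure D) = univ := hclopen.eq_univ ⟨t, ht⟩
  have hopen : closure D ⊆ interior (closure D) := by
    intro x hx
    by_cases hxD : x ∈ D
    · exact mem_interior.mpr ⟨D, subset_closure, h.isOpen, hxD⟩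
    · have hfr : x ∈ frontier D := by rw [h.isOpen.frontier_eq]; exact ⟨hx, hxD⟩
      rw [h.frontier_eq] at hfr
      obtain ⟨l, s, rfl⟩ := mem_iUnion.mp hfr
      obtain rfl : l = default := Subsingleton.elim _ _
      have hs : s ∈ c ⁻¹' interior (closure D) := by rw [huniv]; exact mem_univ s
      exact hs
  have hcl : IsClopen (closure D) :=
    ⟨isClosed_closure, by rw [subset_antisymm hopen interior_subset]; exact isOpen_interior⟩
  exact hD (hcl.eq_univ ⟨_, interior_subset ht⟩)

end Boundary

/-! ### Partitions of unity and integration over the surface -/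

section Partition

variable {X : Type*} [TopologicalSpace X] [ChartedSpace ℂ X]

/-- A function on `X` that is continuously differentiable (in the real sense) in every chart. -/
def ChartSmooth (ρ : X → ℂ) : Prop :=
  ∀ p : X, ∀ z ∈ (chartAt ℂ p).target, ContDiffAt ℝ 1 (fun w => ρ ((chartAt ℂ p).symm w)) z

/-- The function `ρ` in the chart around `p`, extended by zero. -/
noncomputable def chartExt (p : X) (ρ : X → ℂ) : ℂ → ℂ :=
  (chartAt ℂ p).target.indicator fun z => ρ ((chartAt ℂ p).symm z)

theorem chartExt_of_mem {p : X} {ρ : X → ℂ} {z : ℂ} (hz : z ∈ (chartAt ℂ p).target) :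
    chartExt p ρ z = ρ ((chartAt ℂ p).symm z) := indicator_of_mem hz _

theorem chartExt_eventuallyEq {p : X} {ρ : X → ℂ} {z : ℂ} (hz : z ∈ (chartAt ℂ p).target) :
    chartExt p ρ =ᶠ[𝓝 z] fun w => ρ ((chartAt ℂ p).symm w) := by
  filter_upwards [target_mem_nhds hz] with w hw using chartExt_of_mem hw

section

variable {p : X} {ρ : X → ℂ}

theorem chartExt_eq_zero {z : ℂ} (hz : z ∉ chartAt ℂ p '' tsupport ρ) : chartExt p ρ z = 0 := by
  by_cases hzt : z ∈ (chartAt ℂ p).target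
  · rw [chartExt_of_mem hzt]
    by_contra h
    exact hz ⟨_, subset_tsupport ρ h, (chartAt ℂ p).right_inv hzt⟩
  · exact indicator_of_notMem hzt _

variable [CompactSpace X]

theorem isCompact_image_tsupport (hs : tsupport ρ ⊆ (chartAt ℂ p).source) :
    IsCompact (chartAt ℂ p '' tsupport ρ) :=
  (isClosed_tsupport ρ).isCompact.image_of_continuousOn ((chartAt ℂ p).continuousOn.mono hs)

theorem hasCompactSupport_chartExt (hs : tsupport ρ ⊆ (chartAt ℂ p).source) :
    HasCompactSupport (chartExt p ρ) :=
  HasCompactSupport.intro (isCompact_image_tsupport hs) fun _ hz => chartExt_eq_zero hz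

theorem tsupport_chartExt_subset (hs : tsupport ρ ⊆ (chartAt ℂ p).source) :
    tsupport (chartExt p ρ) ⊆ chartAt ℂ p '' tsupport ρ :=
  closure_minimal (fun _ hz => by_contra fun h => hz (chartExt_eq_zero h))
    (isCompact_image_tsupport hs).isClosed

theorem tsupport_chartExt_subset_target (hs : tsupport ρ ⊆ (chartAt ℂ p).source) :
    tsupport (chartExt p ρ) ⊆ (chartAt ℂ p).target := by
  refine (tsupport_chartExt_subset hs).trans ?_
  rintro _ ⟨x, hx, rfl⟩
  exact (chartAt ℂ p).map_source (hs hx)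

theorem symm_mem_of_mem_tsupport (hs : tsupport ρ ⊆ (chartAt ℂ p).source) {z : ℂ}
    (hz : z ∈ tsupport (chartExt p ρ)) : (chartAt ℂ p).symm z ∈ tsupport ρ := by
  obtain ⟨x, hx, rfl⟩ := tsupport_chartExt_subset hs hz
  rwa [(chartAt ℂ p).left_inv (hs hx)]

theorem contDiff_chartExt (hρ : ChartSmooth ρ) (hs : tsupport ρ ⊆ (chartAt ℂ p).source) :
    ContDiff ℝ 1 (chartExt p ρ) := by
  rw [contDiff_iff_contDiffAt]
  intro z
  by_cases hz : z ∈ (chartAt ℂ p).target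
  · exact (hρ p z hz).congr_of_eventuallyEq (chartExt_eventuallyEq hz)
  · have hz' : z ∉ tsupport (chartExt p ρ) := fun h => hz (tsupport_chartExt_subset_target hs h)
    exact contDiffAt_const.congr_of_eventuallyEq (notMem_tsupport_iff_eventuallyEq.mp hz')

theorem integral_dbar_chartExt {p : X} {ρ : X → ℂ} (hs : tsupport ρ ⊆ (chartAt ℂ p).source)
    (F : ℂ → ℂ) : ∫ z, dbar (chartExt p ρ) z * F z =
      ∫ z in (chartAt ℂ p).target, dbar (fun w => ρ ((chartAt ℂ p).symm w)) z * F z := by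
  rw [← integral_indicator (chartAt ℂ p).open_target.measurableSet]
  congr 1
  ext z
  by_cases hz : z ∈ (chartAt ℂ p).target
  · rw [indicator_of_mem hz, dbar_congr (chartExt_eventuallyEq hz)]
  · rw [indicator_of_notMem hz]
    have : dbar (chartExt p ρ) z = 0 := by
      by_contra h
      exact hz (tsupport_chartExt_subset_target hs (support_dbar_subset _ h))
    rw [this, zero_mul]

end

/-- A product with a compactly supported factor is differentiable if both factors are so on the
support. -/
theorem contDiff_mul_of_tsupport {u f : ℂ → ℂ} (hu : ContDiff ℝ 1 u)
    (hf : ∀ z ∈ tsupport u, ContDiffAt ℝ 1 f z) : ContDiff ℝ 1 fun z => u z * f z := by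
  rw [contDiff_iff_contDiffAt]
  intro z
  by_cases hz : z ∈ tsupport u
  · exact hu.contDiffAt.mul (hf z hz)
  · refine (contDiffAt_const (c := (0 : ℂ))).congr_of_eventuallyEq ?_
    filter_upwards [notMem_tsupport_iff_eventuallyEq.mp hz] with w hw
    rw [hw, Pi.zero_apply, zero_mul]

/-- A product `A F` is integrable on `U` if `A` is continuous and vanishes outside a compact subset
of `U`, and `F` is integrable near each point where `A` does not vanish identically. -/
theorem integrableOn_of_support {A F : ℂ → ℂ} {U K : Set ℂ} (hU : IsOpen U) (hK : IsCompact K)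
    (hKU : K ⊆ U) (hA : ContinuousOn A U) (hAK : ∀ z ∈ U, z ∉ K → A z = 0)
    (hF : ∀ z ∈ U, IntegrableAtFilter F (𝓝 z) ∨ A =ᶠ[𝓝 z] 0) :
    IntegrableOn (fun z => A z * F z) U := by
  have h1 : IntegrableOn (fun z => A z * F z) K := by
    refine LocallyIntegrableOn.integrableOn_isCompact (fun z hz => ?_) hK
    refine IntegrableAtFilter.filter_mono nhdsWithin_le_nhds ?_
    rcases hF z (hKU hz) with h | h
    · obtain ⟨s, hs, hint⟩ := h
      obtain ⟨r, hr, hrs⟩ := Metric.nhds_basis_closedBall.mem_iff.mp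
        (inter_mem hs (hU.mem_nhds (hKU hz)))
      refine ⟨Metric.closedBall z r, Metric.closedBall_mem_nhds z hr, ?_⟩
      exact (hint.mono_set (hrs.trans inter_subset_left)).continuousOn_mul
        (hA.mono (hrs.trans inter_subset_right)) (isCompact_closedBall z r)
    · obtain ⟨s, hs, h⟩ := h.exists_mem
      obtain ⟨r, hr, hrs⟩ := Metric.nhds_basis_closedBall.mem_iff.mp hs
      refine ⟨Metric.closedBall z r, Metric.closedBall_mem_nhds z hr, ?_⟩
      refine (integrableOn_zero (ε' := ℂ)).congr_fun (fun w hw => ?_)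
        Metric.isClosed_closedBall.measurableSet
      simp [h (hrs hw)]
  refine h1.of_forall_sdiff_eq_zero hU.measurableSet fun z hz => ?_
  rw [hAK z hz.1 hz.2, zero_mul]

/-- The product of a compactly supported continuous function with a function that is integrable
near each point of the support is integrable. -/
theorem integrable_mul_of_tsupport {u F : ℂ → ℂ} (hu : Continuous u) (huc : HasCompactSupport u)
    (hF : ∀ z ∈ tsupport u, IntegrableAtFilter F (𝓝 z)) : Integrable fun z => u z * F z := by
  rw [← integrableOn_univ]
  refine integrableOn_of_support isOpen_univ huc (subset_univ _) hu.continuousOn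
    (fun z _ hz => image_eq_zero_of_notMem_tsupport hz) fun z _ => ?_
  by_cases hz : z ∈ tsupport u
  · exact Or.inl (hF z hz)
  · exact Or.inr (notMem_tsupport_iff_eventuallyEq.mp hz)

/-- A differential form of degree 2, given by its coefficients with respect to the area element of
each chart. -/
def IsDensity (b : X → ℂ → ℂ) : Prop :=
  ∀ p q : X, ∀ z ∈ (chartAt ℂ p).target, (chartAt ℂ p).symm z ∈ (chartAt ℂ q).source →
    b p z = Complex.normSq (deriv (trans p q) z) * b q (trans p q z)

theorem injOn_trans (p q : X) : InjOn (trans p q)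
    ((chartAt ℂ p).target ∩ (chartAt ℂ p).symm ⁻¹' (chartAt ℂ q).source) := by
  intro z hz w hw h
  have h1 : (chartAt ℂ p).symm z = (chartAt ℂ p).symm w := by
    rw [← symm_trans hz.2, h, symm_trans hw.2]
  rw [← (chartAt ℂ p).right_inv hz.1, h1, (chartAt ℂ p).right_inv hw.1]

theorem image_trans (p q : X) : trans p q ''
    ((chartAt ℂ p).target ∩ (chartAt ℂ p).symm ⁻¹' (chartAt ℂ q).source) =
    (chartAt ℂ q).target ∩ (chartAt ℂ q).symm ⁻¹' (chartAt ℂ p).source := by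
  ext w
  constructor
  · rintro ⟨z, hz, rfl⟩
    refine ⟨trans_mem_target hz.2, ?_⟩
    rw [mem_preimage, symm_trans hz.2]
    exact (chartAt ℂ p).map_target hz.1
  · rintro ⟨hw, hw'⟩
    refine ⟨trans q p w, ⟨trans_mem_target hw', ?_⟩, ?_⟩
    · rw [mem_preimage, symm_trans hw']
      exact (chartAt ℂ q).map_target hw
    · rw [trans_trans hw', trans_self hw]

theorem IsDensity.mul {b : X → ℂ → ℂ} (hb : IsDensity b) (ρ : X → ℂ) :
    IsDensity fun p z => ρ ((chartAt ℂ p).symm z) * b p z := by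
  intro p q z hz hq
  simp only
  rw [hb p q z hz hq, symm_trans hq]
  ring

variable [IsManifold 𝓘(ℂ, ℂ) ω X]

/-- The integral of a 2-form supported in two charts can be computed in either of them. -/
theorem IsDensity.integral_eq {b : X → ℂ → ℂ} (hb : IsDensity b) {p q : X}
    (hp : ∀ z ∈ (chartAt ℂ p).target, (chartAt ℂ p).symm z ∉ (chartAt ℂ q).source → b p z = 0)
    (hq : ∀ z ∈ (chartAt ℂ q).target, (chartAt ℂ q).symm z ∉ (chartAt ℂ p).source → b q z = 0) :
    ∫ z in (chartAt ℂ p).target, b p z = ∫ z in (chartAt ℂ q).target, b q z := by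
  have key : ∀ p q : X,
      (∀ z ∈ (chartAt ℂ p).target, (chartAt ℂ p).symm z ∉ (chartAt ℂ q).source → b p z = 0) →
      ∫ z in (chartAt ℂ p).target, b p z =
      ∫ z in (chartAt ℂ p).target ∩ (chartAt ℂ p).symm ⁻¹' (chartAt ℂ q).source, b p z := by
    intro p q h
    refine setIntegral_eq_of_subset_of_forall_sdiff_eq_zero
      (chartAt ℂ p).open_target.measurableSet inter_subset_left fun z hz => ?_
    exact h z hz.1 fun h' => hz.2 ⟨hz.1, h'⟩
  rw [key p q hp, key q p hq, ← image_trans p q]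
  have hS := isOpen_overlap p q
  rw [integral_image_eq_integral_abs_det_fderiv_smul volume hS.measurableSet
    (f' := fun z => deriv (trans p q) z • (1 : ℂ →L[ℝ] ℂ))
    (fun z hz => (hasFDerivAt_real_of_hasDerivAt
      (differentiableAt_trans hz.1 hz.2).hasDerivAt).hasFDerivWithinAt) (injOn_trans p q)]
  refine setIntegral_congr_fun hS.measurableSet fun z hz => ?_
  have hdet : (deriv (trans p q) z • (1 : ℂ →L[ℝ] ℂ)).det = Complex.normSq (deriv (trans p q) z) := by
    rw [det_complex]
    simp [Complex.normSq_apply]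
  rw [hdet, abs_of_nonneg (Complex.normSq_nonneg _), hb p q z hz.1 hz.2, Complex.real_smul]

/-- For functions `ρ` and `h` and a `(1,0)`-form `η`, the 2-form `h ∂̄ρ ∧ η`, up to a constant. -/
theorem isDensity_dbar {ρ : X → ℂ} (hρ : ChartSmooth ρ) (h : X → ℂ) (η : Differential X) :
    IsDensity fun p z => dbar (fun w => ρ ((chartAt ℂ p).symm w)) z *
      (h ((chartAt ℂ p).symm z) * η.coeff p z) := by
  intro p q z hz hq
  have h1 : (fun w => ρ ((chartAt ℂ p).symm w)) =ᶠ[𝓝 z]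
      fun w => (fun v => ρ ((chartAt ℂ q).symm v)) (trans p q w) := by
    filter_upwards [eventually_symm_mem_source hz hq] with w hw
    rw [symm_trans hw.2]
  have h2 := dbar_comp (u := fun v => ρ ((chartAt ℂ q).symm v)) (τ := trans p q) (z := z)
    ((hρ q _ (trans_mem_target hq)).differentiableAt one_ne_zero) (differentiableAt_trans hz hq)
  simp only
  rw [dbar_congr h1, h2, coeff_trans η hz hq, symm_trans hq, ← Complex.mul_conj]
  ring

variable [CompactSpace X]

/-- The sum over a partition of unity `ρ i` of the integrals of `h ∂̄(ρ i) ∧ η` vanishes, because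
`∂̄ 1 = 0`. -/
theorem sum_integral_dbar_partition {T : Finset X} {ρ : X → X → ℂ}
    (hρ : ∀ i ∈ T, ChartSmooth (ρ i)) (hs : ∀ i ∈ T, tsupport (ρ i) ⊆ (chartAt ℂ i).source)
    (hsum : ∀ x, ∑ i ∈ T, ρ i x = 1) {h : X → ℂ} {η : Differential X}
    (hF : ∀ p, ∀ z ∈ (chartAt ℂ p).target,
      IntegrableAtFilter (fun z => h ((chartAt ℂ p).symm z) * η.coeff p z) (𝓝 z) ∨
      ∀ i ∈ T, ∃ c, ρ i =ᶠ[𝓝 ((chartAt ℂ p).symm z)] fun _ => c) :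
    ∑ i ∈ T, ∫ z, dbar (chartExt i (ρ i)) z * (h ((chartAt ℂ i).symm z) * η.coeff i z) = 0 := by
  set b : X → X → ℂ → ℂ := fun i p z => dbar (fun w => ρ i ((chartAt ℂ p).symm w)) z *
      (h ((chartAt ℂ p).symm z) * η.coeff p z) with hb
  have hbd : ∀ i ∈ T, IsDensity (b i) := fun i hi => isDensity_dbar (hρ i hi) h η
  have hvan : ∀ i, ∀ p, ∀ z ∈ (chartAt ℂ p).target, (chartAt ℂ p).symm z ∉ tsupport (ρ i) →
      b i p z = 0 := by
    intro i p z hz hzi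
    have : (fun w => ρ i ((chartAt ℂ p).symm w)) =ᶠ[𝓝 z] fun _ => 0 :=
      eventually_symm_mem hz (notMem_tsupport_iff_eventuallyEq.mp hzi)
    simp only [hb]
    rw [dbar_congr this, dbar_const, zero_mul]
  have hint : ∀ i ∈ T, ∀ j ∈ T, ∀ p, tsupport (ρ i) ∩ tsupport (ρ j) ⊆ (chartAt ℂ p).source →
      IntegrableOn (fun z => ρ j ((chartAt ℂ p).symm z) * b i p z) (chartAt ℂ p).target := by
    intro i hi j hj p hp
    simp only [hb, ← mul_assoc (ρ j _)]
    have hK : IsCompact (tsupport (ρ i) ∩ tsupport (ρ j)) :=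
      ((isClosed_tsupport _).inter (isClosed_tsupport _)).isCompact
    refine integrableOn_of_support (chartAt ℂ p).open_target
      (hK.image_of_continuousOn ((chartAt ℂ p).continuousOn.mono hp)) ?_ ?_ ?_ ?_
    · rintro _ ⟨x, hx, rfl⟩
      exact (chartAt ℂ p).map_source (hp hx)
    · intro z hz
      exact ((hρ j hj p z hz).continuousAt.mul
        (continuousAt_dbar_of_contDiffAt (hρ i hi p z hz))).continuousWithinAt
    · intro z hz hzK
      by_cases hzi : (chartAt ℂ p).symm z ∈ tsupport (ρ i)
      · have hzj : (chartAt ℂ p).symm z ∉ tsupport (ρ j) := fun hzj =>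
          hzK ⟨_, ⟨hzi, hzj⟩, (chartAt ℂ p).right_inv hz⟩
        rw [image_eq_zero_of_notMem_tsupport hzj, zero_mul]
      · rw [dbar_congr (eventually_symm_mem hz (notMem_tsupport_iff_eventuallyEq.mp hzi))]
        exact (congrArg _ (dbar_const 0 z)).trans (mul_zero _)
    · intro z hz
      refine (hF p z hz).imp_right fun h1 => ?_
      obtain ⟨c, hc⟩ := h1 i hi
      have h2 := eventually_symm_mem hz hc
      filter_upwards [h2.eventually_nhds] with w hw
      rw [dbar_congr (v := fun _ => c) hw, dbar_const, mul_zero, Pi.zero_apply]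
  have step1 : ∀ i ∈ T, ∫ z, dbar (chartExt i (ρ i)) z *
      (h ((chartAt ℂ i).symm z) * η.coeff i z) =
      ∑ j ∈ T, ∫ z in (chartAt ℂ i).target, ρ j ((chartAt ℂ i).symm z) * b i i z := by
    intro i hi
    rw [integral_dbar_chartExt (hs i hi), ← integral_finsetSum]
    · refine setIntegral_congr_fun (chartAt ℂ i).open_target.measurableSet fun z _ => ?_
      rw [← Finset.sum_mul, hsum, one_mul]
    · intro j hj
      exact hint i hi j hj i (inter_subset_left.trans (hs i hi))
  have step2 : ∀ i ∈ T, ∀ j ∈ T,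
      ∫ z in (chartAt ℂ i).target, ρ j ((chartAt ℂ i).symm z) * b i i z =
      ∫ z in (chartAt ℂ j).target, ρ j ((chartAt ℂ j).symm z) * b i j z := by
    intro i hi j hj
    refine ((hbd i hi).mul (ρ j)).integral_eq (fun z hz hzj => ?_) fun z hz hzi => ?_
    · rw [image_eq_zero_of_notMem_tsupport fun h => hzj (hs j hj h), zero_mul]
    · rw [hvan i j z hz fun h => hzi (hs i hi h), mul_zero]
  rw [Finset.sum_congr rfl step1, Finset.sum_congr rfl fun i hi => Finset.sum_congr rfl (step2 i hi),
    Finset.sum_comm]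
  refine Finset.sum_eq_zero fun j hj => ?_
  rw [← integral_finsetSum _ fun i hi => hint i hi j hj j (inter_subset_right.trans (hs j hj))]
  rw [← integral_zero ℂ ℂ (μ := volume.restrict (chartAt ℂ j).target)]
  refine setIntegral_congr_fun (chartAt ℂ j).open_target.measurableSet fun z hz => ?_
  rw [← Finset.mul_sum, ← Finset.sum_mul, ← dbar_sum T fun i hi =>
    (hρ i hi j z hz).differentiableAt one_ne_zero]
  have : (fun w => ∑ i ∈ T, ρ i ((chartAt ℂ j).symm w)) = fun _ => 1 := by
    ext w; exact hsum _
  rw [this, dbar_const, zero_mul, mul_zero]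

end Partition

/-! ### Local forms of Stokes' theorem -/

section Stokes

variable {X : Type*} [TopologicalSpace X] [ChartedSpace ℂ X]

theorem integrableAtFilter_indicator_symm {D : Set X} (hD : IsOpen D) {p : X} {z : ℂ}
    (hz : z ∈ (chartAt ℂ p).target) :
    IntegrableAtFilter (fun w => D.indicator (1 : X → ℂ) ((chartAt ℂ p).symm w)) (𝓝 z) := by
  obtain ⟨r, hr, hrs⟩ := Metric.nhds_basis_closedBall.mem_iff.mp (target_mem_nhds hz)
  refine ⟨Metric.closedBall z r, Metric.closedBall_mem_nhds z hr, ?_⟩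
  have hopen : IsOpen ((chartAt ℂ p).target ∩ (chartAt ℂ p).symm ⁻¹' D) :=
    (chartAt ℂ p).isOpen_inter_preimage_symm hD
  have h1 : IntegrableOn (((chartAt ℂ p).target ∩ (chartAt ℂ p).symm ⁻¹' D).indicator
      (fun _ => (1 : ℂ))) (Metric.closedBall z r) :=
    (integrableOn_const (isCompact_closedBall z r).measure_lt_top.ne).indicator hopen.measurableSet
  refine h1.congr_fun (fun w hw => ?_) Metric.isClosed_closedBall.measurableSet
  by_cases hwD : (chartAt ℂ p).symm w ∈ D
  · rw [indicator_of_mem hwD, indicator_of_mem (show w ∈ (chartAt ℂ p).target ∩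
      (chartAt ℂ p).symm ⁻¹' D from ⟨hrs hw, hwD⟩)]; rfl
  · rw [indicator_of_notMem hwD, indicator_of_notMem fun h => hwD h.2]

variable [CompactSpace X]

/-- Contribution of a simple pole with residue `r`. -/
theorem integral_dbar_pole {p : X} {ρ : X → ℂ} (hρ : ChartSmooth ρ)
    (hs : tsupport ρ ⊆ (chartAt ℂ p).source) (h1 : ρ =ᶠ[𝓝 p] 1) {η : Differential X} {r : ℂ}
    {g : ℂ → ℂ} (hg : ∀ x ∈ tsupport ρ, AnalyticAt ℂ g (chartAt ℂ p x) ∧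
      (x ≠ p → η.coeff p (chartAt ℂ p x) = r / (chartAt ℂ p x - chartAt ℂ p p) +
        g (chartAt ℂ p x))) :
    ∫ z, dbar (chartExt p ρ) z * η.coeff p z = residueConst * r := by
  have hRC : ContDiff ℝ 1 (chartExt p ρ) := contDiff_chartExt hρ hs
  have hRc : HasCompactSupport (chartExt p ρ) := hasCompactSupport_chartExt hs
  have hR1 : ∀ᶠ z in 𝓝 (chartAt ℂ p p), chartExt p ρ z = 1 := by
    have hz := chart_mem_target p
    have h2 := eventually_symm_mem hz (N := {x | ρ x = 1})
      (by rw [(chartAt ℂ p).left_inv (mem_chart_source ℂ p)]; exact h1)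
    filter_upwards [h2, chartExt_eventuallyEq (ρ := ρ) hz] with z h3 h4
    rw [h4]; exact h3
  have hgz : ∀ z ∈ tsupport (chartExt p ρ), AnalyticAt ℂ g z ∧
      (z ≠ chartAt ℂ p p → η.coeff p z = r / (z - chartAt ℂ p p) + g z) := by
    intro z hz
    obtain ⟨x, hx, rfl⟩ := tsupport_chartExt_subset hs hz
    exact ⟨(hg x hx).1, fun hne => (hg x hx).2 fun h => hne (by rw [h])⟩
  have hgC : ContDiff ℝ 1 fun z => chartExt p ρ z * g z :=
    contDiff_mul_of_tsupport hRC fun z hz => (hgz z hz).1.contDiffAt.restrict_scalars ℝ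
  have hpt : ∀ z, dbar (chartExt p ρ) z * η.coeff p z =
      r * (dbar (chartExt p ρ) z / (z - chartAt ℂ p p)) +
        dbar (fun z => chartExt p ρ z * g z) z := by
    intro z
    by_cases hz : z ∈ tsupport (chartExt p ρ)
    · rw [dbar_mul (hRC.differentiable one_ne_zero z)
        (((hgz z hz).1.contDiffAt (n := 1)).restrict_scalars ℝ |>.differentiableAt one_ne_zero),
        dbar_eq_zero (hgz z hz).1.differentiableAt]
      by_cases hzp : z = chartAt ℂ p p
      · have : dbar (chartExt p ρ) z = 0 := by
          rw [hzp, dbar_congr (v := fun _ => 1) hR1, dbar_const]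
        rw [this]
        simp
      · rw [(hgz z hz).2 hzp]
        ring
    · have h0 : chartExt p ρ =ᶠ[𝓝 z] fun _ => 0 := notMem_tsupport_iff_eventuallyEq.mp hz
      have h2 : (fun w => chartExt p ρ w * g w) =ᶠ[𝓝 z] fun _ => 0 := h0.mono fun w hw => by
        simp only [hw, zero_mul]
      rw [dbar_congr h0, dbar_congr h2, dbar_const]
      simp
  simp only [hpt]
  rw [integral_add ((integrable_dbar_div hRC hRc hR1).const_mul r)
    ((continuous_dbar hgC).integrable_of_hasCompactSupport (hasCompactSupport_dbar hRc.mul_right)),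
    integral_const_mul, integral_dbar_div hRC hRc hR1, integral_dbar_eq_zero hgC hRc.mul_right]
  ring

variable [IsManifold 𝓘(ℂ, ℂ) ω X]

/-- Integration by parts in a chart, for a function `h` that is the sum of a differentiable function
`q` with `∂̄q = conj θ` and a multiple of the characteristic function of `D`. -/
theorem integral_dbar_mul_jump {D : Set X} (hD : IsOpen D) {p : X} {ρ : X → ℂ} (hρ : ChartSmooth ρ)
    (hs : tsupport ρ ⊆ (chartAt ℂ p).source) {η θ : Differential X} {h : X → ℂ} {q : ℂ → ℂ} {μ : ℂ}
    (hη : ∀ x ∈ tsupport ρ, HolAt η x) (hθ : ∀ x ∈ tsupport ρ, HolAt θ x)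
    (hq : ∀ x ∈ tsupport ρ, ContDiffAt ℝ 1 q (chartAt ℂ p x) ∧
      dbar q (chartAt ℂ p x) = 2 * conj (θ.coeff p (chartAt ℂ p x)))
    (hh : ∀ x ∈ tsupport ρ, h x = q (chartAt ℂ p x) + μ * D.indicator 1 x) :
    ∫ z, dbar (chartExt p ρ) z * (h ((chartAt ℂ p).symm z) * η.coeff p z) =
      μ * (∫ z, dbar (fun w => chartExt p ρ w * η.coeff p w) z *
        D.indicator 1 ((chartAt ℂ p).symm z)) -
      2 * ∫ z, chartExt p ρ z * (conj (θ.coeff p z) * η.coeff p z) := by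
  set R := chartExt p ρ with hR
  set f := η.coeff p with hf
  have hRC : ContDiff ℝ 1 R := contDiff_chartExt hρ hs
  have hRc : HasCompactSupport R := hasCompactSupport_chartExt hs
  have hfA : ∀ z ∈ tsupport R, AnalyticAt ℂ f z := fun z hz =>
    (hη _ (symm_mem_of_mem_tsupport hs hz)).analyticAt_symm (tsupport_chartExt_subset_target hs hz)
  have hθA : ∀ z ∈ tsupport R, AnalyticAt ℂ (θ.coeff p) z := fun z hz =>
    (hθ _ (symm_mem_of_mem_tsupport hs hz)).analyticAt_symm (tsupport_chartExt_subset_target hs hz)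
  have hfC : ∀ z ∈ tsupport R, ContDiffAt ℝ 1 f z := fun z hz =>
    (hfA z hz).contDiffAt.restrict_scalars ℝ
  have hqz : ∀ z ∈ tsupport R, ContDiffAt ℝ 1 q z ∧ dbar q z = 2 * conj (θ.coeff p z) ∧
      h ((chartAt ℂ p).symm z) = q z + μ * D.indicator 1 ((chartAt ℂ p).symm z) := by
    intro z hz
    have h1 := symm_mem_of_mem_tsupport hs hz
    have h2 := hq _ h1
    have h3 := hh _ h1
    rw [(chartAt ℂ p).right_inv (tsupport_chartExt_subset_target hs hz)] at h2 h3
    exact ⟨h2.1, h2.2, h3⟩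
  have hu : ContDiff ℝ 1 fun w => R w * f w := contDiff_mul_of_tsupport hRC hfC
  have huc : HasCompactSupport fun w => R w * f w := hRc.mul_right
  have hv : ContDiff ℝ 1 fun w => R w * (q w * f w) :=
    contDiff_mul_of_tsupport hRC fun z hz => (hqz z hz).1.mul (hfC z hz)
  have hvc : HasCompactSupport fun w => R w * (q w * f w) := hRc.mul_right
  have hpt : ∀ z, dbar R z * (h ((chartAt ℂ p).symm z) * f z) =
      μ * (dbar (fun w => R w * f w) z * D.indicator 1 ((chartAt ℂ p).symm z)) +
      dbar (fun w => R w * (q w * f w)) z - 2 * (R z * (conj (θ.coeff p z) * f z)) := by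
    intro z
    by_cases hz : z ∈ tsupport R
    · obtain ⟨hq1, hq2, hq3⟩ := hqz z hz
      have hRd := hRC.differentiable one_ne_zero z
      have hfd := (hfC z hz).differentiableAt one_ne_zero
      have hqd := hq1.differentiableAt one_ne_zero
      rw [dbar_mul hRd hfd, dbar_mul (v := fun w => q w * f w) hRd (hqd.mul hfd), dbar_mul hqd hfd,
        dbar_eq_zero (hfA z hz).differentiableAt, hq2, hq3]
      ring
    · have h0 : R =ᶠ[𝓝 z] fun _ => 0 := notMem_tsupport_iff_eventuallyEq.mp hz
      have h1 : (fun w => R w * f w) =ᶠ[𝓝 z] fun _ => 0 := h0.mono fun w hw => by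
        simp only [hw, zero_mul]
      have h2 : (fun w => R w * (q w * f w)) =ᶠ[𝓝 z] fun _ => 0 := h0.mono fun w hw => by
        simp only [hw, zero_mul]
      rw [dbar_congr h0, dbar_congr h1, dbar_congr h2, dbar_const, h0.self_of_nhds]
      ring
  simp only [hpt]
  have hi1 : Integrable fun z => dbar (fun w => R w * f w) z *
      D.indicator 1 ((chartAt ℂ p).symm z) := by
    refine integrable_mul_of_tsupport (continuous_dbar hu) (hasCompactSupport_dbar huc)
      fun z hz => integrableAtFilter_indicator_symm hD (tsupport_chartExt_subset_target hs ?_)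
    exact tsupport_mul_subset_left (tsupport_dbar_subset _ hz)
  have hi2 : Integrable fun z => dbar (fun w => R w * (q w * f w)) z :=
    (continuous_dbar hv).integrable_of_hasCompactSupport (hasCompactSupport_dbar hvc)
  have hi3 : Integrable fun z => R z * (conj (θ.coeff p z) * f z) := by
    refine (contDiff_mul_of_tsupport hRC fun z hz => ?_).continuous.integrable_of_hasCompactSupport
      hRc.mul_right
    exact (Complex.conjCLE.contDiff.contDiffAt.comp z
      ((hθA z hz).contDiffAt.restrict_scalars ℝ)).mul (hfC z hz)
  have hi12 : Integrable fun z => μ * (dbar (fun w => R w * f w) z *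
      D.indicator 1 ((chartAt ℂ p).symm z)) + dbar (fun w => R w * (q w * f w)) z :=
    (hi1.const_mul μ).add hi2
  rw [integral_sub hi12 (hi3.const_mul 2),
    integral_add (hi1.const_mul μ) hi2, integral_const_mul, integral_const_mul,
    integral_dbar_eq_zero hv hvc, add_zero]

variable {ι : Type*} {D : Set X} {γ : ι → ℝ → X}

/-- Stokes' theorem for a form supported near a boundary point. -/
theorem BoundaryBox.integral_dbar_eq_contour {k : ι} {t₀ : ℝ} (b : BoundaryBox D γ k t₀)
    (hD : IsRegularBoundary D γ) {ρ : X → ℂ} (hρ : ChartSmooth ρ) (hs : tsupport ρ ⊆ b.nhd)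
    {η : Differential X} (hη : ∀ x ∈ tsupport ρ, HolAt η x) :
    Complex.I * ∫ z, dbar (fun w => chartExt (γ k t₀) ρ w * η.coeff (γ k t₀) w) z *
        D.indicator 1 ((chartAt ℂ (γ k t₀)).symm z) =
      ∫ t in (0 : ℝ)..1, ρ (γ k t) * η (γ k t) (velocity (γ k) t) := by
  have hs' : tsupport ρ ⊆ (chartAt ℂ (γ k t₀)).source := hs.trans inter_subset_left
  have hγ := hD.curve k
  set u := fun w => chartExt (γ k t₀) ρ w * η.coeff (γ k t₀) w with hu
  have huC : ContDiff ℝ 1 u := contDiff_mul_of_tsupport (contDiff_chartExt hρ hs') fun z hz =>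
    ((hη _ (symm_mem_of_mem_tsupport hs' hz)).analyticAt_symm
      (tsupport_chartExt_subset_target hs' hz)).contDiffAt.restrict_scalars ℝ
  have huc : HasCompactSupport u := (hasCompactSupport_chartExt hs').mul_right
  have hus : tsupport u ⊆ straighten b.c t₀ '' box t₀ b.δ := by
    refine (tsupport_mul_subset_left.trans (tsupport_chartExt_subset hs')).trans ?_
    rintro _ ⟨x, hx, rfl⟩
    exact (hs hx).2
  have h1 := b.integral_dbar hD huC huc hus
  have h2 : ∫ z in straighten b.c t₀ '' box t₀ b.δ,
        dbar u z * D.indicator 1 ((chartAt ℂ (γ k t₀)).symm z) =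
      ∫ z, dbar u z * D.indicator 1 ((chartAt ℂ (γ k t₀)).symm z) := by
    refine setIntegral_eq_integral_of_forall_compl_eq_zero fun z hz => ?_
    have : dbar u z = 0 := by
      by_contra h
      exact hz (hus (support_dbar_subset u h))
    rw [this, zero_mul]
  rw [← h2, h1]
  have hper : Function.Periodic (fun t => ρ (γ k t) * η (γ k t) (velocity (γ k) t)) 1 := by
    intro t
    have := hγ.periodic_apply_velocity η t
    simp only at this ⊢
    rw [this, hγ.periodic t]
  rw [intervalIntegral_eq_setIntegral_of_periodic hper b.le_half]
  · have hms : IsOpen {t : ℝ | |t - t₀| < b.δ} := isOpen_lt (by fun_prop) continuous_const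
    refine setIntegral_congr_fun hms.measurableSet fun t ht => ?_
    have hsrc := (b.c_eq t ht).1
    rw [hγ.apply_velocity hsrc, hu, ← mul_assoc]
    beta_reduce
    rw [chartExt_of_mem ((chartAt ℂ (γ k t₀)).map_source hsrc), (chartAt ℂ (γ k t₀)).left_inv hsrc]
  · intro t ht htδ
    have : γ k t ∉ tsupport ρ := fun h => (b.eq_of_curve_mem (hs h)).2 ht |>.not_ge htδ
    rw [image_eq_zero_of_notMem_tsupport this, zero_mul]

end Stokes

/-! ### Stokes' theorem on the surface -/

section Stokes

variable {X : Type*} [TopologicalSpace X] [ChartedSpace ℂ X] {ι : Type*} {D : Set X}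
  {γ : ι → ℝ → X}

theorem chartSmooth_of_contMDiff [IsManifold 𝓘(ℂ, ℂ) ω X] {f : X → ℝ}
    (hf : ContMDiff 𝓘(ℝ, ℂ) 𝓘(ℝ, ℝ) ∞ f) :
    ChartSmooth fun x => (f x : ℂ) := by
  intro p z hz
  have := isManifold_real (X := X)
  have h1 : ContMDiffAt 𝓘(ℝ, ℂ) 𝓘(ℝ, ℂ) ∞ (chartAt ℂ p).symm z :=
    (contMDiffOn_chart_symm (I := 𝓘(ℝ, ℂ)) (n := ∞) (x := p)).contMDiffAt (target_mem_nhds hz)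
  have h2 : ContMDiffAt 𝓘(ℝ, ℂ) 𝓘(ℝ, ℝ) ∞ (fun w => f ((chartAt ℂ p).symm w)) z :=
    (hf.contMDiffAt).comp z h1
  exact Complex.ofRealCLM.contDiff.contDiffAt.comp z (h2.contDiffAt.of_le (by simp))

/-- Every point outside the curves has a neighbourhood on which the characteristic function of `D`
is constant. -/
theorem IsBoundedBy.eventually_indicator_eq (hD : IsBoundedBy D γ) {p : X}
    (hp : ∀ k, p ∉ range (γ k)) :
    ∀ᶠ x in 𝓝 p, D.indicator (1 : X → ℂ) x = D.indicator 1 p := by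
  by_cases hpD : p ∈ D
  · filter_upwards [hD.isOpen.mem_nhds hpD] with x hx
    rw [indicator_of_mem hx, indicator_of_mem hpD]
    rfl
  · have hpc : p ∈ (closure D)ᶜ := by
      intro h
      have : p ∈ frontier D := by rw [hD.isOpen.frontier_eq]; exact ⟨h, hpD⟩
      rw [hD.frontier_eq] at this
      obtain ⟨k, hk⟩ := mem_iUnion.mp this
      exact hp k hk
    filter_upwards [isClosed_closure.isOpen_compl.mem_nhds hpc] with x hx
    rw [indicator_of_notMem hpD, indicator_of_notMem fun h => hx (subset_closure h)]

variable [IsManifold 𝓘(ℂ, ℂ) ω X] [CompactSpace X] [T2Space X] [Fintype ι]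

/-- **Stokes' theorem.** Let `h` be a function on `X` whose `∂̄`-derivative is `conj θ`, except that
along the curve `γ k` it jumps by `lam k` when one enters `D`, and let `η` be a differential that is
holomorphic except for simple poles with residues `r P` at the points `P ∈ S`, near which `h` is
constant. Then the integral of `d(h η)` over `X`, written with a partition of unity, is expressed
through the periods of `η` and its residues. -/
theorem stokes (hD : IsRegularBoundary D γ) {S : Finset X} (hSγ : ∀ P ∈ S, ∀ k, P ∉ range (γ k))
    {η θ : Differential X} (hη : ∀ x, x ∉ S → HolAt η x) (hθ : ∀ x, HolAt θ x)
    {r : X → ℂ} (hpole : ∀ P ∈ S, ∃ g, AnalyticAt ℂ g (chartAt ℂ P P) ∧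
      ∀ᶠ z in 𝓝[≠] (chartAt ℂ P P), η.coeff P z = r P / (z - chartAt ℂ P P) + g z)
    {h : X → ℂ} {lam : ι → ℂ}
    (hh : ∀ p : X, ∃ (q : ℂ → ℂ) (μ : ℂ), (∀ᶠ z in 𝓝 (chartAt ℂ p p), ContDiffAt ℝ 1 q z ∧
        dbar q z = 2 * conj (θ.coeff p z)) ∧
      (∀ᶠ x in 𝓝 p, h x = q (chartAt ℂ p x) + μ * D.indicator 1 x) ∧
      ∀ k, p ∈ range (γ k) → μ = lam k)
    (hhS : ∀ P ∈ S, (∀ᶠ x in 𝓝 P, h x = h P) ∧ ∀ᶠ z in 𝓝 (chartAt ℂ P P), θ.coeff P z = 0) :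
    ∃ (T : Finset X) (ρ : X → X → ℝ), (∀ i x, 0 ≤ ρ i x) ∧
      (∀ i ∈ T, ChartSmooth fun x => (ρ i x : ℂ)) ∧
      (∀ i ∈ T, tsupport (fun x => (ρ i x : ℂ)) ⊆ (chartAt ℂ i).source) ∧
      (∀ x, ∑ i ∈ T, ρ i x = 1) ∧
      ∑ k, lam k * contourIntegral (γ k) η +
        Complex.I * residueConst * ∑ P ∈ S, h P * r P =
      2 * Complex.I * ∑ i ∈ T, ∫ z, chartExt i (fun x => (ρ i x : ℂ)) z *
        (conj (θ.coeff i z) * η.coeff i z) := by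
  classical
  -- The formula for a function supported near a point.
  have hlocal : ∀ p : X, ∃ N : Set X, IsOpen N ∧ p ∈ N ∧ N ⊆ (chartAt ℂ p).source ∧
      (∀ P ∈ S, P ∈ N → P = p) ∧
      ∀ ρ : X → ℂ, ChartSmooth ρ → tsupport ρ ⊆ N → (p ∈ S → ρ =ᶠ[𝓝 p] 1) →
        Complex.I * ∫ z, dbar (chartExt p ρ) z *
          (h ((chartAt ℂ p).symm z) * η.coeff p z) =
        ∑ k, lam k * (∫ t in (0 : ℝ)..1, ρ (γ k t) * η (γ k t) (velocity (γ k) t)) +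
        Complex.I * residueConst * (∑ P ∈ S, ρ P * (h P * r P)) -
        2 * Complex.I * ∫ z, chartExt p ρ z * (conj (θ.coeff p z) * η.coeff p z) := by
    intro p
    have hps := mem_chart_source ℂ p
    have hsrc : ∀ᶠ x in 𝓝 p, x ∈ (chartAt ℂ p).source := (chartAt ℂ p).open_source.mem_nhds hps
    -- conditions that hold near `p`
    have hS' : ∀ᶠ x in 𝓝 p, ∀ P ∈ S, x = P → P = p := by
      have : IsClosed ((S.erase p : Finset X) : Set X) := (S.erase p).finite_toSet.isClosed
      filter_upwards [this.isOpen_compl.mem_nhds (by simp)] with x hx P hP hxP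
      by_contra hne
      exact hx (by rw [hxP]; simpa using ⟨hP, hne⟩)
    have hcurve0 : ∀ ρ : X → ℂ, ∀ k, (∀ x ∈ tsupport ρ, x ∉ range (γ k)) →
        ∫ t in (0 : ℝ)..1, ρ (γ k t) * η (γ k t) (velocity (γ k) t) = 0 := by
      intro ρ k hk
      have : ∀ t, ρ (γ k t) * η (γ k t) (velocity (γ k) t) = 0 := fun t => by
        rw [image_eq_zero_of_notMem_tsupport fun h => hk _ h ⟨t, rfl⟩, zero_mul]
      simp [this]
    by_cases hpS : p ∈ S
    · -- a pole
      obtain ⟨g, hg, hηg⟩ := hpole p hpS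
      obtain ⟨hhp, hθp⟩ := hhS p hpS
      have hc : ContinuousAt (chartAt ℂ p) p := (chartAt ℂ p).continuousAt hps
      have hγc : ∀ᶠ x in 𝓝 p, ∀ k, x ∉ range (γ k) := by
        rw [eventually_all]
        exact fun k => (hD.curve k).isCompact_range.isClosed.isOpen_compl.mem_nhds (hSγ p hpS k)
      rw [eventually_nhdsWithin_iff] at hηg
      have hall := ((hc.eventually ((hg.eventually_analyticAt.and hηg).and hθp)).and hsrc).and
        ((hS'.and hhp).and hγc)
      obtain ⟨N, hN, hNo, hpN⟩ := eventually_nhds_iff.mp hall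
      refine ⟨N, hNo, hpN, fun x hx => (hN x hx).1.2, fun P hP hPN => (hN P hPN).2.1.1 P hP rfl,
        fun ρ hρ hs h1 => ?_⟩
      have hs' : tsupport ρ ⊆ (chartAt ℂ p).source := fun x hx => (hN x (hs hx)).1.2
      have hI := integral_dbar_pole hρ hs' (h1 hpS) (η := η) (r := r p) (g := g) fun x hx => by
        obtain ⟨⟨⟨⟨h2, h3⟩, _⟩, h4⟩, _⟩ := hN x (hs hx)
        refine ⟨h2, fun hne => h3 ?_⟩
        exact fun he => hne ((chartAt ℂ p).injOn h4 hps he)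
      have e1 : ∀ z, dbar (chartExt p ρ) z * (h ((chartAt ℂ p).symm z) * η.coeff p z) =
          h p * (dbar (chartExt p ρ) z * η.coeff p z) := by
        intro z
        by_cases hz : z ∈ tsupport (chartExt p ρ)
        · rw [(hN _ (hs (symm_mem_of_mem_tsupport hs' hz))).2.1.2]
          ring
        · have : dbar (chartExt p ρ) z = 0 := by
            by_contra h
            exact hz (support_dbar_subset _ h)
          rw [this]
          ring
      have e2 : ∀ z, chartExt p ρ z * (conj (θ.coeff p z) * η.coeff p z) = 0 := by
        intro z
        by_cases hz : z ∈ tsupport (chartExt p ρ)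
        · have hz' := (hN _ (hs (symm_mem_of_mem_tsupport hs' hz))).1.1.2
          rw [(chartAt ℂ p).right_inv (tsupport_chartExt_subset_target hs' hz)] at hz'
          rw [hz', map_zero]
          ring
        · rw [image_eq_zero_of_notMem_tsupport hz, zero_mul]
      have e3 : ∑ P ∈ S, ρ P * (h P * r P) = h p * r p := by
        rw [Finset.sum_eq_single p]
        · rw [(h1 hpS).self_of_nhds]; simp
        · intro P hP hne
          rw [image_eq_zero_of_notMem_tsupport fun hP' => hne ((hN P (hs hP')).2.1.1 P hP rfl),
            zero_mul]
        · exact fun hn => absurd hpS hn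
      simp only [e1, e2]
      rw [integral_const_mul, hI, e3, integral_zero, Finset.sum_eq_zero fun k _ => by
        rw [hcurve0 ρ k fun x hx => (hN x (hs hx)).2.2 k, mul_zero]]
      ring
    · -- a point that is not a pole
      obtain ⟨q, μ, hq, hhq, hμ⟩ := hh p
      have hc : ContinuousAt (chartAt ℂ p) p := (chartAt ℂ p).continuousAt hps
      have hne : ∀ᶠ x in 𝓝 p, x ∉ S := by
        filter_upwards [hS'] with x hx hxS
        exact hpS (hx x hxS rfl ▸ hxS)
      have e3 : ∀ N : Set X, (∀ x ∈ N, x ∉ S) → ∀ ρ : X → ℂ, tsupport ρ ⊆ N →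
          ∑ P ∈ S, ρ P * (h P * r P) = 0 := by
        intro N hN ρ hs
        refine Finset.sum_eq_zero fun P hP => ?_
        rw [image_eq_zero_of_notMem_tsupport fun h => hN P (hs h) hP, zero_mul]
      by_cases hpγ : ∃ k, p ∈ range (γ k)
      · obtain ⟨k, t₀, rfl⟩ := hpγ
        obtain ⟨b⟩ := hD.toIsBoundedBy.nonempty_boundaryBox k t₀
        have hall := ((hc.eventually hq).and hhq).and (hne.and
          (show ∀ᶠ x in 𝓝 (γ k t₀), x ∈ b.nhd from b.isOpen_nhd.mem_nhds b.mem_nhd_self))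
        obtain ⟨N, hN, hNo, hpN⟩ := eventually_nhds_iff.mp hall
        refine ⟨N, hNo, hpN, fun x hx => (hN x hx).2.2.1, fun P hP hPN => ((hN P hPN).2.1 hP).elim,
          fun ρ hρ hs _ => ?_⟩
        have hs' : tsupport ρ ⊆ (chartAt ℂ (γ k t₀)).source := fun x hx => (hN x (hs hx)).2.2.1
        have hη' : ∀ x ∈ tsupport ρ, HolAt η x := fun x hx => hη x (hN x (hs hx)).2.1
        rw [integral_dbar_mul_jump hD.isOpen hρ hs' hη' (fun x _ => hθ x)
          (fun x hx => (hN x (hs hx)).1.1) (fun x hx => (hN x (hs hx)).1.2), mul_sub,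
          ← mul_assoc Complex.I μ, mul_comm Complex.I μ, mul_assoc μ,
          b.integral_dbar_eq_contour hD hρ (fun x hx => (hN x (hs hx)).2.2) hη',
          e3 N (fun x hx => (hN x hx).2.1) ρ hs, Finset.sum_eq_single k, hμ k ⟨t₀, rfl⟩]
        · ring
        · intro l _ hlk
          rw [hcurve0 ρ l, mul_zero]
          rintro x hx ⟨t, rfl⟩
          exact hlk (b.eq_of_curve_mem (hN _ (hs hx)).2.2).1
        · exact fun hk => absurd (Finset.mem_univ k) hk
      · -- away from the curves the characteristic function of `D` is locally constant
        have hpγ' : ∀ k, p ∉ range (γ k) := fun k hk => hpγ ⟨k, hk⟩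
        have hγc : ∀ᶠ x in 𝓝 p, ∀ k, x ∉ range (γ k) := by
          rw [eventually_all]
          exact fun k => (hD.curve k).isCompact_range.isClosed.isOpen_compl.mem_nhds (hpγ' k)
        have hall := ((((hc.eventually hq).and hhq).and
          (hD.toIsBoundedBy.eventually_indicator_eq hpγ')).and
          hsrc).and (hne.and hγc)
        obtain ⟨N, hN, hNo, hpN⟩ := eventually_nhds_iff.mp hall
        refine ⟨N, hNo, hpN, fun x hx => (hN x hx).1.2, fun P hP hPN => ((hN P hPN).2.1 hP).elim,
          fun ρ hρ hs _ => ?_⟩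
        have hs' : tsupport ρ ⊆ (chartAt ℂ p).source := fun x hx => (hN x (hs hx)).1.2
        have hη' : ∀ x ∈ tsupport ρ, HolAt η x := fun x hx => hη x (hN x (hs hx)).2.1
        rw [integral_dbar_mul_jump (q := fun z => q z + μ * D.indicator 1 p) (μ := 0)
          hD.isOpen hρ hs' hη' (fun x _ => hθ x) ?_ ?_, e3 N (fun x hx => (hN x hx).2.1) ρ hs,
          Finset.sum_eq_zero fun k _ => by
            rw [hcurve0 ρ k fun x hx => (hN x (hs hx)).2.2 k, mul_zero]]
        · ring
        · intro x hx
          obtain ⟨h1, h2⟩ := (hN x (hs hx)).1.1.1.1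
          refine ⟨h1.add contDiffAt_const, ?_⟩
          rw [dbar_add (h1.differentiableAt one_ne_zero) (differentiableAt_const _), dbar_const,
            add_zero, h2]
        · intro x hx
          rw [(hN x (hs hx)).1.1.1.2, (hN x (hs hx)).1.1.2]
          ring
  choose N hNo hpN hNs hNS hN using hlocal
  -- A finite partition of unity subordinate to these neighbourhoods.
  have := isManifold_real (X := X)
  obtain ⟨f, hf⟩ := SmoothPartitionOfUnity.exists_isSubordinate 𝓘(ℝ, ℂ) (isClosed_univ (X := X)) N
    hNo fun x _ => mem_iUnion.mpr ⟨x, hpN x⟩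
  have hfin := f.locallyFinite.finite_nonempty_of_compact
  set T : Finset X := hfin.toFinset with hT
  have hT0 : ∀ i, i ∉ T → ∀ x, f i x = 0 := by
    intro i hi x
    by_contra hx
    exact hi (hfin.mem_toFinset.mpr ⟨x, hx⟩)
  have hsum : ∀ x, ∑ i ∈ T, f i x = 1 := by
    intro x
    rw [← f.sum_eq_one (mem_univ x), finsum_eq_sum_of_support_subset]
    intro i hi
    by_contra h
    exact hi (hT0 i h x)
  have hts : ∀ i, tsupport (fun x => (f i x : ℂ)) ⊆ N i := fun i => by
    refine (closure_mono fun x hx => ?_).trans (hf i)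
    intro h
    exact hx (by simp only [h, Complex.ofReal_zero])
  have hsm : ∀ i, ChartSmooth fun x => (f i x : ℂ) := fun i =>
    chartSmooth_of_contMDiff (f i).contMDiff
  have hzero : ∀ i, ∀ P ∈ S, P ≠ i → (fun x => (f i x : ℂ)) =ᶠ[𝓝 P] 0 := fun i P hP hne =>
    notMem_tsupport_iff_eventuallyEq.mp fun h => hne (hNS i P hP (hts i h))
  have hone : ∀ P ∈ S, (fun x => (f P x : ℂ)) =ᶠ[𝓝 P] 1 := by
    intro P hP
    have h1 : ∀ᶠ x in 𝓝 P, ∀ i ∈ T, i ≠ P → (f i x : ℂ) = 0 := by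
      rw [eventually_all_finset]
      intro i _
      by_cases hi : i = P
      · exact Eventually.of_forall fun x hx => absurd hi hx
      · filter_upwards [hzero i P hP (Ne.symm hi)] with x hx _ using hx
    filter_upwards [h1] with x hx
    have h2 : ((∑ i ∈ T, f i x : ℝ) : ℂ) = 1 := by rw [hsum]; simp
    push_cast at h2
    by_cases hPT : P ∈ T
    · rw [Finset.sum_eq_single P (fun i hi hne => hx i hi hne) fun h => absurd hPT h] at h2
      exact h2
    · rw [Finset.sum_eq_zero fun i hi => hx i hi fun h => hPT (h ▸ hi)] at h2
      exact absurd h2 zero_ne_one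
  refine ⟨T, fun i x => f i x, fun i x => f.nonneg i x, fun i _ => hsm i,
    fun i _ => (hts i).trans (hNs i), hsum, ?_⟩
  have hsumC : ∀ x, ∑ i ∈ T, (f i x : ℂ) = 1 := fun x => by
    rw [← Complex.ofReal_sum, hsum, Complex.ofReal_one]
  -- The left-hand sides of the local formulas add up to zero.
  have hglobal := sum_integral_dbar_partition (T := T) (ρ := fun i x => (f i x : ℂ)) (h := h) (η := η)
    (fun i _ => hsm i) (fun i _ => (hts i).trans (hNs i)) hsumC (by
      intro p z hz
      set x := (chartAt ℂ p).symm z with hx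
      by_cases hxS : x ∈ S
      · right
        intro i _
        by_cases hi : i = x
        · exact ⟨1, by rw [hi]; exact hone x hxS⟩
        · exact ⟨0, hzero i x hxS (Ne.symm hi)⟩
      · left
        have hzs : x ∈ (chartAt ℂ p).source := (chartAt ℂ p).map_target hz
        obtain ⟨q, μ, hq, hhq, -⟩ := hh x
        have hηz : AnalyticAt ℂ (η.coeff p) z := (hη x hxS).analyticAt_symm hz
        have hqx : ContinuousAt (fun w => q (trans p x w)) z := by
          refine ContinuousAt.comp (g := q) ?_
            (differentiableAt_trans hz (mem_chart_source ℂ _)).continuousAt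
          have := hq.self_of_nhds.1.continuousAt
          exact this
        have hqc : ∀ᶠ w in 𝓝 z, ContinuousAt (fun w => q (trans p x w)) w := by
          have ht : ContinuousAt (trans p x) z :=
            (differentiableAt_trans hz (mem_chart_source ℂ _)).continuousAt
          have h1 : ∀ᶠ w in 𝓝 z, ContDiffAt ℝ 1 q (trans p x w) :=
            ht.eventually (hq.mono fun _ h => h.1)
          filter_upwards [h1, eventually_symm_mem_source hz (mem_chart_source ℂ x)] with w h2 h3
          exact ContinuousAt.comp (g := q) h2.continuousAt
            (differentiableAt_trans h3.1 h3.2).continuousAt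
        have hall := (hqc.and hηz.eventually_analyticAt).and (target_mem_nhds hz)
        obtain ⟨R, hR, hRs⟩ := Metric.nhds_basis_closedBall.mem_iff.mp hall
        have hcomp := isCompact_closedBall z R
        have hI1 : IntegrableOn (fun w => q (trans p x w) * η.coeff p w) (Metric.closedBall z R) :=
          ContinuousOn.integrableOn_compact hcomp fun w hw => ((hRs hw).1.1.mul
            (hRs hw).1.2.continuousAt).continuousWithinAt
        obtain ⟨s, hs, hI2⟩ := integrableAtFilter_indicator_symm hD.isOpen hz
        have hI3 : IntegrableAtFilter (fun w => D.indicator 1 ((chartAt ℂ p).symm w) *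
            (μ * η.coeff p w)) (𝓝 z) := by
          obtain ⟨R', hR', hRs'⟩ := Metric.nhds_basis_closedBall.mem_iff.mp
            (inter_mem hs (Metric.closedBall_mem_nhds z hR))
          refine ⟨_, Metric.closedBall_mem_nhds z hR', ?_⟩
          refine (hI2.mono_set (hRs'.trans inter_subset_left)).mul_continuousOn ?_
            (isCompact_closedBall z R')
          exact fun w hw => (continuousAt_const.mul
            (hRs (hRs' hw).2).1.2.continuousAt).continuousWithinAt
        have hI4 : IntegrableAtFilter (fun w => q (trans p x w) * η.coeff p w +
            D.indicator 1 ((chartAt ℂ p).symm w) * (μ * η.coeff p w)) (𝓝 z) :=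
          IntegrableAtFilter.add ⟨_, Metric.closedBall_mem_nhds z hR, hI1⟩ hI3
        have hev := eventually_symm_mem hz hhq
        obtain ⟨s', hs', hI5⟩ := hI4
        obtain ⟨s'', hs'', hmeas⟩ : ∃ s'' ∈ 𝓝 z, MeasurableSet s'' ∧ s'' ⊆ s' ∧
            ∀ w ∈ s'', h ((chartAt ℂ p).symm w) = q (trans p x w) +
              μ * D.indicator 1 ((chartAt ℂ p).symm w) := by
          obtain ⟨R', hR', hRs'⟩ := Metric.nhds_basis_closedBall.mem_iff.mp (inter_mem hs' hev)
          exact ⟨_, Metric.closedBall_mem_nhds z hR', Metric.isClosed_closedBall.measurableSet,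
            hRs'.trans inter_subset_left, fun w hw => (hRs' hw).2⟩
        refine ⟨s'', hs'', (hI5.mono_set hmeas.2.1).congr_fun (fun w hw => ?_) hmeas.1⟩
        simp only
        rw [hmeas.2.2 w hw]
        ring)
  have hsumloc : Complex.I * ∑ i ∈ T, ∫ z, dbar (chartExt i fun x => (f i x : ℂ)) z *
      (h ((chartAt ℂ i).symm z) * η.coeff i z) = ∑ i ∈ T,
      (∑ k, lam k * (∫ t in (0 : ℝ)..1, (f i (γ k t) : ℂ) * η (γ k t) (velocity (γ k) t)) +
        Complex.I * residueConst * (∑ P ∈ S, (f i P : ℂ) * (h P * r P)) -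
        2 * Complex.I * ∫ z, chartExt i (fun x => (f i x : ℂ)) z *
          (conj (θ.coeff i z) * η.coeff i z)) := by
    rw [Finset.mul_sum]
    refine Finset.sum_congr rfl fun i _ => ?_
    exact hN i _ (hsm i) (hts i) fun hiS => hone i hiS
  rw [hglobal, mul_zero, Finset.sum_sub_distrib, Finset.sum_add_distrib,
    ← Finset.mul_sum, ← Finset.mul_sum] at hsumloc
  have hS1 : ∑ i ∈ T, ∑ P ∈ S, (f i P : ℂ) * (h P * r P) = ∑ P ∈ S, h P * r P := by
    rw [Finset.sum_comm]
    exact Finset.sum_congr rfl fun P _ => by rw [← Finset.sum_mul, hsumC, one_mul]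
  have hk1 : ∀ k, ∑ i ∈ T, lam k * (∫ t in (0 : ℝ)..1, (f i (γ k t) : ℂ) *
      η (γ k t) (velocity (γ k) t)) = lam k * contourIntegral (γ k) η := by
    intro k
    have hγη : ∀ t, HolAt η (γ k t) := fun t => hη _ fun hS => hSγ _ hS k ⟨t, rfl⟩
    have hcont := (hD.curve k).continuous_apply_velocity hγη
    rw [← Finset.mul_sum, ← intervalIntegral.integral_finsetSum, contourIntegral]
    · congr 2
      ext t
      rw [← Finset.sum_mul, hsumC, one_mul]
    · intro i _
      refine Continuous.intervalIntegrable (Continuous.mul ?_ hcont) _ _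
      exact Complex.continuous_ofReal.comp ((f i).contMDiff.continuous.comp (hD.curve k).continuous)
  rw [hS1, Finset.sum_comm, Finset.sum_congr rfl fun k _ => hk1 k] at hsumloc
  linear_combination -hsumloc

end Stokes

/-! ### Consequences of Stokes' theorem -/

section Consequences

variable {X : Type*} [TopologicalSpace X] [ChartedSpace ℂ X] {ι : Type*} {D : Set X}
  {γ : ι → ℝ → X}

/-- The residue theorem for a region with smooth boundary and a differential with simple poles. The
constant `-i * residueConst` is `2πi`. -/
theorem sum_contourIntegral_eq_residues [IsManifold 𝓘(ℂ, ℂ) ω X] [CompactSpace X] [T2Space X]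
    [Fintype ι] (hD : IsRegularBoundary D γ) {S : Finset X}
    (hSγ : ∀ P ∈ S, ∀ k, P ∉ range (γ k)) {η : Differential X} (hη : ∀ x, x ∉ S → HolAt η x)
    {r : X → ℂ} (hpole : ∀ P ∈ S, ∃ g, AnalyticAt ℂ g (chartAt ℂ P P) ∧
      ∀ᶠ z in 𝓝[≠] (chartAt ℂ P P), η.coeff P z = r P / (z - chartAt ℂ P P) + g z) :
    ∑ k, contourIntegral (γ k) η =
      -(Complex.I * residueConst) * ∑ P ∈ S, D.indicator 1 P * r P := by
  obtain ⟨T, ρ, -, -, -, -, h⟩ := stokes hD hSγ hη (θ := 0) (fun x => HolAt.zero x) hpole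
    (h := D.indicator 1) (lam := fun _ => 1)
    (fun p => ⟨fun _ => 0, 1, Eventually.of_forall fun z =>
      ⟨contDiffAt_const, by rw [dbar_const, coeff_zero]; simp⟩,
      Eventually.of_forall fun x => by simp, fun _ _ => rfl⟩)
    (fun P hP => ⟨hD.toIsBoundedBy.eventually_indicator_eq (hSγ P hP),
      Eventually.of_forall fun z => coeff_zero P z⟩)
  simp only [coeff_zero, map_zero, zero_mul, mul_zero, integral_zero, Finset.sum_const_zero,
    one_mul] at h
  linear_combination h

/-- The function `h` is a primitive of `ω₁ + conj ω₂` off the curves `γ k`, and jumps by `lam k` when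
one crosses `γ k` in the direction of `D`. -/
def IsJumpPrimitive (D : Set X) (γ : ι → ℝ → X) (ω₁ ω₂ : Differential X) (lam : ι → ℂ)
    (h : X → ℂ) : Prop :=
  ∀ p : X, ∃ (F₁ F₂ : ℂ → ℂ) (μ : ℂ), (∀ᶠ z in 𝓝 (chartAt ℂ p p),
      HasDerivAt F₁ (ω₁.coeff p z) z ∧ HasDerivAt F₂ (ω₂.coeff p z) z) ∧
    (∀ᶠ x in 𝓝 p, h x = F₁ (chartAt ℂ p x) + conj (F₂ (chartAt ℂ p x)) + μ * D.indicator 1 x) ∧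
    ∀ k, p ∈ range (γ k) → μ = lam k

theorem IsJumpPrimitive.conj {ω₁ ω₂ : Differential X} {lam : ι → ℂ} {h : X → ℂ}
    (hh : IsJumpPrimitive D γ ω₁ ω₂ lam h) :
    IsJumpPrimitive D γ ω₂ ω₁ (fun k => conj (lam k)) (fun x => conj (h x)) := by
  intro p
  obtain ⟨F₁, F₂, μ, hF, hx, hμ⟩ := hh p
  refine ⟨F₂, F₁, conj μ, hF.mono fun z hz => hz.symm, hx.mono fun x hx => ?_,
    fun k hk => by rw [hμ k hk]⟩
  beta_reduce
  rw [hx, map_add, map_add, map_mul, Complex.conj_conj, add_comm (F₂ _)]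
  congr 2
  by_cases hxD : x ∈ D
  · rw [indicator_of_mem hxD, Pi.one_apply, map_one]
  · rw [indicator_of_notMem hxD, map_zero]

theorem analyticAt_of_eventually_hasDerivAt {F f : ℂ → ℂ} {z : ℂ}
    (h : ∀ᶠ w in 𝓝 z, HasDerivAt F (f w) w) : AnalyticAt ℂ F z :=
  Complex.analyticAt_iff_eventually_differentiableAt.mpr (h.mono fun _ hw => hw.differentiableAt)

variable [IsManifold 𝓘(ℂ, ℂ) ω X]

/-- Stokes' theorem on an annulus around `γ k`. -/
theorem IsJumpPrimitive.contourIntegral_add_conj (hD : IsBoundedBy D γ) {ω₁ ω₂ : Differential X}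
    (h₁ : ∀ x, HolAt ω₁ x) (h₂ : ∀ x, HolAt ω₂ x) {lam : ι → ℂ} {h : X → ℂ}
    (hh : IsJumpPrimitive D γ ω₁ ω₂ lam h) (k : ι) :
    contourIntegral (γ k) ω₁ + conj (contourIntegral (γ k) ω₂) = 0 := by
  have hγ := hD.curve k
  have hc₁ := hγ.continuous_apply_velocity (η := ω₁) fun t => h₁ _
  have hc₂ := hγ.continuous_apply_velocity (η := ω₂) fun t => h₂ _
  have hd : ∀ t, HasDerivAt (fun s => h (γ k s)) (ω₁ (γ k t) (velocity (γ k) t) +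
      conj (ω₂ (γ k t) (velocity (γ k) t))) t := by
    intro t
    obtain ⟨F₁, F₂, μ, hF, hx, -⟩ := hh (γ k t)
    have hsrc := mem_chart_source ℂ (γ k t)
    have hcd := ((hγ.contDiffAt hsrc).differentiableAt one_ne_zero).hasDerivAt
    obtain ⟨hF₁, hF₂⟩ := hF.self_of_nhds
    have e₁ : HasDerivAt (fun s => F₁ (chartAt ℂ (γ k t) (γ k s)))
        (ω₁ (γ k t) (velocity (γ k) t)) t := by
      rw [hγ.apply_velocity hsrc]
      exact HasDerivAt.comp (h₂ := F₁) t hF₁ hcd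
    have e₂ : HasDerivAt (fun s => F₂ (chartAt ℂ (γ k t) (γ k s)))
        (ω₂ (γ k t) (velocity (γ k) t)) t := by
      rw [hγ.apply_velocity hsrc]
      exact HasDerivAt.comp (h₂ := F₂) t hF₂ hcd
    have e₃ := e₁.add (Complex.conjCLE.hasFDerivAt.comp_hasDerivAt t e₂)
    refine e₃.congr_of_eventuallyEq ?_
    filter_upwards [hγ.continuous.continuousAt.eventually hx] with s hs
    rw [hs, indicator_of_notMem, mul_zero, add_zero]
    · rfl
    · intro hsD
      have : γ k s ∈ frontier D := by rw [hD.frontier_eq]; exact mem_iUnion.mpr ⟨k, s, rfl⟩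
      rw [hD.isOpen.frontier_eq] at this
      exact this.2 hsD
  have hc₂' : Continuous fun t => conj (ω₂ (γ k t) (velocity (γ k) t)) :=
    Complex.continuous_conj.comp hc₂
  have h1 := intervalIntegral.integral_eq_sub_of_hasDerivAt (a := 0) (b := 1) (fun t _ => hd t)
    ((hc₁.add hc₂').intervalIntegrable 0 1)
  rw [intervalIntegral.integral_add (hc₁.intervalIntegrable 0 1) (hc₂'.intervalIntegrable 0 1)] at h1
  have h2 : γ k 1 = γ k 0 := by simpa using hγ.periodic 0
  rw [h2, sub_self] at h1
  rw [← h1, contourIntegral, contourIntegral]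
  congr 1
  rw [intervalIntegral.integral_of_le zero_le_one, intervalIntegral.integral_of_le zero_le_one,
    integral_conj]

variable [CompactSpace X] [T2Space X] [Fintype ι]

/-- If the jumps of a primitive of `ω₁ + conj ω₂` are orthogonal to the periods of `ω₂`, the energy
of `ω₂` vanishes. -/
theorem IsJumpPrimitive.right_eq_zero (hD : IsRegularBoundary D γ) {ω₁ ω₂ : Differential X}
    (h₂ : ∀ x, HolAt ω₂ x) {lam : ι → ℂ} {h : X → ℂ} (hh : IsJumpPrimitive D γ ω₁ ω₂ lam h)
    (hper : ∑ k, lam k * contourIntegral (γ k) ω₂ = 0) : ω₂ = 0 := by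
  obtain ⟨T, ρ, hρ0, hρs, hρt, hρ1, hst⟩ := stokes hD (S := ∅) (by simp) (η := ω₂) (θ := ω₂)
    (fun x _ => h₂ x) h₂ (r := 0) (by simp) (h := h) (lam := lam) (fun p => by
      obtain ⟨F₁, F₂, μ, hF, hx, hμ⟩ := hh p
      refine ⟨fun z => F₁ z + conj (F₂ z), μ, ?_, hx, hμ⟩
      filter_upwards [hF.eventually_nhds] with z hz
      have a₁ : AnalyticAt ℂ F₁ z := analyticAt_of_eventually_hasDerivAt (hz.mono fun _ h => h.1)
      have a₂ : AnalyticAt ℂ F₂ z := analyticAt_of_eventually_hasDerivAt (hz.mono fun _ h => h.2)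
      have c₁ : ContDiffAt ℝ 1 F₁ z := a₁.contDiffAt.restrict_scalars ℝ
      have c₂ : ContDiffAt ℝ 1 (fun z => conj (F₂ z)) z :=
        Complex.conjCLE.contDiff.contDiffAt.comp z (a₂.contDiffAt.restrict_scalars ℝ)
      refine ⟨c₁.add c₂, ?_⟩
      rw [dbar_add (c₁.differentiableAt one_ne_zero) (c₂.differentiableAt one_ne_zero),
        dbar_eq_zero a₁.differentiableAt, dbar_conj hz.self_of_nhds.2, zero_add]) (by simp)
  rw [hper, Finset.sum_empty, mul_zero, add_zero] at hst
  -- Each term of the energy is the integral of a non-negative function.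
  set e : X → ℂ → ℝ := fun i z => (chartExt i (fun x => (ρ i x : ℂ)) z).re *
    Complex.normSq (ω₂.coeff i z) with he
  have him : ∀ i z, (chartExt i (fun x => (ρ i x : ℂ)) z).im = 0 := by
    intro i z
    by_cases hz : z ∈ (chartAt ℂ i).target
    · rw [chartExt_of_mem hz]; simp
    · rw [chartExt, indicator_of_notMem hz]; simp
  have hre : ∀ i z, 0 ≤ (chartExt i (fun x => (ρ i x : ℂ)) z).re := by
    intro i z
    by_cases hz : z ∈ (chartAt ℂ i).target
    · rw [chartExt_of_mem hz]; simpa using hρ0 i _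
    · rw [chartExt, indicator_of_notMem hz]; simp
  have hee : ∀ i z, chartExt i (fun x => (ρ i x : ℂ)) z * (conj (ω₂.coeff i z) * ω₂.coeff i z) =
      (e i z : ℂ) := by
    intro i z
    rw [← Complex.normSq_eq_conj_mul_self, he]
    push_cast
    congr 1
    exact Complex.ext (by simp) (by simp [him i z])
  have hcont : ∀ i ∈ T, Continuous (e i) := by
    intro i hi
    have h1 : Continuous fun z => chartExt i (fun x => (ρ i x : ℂ)) z *
        (conj (ω₂.coeff i z) * ω₂.coeff i z) := by
      refine (contDiff_mul_of_tsupport (contDiff_chartExt (hρs i hi) (hρt i hi))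
        fun z hz => ?_).continuous
      have := ((h₂ _).analyticAt_symm
        (tsupport_chartExt_subset_target (hρt i hi) hz)).contDiffAt.restrict_scalars ℝ (n := 1)
      exact (Complex.conjCLE.contDiff.contDiffAt.comp z this).mul this
    have h2 : e i = fun z => (chartExt i (fun x => (ρ i x : ℂ)) z *
        (conj (ω₂.coeff i z) * ω₂.coeff i z)).re := by
      ext z
      rw [hee, Complex.ofReal_re]
    rw [h2]
    exact Complex.continuous_re.comp h1
  have hcs : ∀ i ∈ T, HasCompactSupport (e i) := by
    intro i hi
    refine (hasCompactSupport_chartExt (hρt i hi)).mono' fun z hz => subset_tsupport _ ?_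
    intro h0
    exact hz (by simp [he, h0])
  have hpos : ∀ i z, 0 ≤ e i z := fun i z => mul_nonneg (hre i z) (Complex.normSq_nonneg _)
  have hsum : ∑ i ∈ T, ∫ z, e i z = 0 := by
    have h1 : ((∑ i ∈ T, ∫ z, e i z : ℝ) : ℂ) = 0 := by
      simp only [hee, integral_complex_ofReal] at hst
      push_cast
      have : 2 * Complex.I ≠ 0 := by simp
      exact (mul_eq_zero.mp hst.symm).resolve_left this
    exact_mod_cast h1
  have hzero : ∀ i ∈ T, ∀ z, e i z = 0 := by
    intro i hi z
    by_contra hne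
    have h1 := (hcont i hi).integral_pos_of_hasCompactSupport_nonneg_nonzero (μ := volume)
      (hcs i hi) (hpos i) hne
    have h2 := (Finset.sum_eq_zero_iff_of_nonneg fun j _ => integral_nonneg (hpos j)).mp hsum i hi
    exact h1.ne' h2
  funext x
  have hx : ∃ i ∈ T, ρ i x ≠ 0 := by
    by_contra hcon
    push Not at hcon
    have := hρ1 x
    rw [Finset.sum_eq_zero hcon] at this
    exact zero_ne_one this
  obtain ⟨i, hi, hne⟩ := hx
  have hsrc : x ∈ (chartAt ℂ i).source :=
    hρt i hi (subset_tsupport _ (by simpa using hne))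
  have h3 := hzero i hi (chartAt ℂ i x)
  rw [he] at h3
  simp only at h3
  rw [chartExt_of_mem ((chartAt ℂ i).map_source hsrc), (chartAt ℂ i).left_inv hsrc,
    Complex.ofReal_re] at h3
  have h4 := Complex.normSq_eq_zero.mp ((mul_eq_zero.mp h3).resolve_left hne)
  have h5 := eq_of_coeff_eq (η := ω₂) (θ := 0) ((chartAt ℂ i).map_source hsrc)
    (by rw [h4, coeff_zero])
  rwa [(chartAt ℂ i).left_inv hsrc] at h5

end Consequences

/-! ### Jump primitives of holomorphic differentials -/

section JumpPrimitives

theorem eq_of_isPreconnected {X Y : Type*} [TopologicalSpace X] {s : Set X}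
    (hs : IsPreconnected s) {f : X → Y} (hf : ∀ x ∈ s, ∀ᶠ y in 𝓝[s] x, f y = f x) {x y : X}
    (hx : x ∈ s) (hy : y ∈ s) : f x = f y :=
  hs.induction₂ (fun x y => f x = f y) (fun x hx => (hf x hx).mono fun _ h => h.symm)
    (fun _ _ _ _ _ _ h₁ h₂ => h₁.trans h₂) (fun _ _ _ _ h => h.symm) hx hy

theorem eventually_sub_eq_of_hasDerivAt {A B a : ℂ → ℂ} {z₀ : ℂ}
    (h : ∀ᶠ z in 𝓝 z₀, HasDerivAt A (a z) z ∧ HasDerivAt B (a z) z) :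
    ∀ᶠ z in 𝓝 z₀, A z - A z₀ = B z - B z₀ := by
  obtain ⟨r, hr, hball⟩ := Metric.eventually_nhds_iff_ball.mp h
  filter_upwards [Metric.ball_mem_nhds _ hr] with z hz
  have hd : ∀ w ∈ Metric.ball z₀ r, HasDerivAt (fun w => A w - B w) 0 w := fun w hw =>
    ((hball w hw).1.fun_sub (hball w hw).2).congr_deriv (sub_self _)
  have := (convex_ball z₀ r).is_const_of_fderivWithin_eq_zero (𝕜 := ℂ)
    (fun w hw => (hd w hw).differentiableAt.differentiableWithinAt)
    (fun w hw => by
      rw [fderivWithin_of_isOpen Metric.isOpen_ball hw, (hd w hw).hasFDerivAt.fderiv]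
      ext; simp) hz (Metric.mem_ball_self hr)
  linear_combination this

variable {X : Type*} [TopologicalSpace X] [ChartedSpace ℂ X]

variable {ι : Type*} {D : Set X} {γ : ι → ℝ → X}

variable [IsManifold 𝓘(ℂ, ℂ) ω X]

/-- A primitive of a holomorphic differential is locally constant, with the same jump along all
boundary curves of a connected region with connected exterior. -/
theorem IsJumpPrimitive.eq_zero_of_right_eq_zero [CompactSpace X] [T2Space X] [Fintype ι]
    (hD : IsRegularBoundary D γ) (hDc : IsPreconnected D) (hDe : IsPreconnected (closure D)ᶜ)
    {ω₁ : Differential X} (h₁ : ∀ x, HolAt ω₁ x) {lam : ι → ℂ} {h : X → ℂ}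
    (hh : IsJumpPrimitive D γ ω₁ 0 lam h) : ω₁ = 0 ∧ ∀ k l, lam k = lam l := by
  have hω : ω₁ = 0 := by
    refine hh.conj.right_eq_zero hD h₁ ?_
    refine Finset.sum_eq_zero fun k _ => ?_
    have := hh.contourIntegral_add_conj hD.toIsBoundedBy h₁ (fun x => HolAt.zero x) k
    have h0 : contourIntegral (γ k) (0 : Differential X) = 0 := by simp [contourIntegral]
    rw [h0, map_zero, add_zero] at this
    rw [this, mul_zero]
  subst hω
  refine ⟨rfl, ?_⟩
  have key : ∀ p : X, ∃ c μ : ℂ, (∀ᶠ x in 𝓝 p, h x = c + μ * D.indicator 1 x) ∧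
      ∀ k, p ∈ range (γ k) → μ = lam k := by
    intro p
    obtain ⟨F₁, F₂, μ, hF, hx, hμ⟩ := hh p
    have hcst : ∀ F : ℂ → ℂ, (∀ᶠ z in 𝓝 (chartAt ℂ p p), HasDerivAt F 0 z) →
        ∀ᶠ z in 𝓝 (chartAt ℂ p p), F z = F (chartAt ℂ p p) := by
      intro F hF
      filter_upwards [eventually_sub_eq_of_hasDerivAt (B := fun _ => 0)
        (hF.mono fun z hz => ⟨hz, hasDerivAt_const z 0⟩)] with z hz
      linear_combination hz
    have hφ := (chartAt ℂ p).continuousAt (mem_chart_source ℂ p)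
    have hF₁ := hφ.eventually (hcst F₁ (hF.mono fun z hz => by simpa [coeff_zero] using hz.1))
    have hF₂ := hφ.eventually (hcst F₂ (hF.mono fun z hz => by simpa [coeff_zero] using hz.2))
    refine ⟨F₁ (chartAt ℂ p p) + conj (F₂ (chartAt ℂ p p)), μ, ?_, hμ⟩
    filter_upwards [hx, hF₁, hF₂] with x hx h₁ h₂
    rw [hx, h₁, h₂]
  have hin : ∀ x ∈ D, ∀ y ∈ D, h x = h y := by
    refine fun x hx y hy => eq_of_isPreconnected hDc (fun p hp => ?_) hx hy
    obtain ⟨c, μ, hc, -⟩ := key p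
    filter_upwards [mem_nhdsWithin_of_mem_nhds hc, self_mem_nhdsWithin] with x hx hxD
    rw [hx, hc.self_of_nhds, indicator_of_mem hxD, indicator_of_mem hp]
    rfl
  have hout : ∀ x ∈ (closure D)ᶜ, ∀ y ∈ (closure D)ᶜ, h x = h y := by
    refine fun x hx y hy => eq_of_isPreconnected hDe (fun p hp => ?_) hx hy
    obtain ⟨c, μ, hc, -⟩ := key p
    filter_upwards [mem_nhdsWithin_of_mem_nhds hc, self_mem_nhdsWithin] with x hx hxD
    rw [hx, hc.self_of_nhds, indicator_of_notMem fun h => hxD (subset_closure h),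
      indicator_of_notMem fun h => hp (subset_closure h)]
  have hjump : ∀ k, ∃ x ∈ D, ∃ y ∈ (closure D)ᶜ, lam k = h x - h y := by
    intro k
    obtain ⟨c, μ, hc, hμ⟩ := key (γ k 0)
    have hcl : γ k 0 ∈ closure D := frontier_subset_closure
      (by rw [hD.frontier_eq]; exact mem_iUnion.mpr ⟨k, 0, rfl⟩)
    have hcl' : γ k 0 ∈ closure (closure D)ᶜ := by
      rw [closure_compl]
      exact hD.exterior k 0
    obtain ⟨x, hx, hxD⟩ := mem_closure_iff_nhds.mp hcl _ hc
    obtain ⟨y, hy, hyD⟩ := mem_closure_iff_nhds.mp hcl' _ hc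
    refine ⟨x, hxD, y, hyD, ?_⟩
    rw [mem_ofPred_eq] at hx hy
    rw [hx, hy, indicator_of_mem hxD, indicator_of_notMem fun h => hyD (subset_closure h),
      hμ k ⟨0, rfl⟩]
    simp
  intro k l
  obtain ⟨x, hx, y, hy, e⟩ := hjump k
  obtain ⟨x', hx', y', hy', e'⟩ := hjump l
  rw [e, e', hin x hx x' hx', hout y hy y' hy']

end JumpPrimitives

/-! ### Germ families and their periods -/

section GermFamilies

variable {X : Type*}

/-- A family of germs of functions `F p` at the points `p`, any two neighbouring ones of which
differ by a locally constant function. It is a section of the sheaf of functions modulo locally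
constant functions. -/
def IsGermFamily [TopologicalSpace X] (F : X → X → ℂ) : Prop :=
  ∀ p, ∀ᶠ q in 𝓝 p, ∀ᶠ z in 𝓝 q, F q z - F q q = F p z - F p q

/-- `f` is the continuation of the germ family `F` along the map `γ` on `B`. -/
def IsLift {E : Type*} [TopologicalSpace E] (F : X → X → ℂ) (γ : E → X) (B : Set E) (f : E → ℂ) :
    Prop :=
  ∀ t ∈ B, ∀ᶠ s in 𝓝[B] t, f s - f t = F (γ t) (γ s) - F (γ t) (γ t)

section Lift

variable {E E' : Type*} [TopologicalSpace E] [TopologicalSpace E'] {F F' : X → X → ℂ} {γ : E → X}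
  {B : Set E} {f f' : E → ℂ}

theorem IsLift.sub_eq (hf : IsLift F γ B f) (hf' : IsLift F γ B f') (hB : IsPreconnected B)
    {s t : E} (hs : s ∈ B) (ht : t ∈ B) : f s - f t = f' s - f' t := by
  have h := eq_of_isPreconnected hB (f := fun t => f t - f' t) (fun t ht => by
    filter_upwards [hf t ht, hf' t ht] with s h h'
    linear_combination h - h') hs ht
  linear_combination h

theorem IsLift.comp {σ : E' → E} {B' : Set E'} (hf : IsLift F γ B f) (hσ : ContinuousOn σ B')
    (hm : MapsTo σ B' B) : IsLift F (γ ∘ σ) B' (f ∘ σ) := fun t ht =>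
  ((hσ t ht).tendsto_nhdsWithin hm).eventually (hf (σ t) (hm ht))

theorem IsLift.congr {γ' : E → X} (hf : IsLift F γ B f) (h : EqOn γ γ' B) : IsLift F γ' B f := by
  intro t ht
  filter_upwards [hf t ht, self_mem_nhdsWithin] with s hs hsB
  rw [hs, h ht, h hsB]

theorem IsLift.add (hf : IsLift F γ B f) (hf' : IsLift F' γ B f') :
    IsLift (fun p z => F p z + F' p z) γ B (fun t => f t + f' t) := by
  intro t ht
  filter_upwards [hf t ht, hf' t ht] with s h h'
  linear_combination h + h'

theorem IsLift.const_mul (c : ℂ) (hf : IsLift F γ B f) :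
    IsLift (fun p z => c * F p z) γ B (fun t => c * f t) := by
  intro t ht
  filter_upwards [hf t ht] with s h
  linear_combination c * h

theorem isLift_period_eq_of_const {f : ℝ → ℂ} {γ : ℝ → X} (hf : IsLift F γ (Icc 0 1) f)
    {x : X} (hγ : ∀ t ∈ Icc (0 : ℝ) 1, γ t = x) : f 1 = f 0 := by
  refine eq_of_isPreconnected isPreconnected_Icc (fun t ht => ?_)
    (right_mem_Icc.mpr zero_le_one) (left_mem_Icc.mpr zero_le_one)
  filter_upwards [hf t ht, self_mem_nhdsWithin] with s hs hsB
  rw [hγ t ht, hγ s hsB, sub_self] at hs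
  exact sub_eq_zero.mp hs

variable [TopologicalSpace X]

theorem IsLift.congr_family (hf : IsLift F γ B f) (hγ : ContinuousOn γ B)
    (h : ∀ p, ∀ᶠ z in 𝓝 p, F' p z - F' p p = F p z - F p p) : IsLift F' γ B f := by
  intro t ht
  filter_upwards [hf t ht, (hγ t ht).eventually (h (γ t))] with s hs hsF
  rw [hs, hsF]

/-- Where a single germ represents the family, it is itself a lift. -/
theorem isLift_of_forall {p : X} (hγ : ContinuousOn γ B)
    (h : ∀ t ∈ B, ∀ᶠ z in 𝓝 (γ t), F (γ t) z - F (γ t) (γ t) = F p z - F p (γ t)) :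
    IsLift F γ B (fun t => F p (γ t)) := by
  intro t ht
  filter_upwards [(hγ t ht).eventually (h t ht)] with s hs
  exact hs.symm

end Lift

variable [TopologicalSpace X]

/-- A local cocycle on a convex compact set is a coboundary. -/
theorem exists_of_local_cocycle {E : Type*} [NormedAddCommGroup E] [NormedSpace ℝ E] {B : Set E}
    (hB : Convex ℝ B) (hBc : IsCompact B) (h0 : (0 : E) ∈ B) {a : E → E → ℂ} {δ : ℝ} (hδ : 0 < δ)
    (ha : ∀ x ∈ B, ∀ y ∈ B, ∀ z ∈ B, dist x y < δ → dist y z < δ → dist x z < δ →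
      a x y + a y z = a x z) :
    ∃ (f : E → ℂ) (ε : ℝ), 0 < ε ∧ ∀ x ∈ B, ∀ y ∈ B, dist x y < ε → f y - f x = a x y := by
  obtain ⟨R, hR⟩ := hBc.isBounded.exists_norm_le
  obtain ⟨N, hN⟩ := exists_nat_gt (2 * R / δ)
  have hR0 : 0 ≤ R := (norm_nonneg _).trans (hR 0 h0)
  have hN0 : (0 : ℝ) < N := (by positivity : 0 ≤ 2 * R / δ).trans_lt hN
  set x' : E → ℕ → E := fun x i => ((i : ℝ) / N) • x with hx'
  have hmem : ∀ x ∈ B, ∀ i ≤ N, x' x i ∈ B := by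
    intro x hx i hi
    refine hB.smul_mem_of_zero_mem h0 hx ⟨by positivity, ?_⟩
    rw [div_le_one hN0]
    exact_mod_cast hi
  have hstep : ∀ x ∈ B, ∀ i, dist (x' x i) (x' x (i + 1)) < δ / 2 := by
    intro x hx i
    rw [dist_eq_norm, hx']
    simp only
    rw [← sub_smul, norm_smul, Real.norm_eq_abs,
      show ((i : ℝ) / N - ((i + 1 : ℕ) : ℝ) / N) = -(1 / N) by push_cast; ring, abs_neg,
      abs_of_pos (by positivity)]
    calc 1 / (N : ℝ) * ‖x‖ ≤ 1 / N * R := by gcongr; exact hR x hx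
      _ = R / N := by ring
      _ < δ / 2 := by
        rw [div_lt_iff₀ hδ] at hN
        rw [div_lt_iff₀ hN0]
        linarith
  have hcross : ∀ x y : E, ∀ i ≤ N, dist (x' x i) (x' y i) ≤ dist x y := by
    intro x y i hi
    rw [hx', dist_smul₀, Real.norm_eq_abs, abs_of_nonneg (by positivity)]
    refine mul_le_of_le_one_left dist_nonneg ?_
    rw [div_le_one hN0]
    exact_mod_cast hi
  refine ⟨fun x => ∑ i ∈ Finset.range N, a (x' x i) (x' x (i + 1)), δ / 2, by linarith, ?_⟩
  intro x hx y hy hxy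
  have hterm : ∀ i ∈ Finset.range N, a (x' y i) (x' y (i + 1)) - a (x' x i) (x' x (i + 1)) =
      a (x' x (i + 1)) (x' y (i + 1)) - a (x' x i) (x' y i) := by
    intro i hi
    have hi' : i + 1 ≤ N := Finset.mem_range.mp hi
    have m1 := hmem x hx i (by omega)
    have m2 := hmem x hx (i + 1) hi'
    have m3 := hmem y hy i (by omega)
    have m4 := hmem y hy (i + 1) hi'
    have c1 := hcross x y i (by omega)
    have c2 := hcross x y (i + 1) hi'
    have s1 := hstep x hx i
    have s2 := hstep y hy i
    have d : dist (x' x i) (x' y (i + 1)) < δ := by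
      linarith [dist_triangle (x' x i) (x' y i) (x' y (i + 1))]
    have e1 := ha _ m1 _ m2 _ m4 (by linarith) (by linarith) d
    have e2 := ha _ m1 _ m3 _ m4 (by linarith) (by linarith) d
    linear_combination e2 - e1
  rw [← Finset.sum_sub_distrib, Finset.sum_congr rfl hterm, Finset.sum_range_sub
    (fun i => a (x' x i) (x' y i))]
  have hz : a 0 0 = 0 := by
    have := ha 0 h0 0 h0 0 h0 (by simpa) (by simpa) (by simpa)
    linear_combination this
  have e1 : ∀ x, x' x N = x := fun x => by rw [hx']; simp [div_self hN0.ne']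
  have e0 : ∀ x, x' x 0 = 0 := fun x => by rw [hx']; simp
  rw [e1, e1, e0, e0, hz, sub_zero]

/-- A germ family can be continued along any map from a convex compact set. -/
theorem IsGermFamily.exists_isLift {F : X → X → ℂ} (hF : IsGermFamily F) {E : Type*}
    [NormedAddCommGroup E] [NormedSpace ℝ E] {B : Set E} (hB : Convex ℝ B) (hBc : IsCompact B)
    (h0 : (0 : E) ∈ B) {γ : E → X} (hγ : Continuous γ) : ∃ f, IsLift F γ B f := by
  choose N hN hNo hNp using fun p => mem_nhds_iff.mp (hF p)
  obtain ⟨δ, hδ, hleb⟩ := lebesgue_number_lemma_of_metric (s := B) (c := fun p : X => γ ⁻¹' N p) hBc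
    (fun p => (hNo p).preimage hγ) fun t _ => mem_iUnion.mpr ⟨γ t, hNp (γ t)⟩
  have : Nonempty X := ⟨γ 0⟩
  choose! P hP using hleb
  -- Two of the chosen germs differ by a constant on the intersection of two balls.
  have hcmp : ∀ x ∈ B, ∀ y ∈ B, ∀ s ∈ B ∩ (Metric.ball x δ ∩ Metric.ball y δ),
      ∀ t ∈ B ∩ (Metric.ball x δ ∩ Metric.ball y δ),
      F (P x) (γ s) - F (P y) (γ s) = F (P x) (γ t) - F (P y) (γ t) := by
    intro x hx y hy s hs t ht
    refine eq_of_isPreconnected (f := fun s => F (P x) (γ s) - F (P y) (γ s))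
      (hB.inter ((convex_ball x δ).inter (convex_ball y δ))).isPreconnected (fun u hu => ?_) hs ht
    have h1 := hγ.continuousAt.eventually (hN _ (hP x hx hu.2.1))
    have h2 := hγ.continuousAt.eventually (hN _ (hP y hy hu.2.2))
    filter_upwards [mem_nhdsWithin_of_mem_nhds h1, mem_nhdsWithin_of_mem_nhds h2] with v e1 e2
    linear_combination e2 - e1
  obtain ⟨f, ε, hε, hf⟩ := exists_of_local_cocycle hB hBc h0
    (a := fun x y => F (P x) (γ y) - F (P x) (γ x)) hδ (by
      intro x hx y hy z hz hxy hyz hxz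
      have := hcmp x hx y hy y ⟨hy, by rwa [Metric.mem_ball'], Metric.mem_ball_self hδ⟩ z
        ⟨hz, by rwa [Metric.mem_ball'], by rwa [Metric.mem_ball']⟩
      linear_combination this)
  refine ⟨f, fun t ht => ?_⟩
  have h1 := hγ.continuousAt.eventually (hN _ (hP t ht (Metric.mem_ball_self hδ)))
  filter_upwards [mem_nhdsWithin_of_mem_nhds h1, self_mem_nhdsWithin,
    mem_nhdsWithin_of_mem_nhds (Metric.ball_mem_nhds t hε)] with s hs hsB hst
  rw [hf t ht s hsB (by rwa [Metric.mem_ball'] at hst), hs]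

open Classical in
/-- The increment of the germ family `F` along the path `p` (zero if `F` is not a germ family). -/
noncomputable def period (F : X → X → ℂ) {x y : X} (p : Path x y) : ℂ :=
  if h : ∃ f, IsLift F p.extend (Icc 0 1) f then h.choose 1 - h.choose 0 else 0

variable {F : X → X → ℂ} {x y z : X}

theorem IsLift.period_eq {p : Path x y} {f : ℝ → ℂ} (hf : IsLift F p.extend (Icc 0 1) f) :
    period F p = f 1 - f 0 := by
  have h : ∃ f, IsLift F p.extend (Icc 0 1) f := ⟨f, hf⟩
  rw [period, dif_pos h]
  exact h.choose_spec.sub_eq hf isPreconnected_Icc (right_mem_Icc.mpr zero_le_one)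
    (left_mem_Icc.mpr zero_le_one)

theorem IsGermFamily.exists_isLift_path (hF : IsGermFamily F) (p : Path x y) :
    ∃ f, IsLift F p.extend (Icc 0 1) f :=
  hF.exists_isLift (convex_Icc 0 1) isCompact_Icc (left_mem_Icc.mpr zero_le_one) p.extend.continuous

theorem period_add {F' F'' : X → X → ℂ} (hF : IsGermFamily F) (hF' : IsGermFamily F')
    (h : ∀ p, ∀ᶠ z in 𝓝 p, F'' p z - F'' p p = (F p z + F' p z) - (F p p + F' p p))
    (p : Path x y) : period F'' p = period F p + period F' p := by
  obtain ⟨f, hf⟩ := hF.exists_isLift_path p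
  obtain ⟨f', hf'⟩ := hF'.exists_isLift_path p
  rw [((hf.add hf').congr_family p.extend.continuous.continuousOn h).period_eq, hf.period_eq,
    hf'.period_eq]
  ring

theorem period_const_mul {F' : X → X → ℂ} (hF : IsGermFamily F) (c : ℂ)
    (h : ∀ p, ∀ᶠ z in 𝓝 p, F' p z - F' p p = c * F p z - c * F p p)
    (p : Path x y) : period F' p = c * period F p := by
  obtain ⟨f, hf⟩ := hF.exists_isLift_path p
  rw [((hf.const_mul c).congr_family p.extend.continuous.continuousOn h).period_eq, hf.period_eq]
  ring

theorem IsGermFamily.period_trans (hF : IsGermFamily F) (p : Path x y) (q : Path y z) :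
    period F (p.trans q) = period F p + period F q := by
  obtain ⟨f, hf⟩ := hF.exists_isLift_path (p.trans q)
  have h1 : IsLift F p.extend (Icc 0 1) (f ∘ fun t => t / 2) := by
    refine (hf.comp (σ := fun t : ℝ => t / 2) (by fun_prop) fun t ht =>
      ⟨by linarith [ht.1], by linarith [ht.2]⟩).congr fun t ht => ?_
    rw [Function.comp_apply, Path.extend_trans_of_le_half _ _ (by linarith [ht.2])]
    ring_nf
  have h2 : IsLift F q.extend (Icc 0 1) (f ∘ fun t => (1 + t) / 2) := by
    refine (hf.comp (σ := fun t : ℝ => (1 + t) / 2) (by fun_prop) fun t ht =>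
      ⟨by linarith [ht.1], by linarith [ht.2]⟩).congr fun t ht => ?_
    rw [Function.comp_apply, Path.extend_trans_of_half_le _ _ (by linarith [ht.1])]
    ring_nf
  rw [hf.period_eq, h1.period_eq, h2.period_eq]
  simp only [Function.comp_apply]
  norm_num

theorem IsGermFamily.period_symm (hF : IsGermFamily F) (p : Path x y) :
    period F p.symm = -period F p := by
  obtain ⟨f, hf⟩ := hF.exists_isLift_path p
  have h1 : IsLift F p.symm.extend (Icc 0 1) (f ∘ fun t => 1 - t) := by
    refine (hf.comp (σ := fun t : ℝ => 1 - t) (by fun_prop) fun t ht =>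
      ⟨by linarith [ht.2], by linarith [ht.1]⟩).congr fun t ht => ?_
    rw [Function.comp_apply, Path.extend_symm_apply]
  rw [hf.period_eq, h1.period_eq]
  simp

theorem IsGermFamily.period_homotopic (hF : IsGermFamily F) {p q : Path x y}
    (h : p.Homotopic q) : period F p = period F q := by
  obtain ⟨H⟩ := h
  set Γ : ℝ × ℝ → X := fun w => H (projIcc 0 1 zero_le_one w.1, projIcc 0 1 zero_le_one w.2) with hΓ
  have hΓc : Continuous Γ := by
    have : Continuous (projIcc (0 : ℝ) 1 zero_le_one) := continuous_projIcc
    exact H.continuous.comp (by fun_prop)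
  have m0 : (0 : ℝ) ∈ Icc (0 : ℝ) 1 := left_mem_Icc.mpr zero_le_one
  have m1 : (1 : ℝ) ∈ Icc (0 : ℝ) 1 := right_mem_Icc.mpr zero_le_one
  obtain ⟨f, hf⟩ := hF.exists_isLift (B := Icc (0 : ℝ) 1 ×ˢ Icc (0 : ℝ) 1)
    ((convex_Icc 0 1).prod (convex_Icc 0 1)) (isCompact_Icc.prod isCompact_Icc) ⟨m0, m0⟩ hΓc
  have l1 : IsLift F p.extend (Icc 0 1) (f ∘ fun t => (0, t)) := by
    refine (hf.comp (σ := fun t : ℝ => ((0 : ℝ), t)) (by fun_prop) fun t ht => ⟨m0, ht⟩).congr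
      fun t ht => ?_
    simp [hΓ, Path.extend_apply _ ht, projIcc_of_mem _ ht]
  have l2 : IsLift F q.extend (Icc 0 1) (f ∘ fun t => (1, t)) := by
    refine (hf.comp (σ := fun t : ℝ => ((1 : ℝ), t)) (by fun_prop) fun t ht => ⟨m1, ht⟩).congr
      fun t ht => ?_
    simp [hΓ, Path.extend_apply _ ht, projIcc_of_mem _ ht]
  have l3 := isLift_period_eq_of_const (x := x) (hf.comp (σ := fun t : ℝ => (t, (0 : ℝ)))
    (by fun_prop) fun t ht => ⟨ht, m0⟩) fun t _ => by simp [hΓ]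
  have l4 := isLift_period_eq_of_const (x := y) (hf.comp (σ := fun t : ℝ => (t, (1 : ℝ)))
    (by fun_prop) fun t ht => ⟨ht, m1⟩) fun t _ => by simp [hΓ]
  rw [l1.period_eq, l2.period_eq]
  simp only [Function.comp_apply] at l3 l4 ⊢
  rw [l3, l4]

/-- The homomorphism from the first homology group given by the periods of a germ family. -/
theorem IsGermFamily.exists_period_hom (hF : IsGermFamily F) (x : X) :
    ∃ φ : Additive (Abelianization (FundamentalGroup X x)) →+ ℂ, ∀ p : Path x x,
      φ (Additive.ofMul (Abelianization.of
        (FundamentalGroup.fromPath (Path.Homotopic.Quotient.mk p)))) = period F p := by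
  let ψ : FundamentalGroup X x → ℂ :=
    Quotient.lift (fun p : Path x x => period F p) fun _ _ h => hF.period_homotopic h
  have hψ : ∀ a b, ψ (a * b) = ψ a + ψ b := by
    intro a b
    induction a using Path.Homotopic.Quotient.ind with | _ p
    induction b using Path.Homotopic.Quotient.ind with | _ q
    exact (hF.period_trans q p).trans (add_comm _ _)
  let ψ' : FundamentalGroup X x →* Multiplicative ℂ :=
    MonoidHom.mk' (fun a => Multiplicative.ofAdd (ψ a)) fun a b => by rw [hψ]; rfl
  refine ⟨(Abelianization.lift ψ').toAdditiveLeft, fun p => ?_⟩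
  simp only [MonoidHom.toAdditiveLeft_apply_apply, toMul_ofMul, Abelianization.lift_apply_of]
  rfl

/-- A germ family without periods comes from a function. -/
theorem IsGermFamily.exists_function [LocallyPathConnectedSpace X] [PathConnectedSpace X]
    (hF : IsGermFamily F) (x : X) (h0 : ∀ p : Path x x, period F p = 0) :
    ∃ h : X → ℂ, ∀ p, ∀ᶠ z in 𝓝 p, h z - h p = F p z - F p p := by
  have hindep : ∀ y (p q : Path x y), period F p = period F q := by
    intro y p q
    have := h0 (p.trans q.symm)
    rw [hF.period_trans, hF.period_symm] at this
    linear_combination this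
  refine ⟨fun y => period F (PathConnectedSpace.somePath x y), fun p => ?_⟩
  obtain ⟨V, ⟨hVn, hVc⟩, hV⟩ := (path_connected_basis p).mem_iff.mp
    (eventually_eventually_nhds.mpr (hF p))
  filter_upwards [hVn] with z hz
  obtain ⟨q, hq⟩ := hVc.joinedIn p (mem_of_mem_nhds hVn) z hz
  have hlift : IsLift F q.extend (Icc 0 1) (fun t => F p (q.extend t)) := by
    refine isLift_of_forall q.extend.continuous.continuousOn fun t ht => ?_
    rw [Path.extend_apply _ ht]
    have : q ⟨t, ht⟩ ∈ V := hq _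
    have h3 : ∀ᶠ w in 𝓝 (q ⟨t, ht⟩), _ := hV this
    exact h3.self_of_nhds
  have h1 := hindep z (PathConnectedSpace.somePath x z) ((PathConnectedSpace.somePath x p).trans q)
  rw [hF.period_trans, hlift.period_eq, Path.extend_zero, Path.extend_one] at h1
  linear_combination h1

/-- For a space of genus `g` there are `2 g` loops such that a homomorphism from the first homology
group to `ℂ` vanishes if it vanishes on these loops. -/
theorem HasGenus.exists_loops {g : ℕ} (hg : HasGenus X g) (x : X) :
    ∃ ℓ : Fin (2 * g) → Path x x,
      ∀ φ : Additive (Abelianization (FundamentalGroup X x)) →+ ℂ,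
        (∀ i, φ (Additive.ofMul (Abelianization.of
          (FundamentalGroup.fromPath (Path.Homotopic.Quotient.mk (ℓ i))))) = 0) → φ = 0 := by
  obtain ⟨b, hb⟩ := exists_linearIndependent_of_le_rank (hg x).ge
  have hsurj : ∀ a : Additive (Abelianization (FundamentalGroup X x)), ∃ p : Path x x,
      Additive.ofMul (Abelianization.of
        (FundamentalGroup.fromPath (Path.Homotopic.Quotient.mk p))) = a := by
    intro a
    obtain ⟨c, hc⟩ := QuotientGroup.mk_surjective a.toMul
    obtain ⟨p, hp⟩ := Quotient.exists_rep c
    exact ⟨p, by rw [← ofMul_toMul a, ← hc, ← hp]; rfl⟩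
  choose ℓ hℓ using fun i => hsurj (b i)
  refine ⟨ℓ, fun φ hφ => ?_⟩
  simp only [hℓ] at hφ
  refine DFunLike.ext _ _ fun a => ?_
  rw [AddMonoidHom.zero_apply]
  by_contra hne
  have hspan : ∀ y ∈ Submodule.span ℤ (range b), φ y = 0 := by
    intro y hy
    have : Submodule.span ℤ (range b) ≤ LinearMap.ker φ.toIntLinearMap :=
      Submodule.span_le.mpr (by rintro _ ⟨i, rfl⟩; exact hφ i)
    exact this hy
  have hli := LinearIndependent.finCons' a b hb fun c y hy h => by
    have h1 := congrArg φ h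
    rw [map_add, hspan y hy, add_zero, map_zsmul, map_zero] at h1
    exact (smul_eq_zero.mp h1).resolve_right hne
  have h2 := hli.cardinal_lift_le_rank
  rw [hg x] at h2
  simp only [Cardinal.mk_fin, Cardinal.lift_natCast] at h2
  have h3 : 2 * g + 1 ≤ 2 * g := by exact_mod_cast h2
  omega

end GermFamilies

/-! ### Existence of jump primitives -/

section PeriodMap

variable {X : Type*} {ι : Type*}

open Classical in
/-- The value of `lam` on the curve through `p`, and zero off the curves. -/
noncomputable def jumpAt (γ : ι → ℝ → X) (lam : ι → ℂ) (p : X) : ℂ :=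
  if h : ∃ k, p ∈ range (γ k) then lam h.choose else 0

theorem jumpAt_add (γ : ι → ℝ → X) (lam lam' : ι → ℂ) (p : X) :
    jumpAt γ (lam + lam') p = jumpAt γ lam p + jumpAt γ lam' p := by
  by_cases h : ∃ k, p ∈ range (γ k)
  · simp only [jumpAt, dif_pos h, Pi.add_apply]
  · simp only [jumpAt, dif_neg h, add_zero]

theorem jumpAt_smul (γ : ι → ℝ → X) (r : ℝ) (lam : ι → ℂ) (p : X) :
    jumpAt γ (r • lam) p = r * jumpAt γ lam p := by
  by_cases h : ∃ k, p ∈ range (γ k)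
  · simp only [jumpAt, dif_pos h, Pi.smul_apply, Complex.real_smul]
  · simp only [jumpAt, dif_neg h, mul_zero]

variable [TopologicalSpace X] [ChartedSpace ℂ X]

theorem exists_primitive_of_analyticAt {f : ℂ → ℂ} {z : ℂ} (hf : AnalyticAt ℂ f z) :
    ∃ F : ℂ → ℂ, ∀ᶠ w in 𝓝 z, HasDerivAt F (f w) w := by
  obtain ⟨r, hr, hball⟩ := Metric.eventually_nhds_iff_ball.mp
    (Complex.analyticAt_iff_eventually_differentiableAt.mp hf)
  obtain ⟨F, hF⟩ := DifferentiableOn.isExactOn_ball (c := z) (r := r) (f := f)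
    fun w hw => (hball w hw).differentiableWithinAt
  exact ⟨F, by filter_upwards [Metric.ball_mem_nhds z hr] with w hw using hF w hw⟩

open Classical in
/-- A primitive of `θ` near `p`, in the coordinate of the chart around `p` (zero if there is
none). -/
noncomputable def localPrimitive (θ : Differential X) (p : X) : ℂ → ℂ :=
  if h : ∃ F : ℂ → ℂ, ∀ᶠ z in 𝓝 (chartAt ℂ p p), HasDerivAt F (θ.coeff p z) z then h.choose else 0

theorem HolAt.hasDerivAt_localPrimitive {θ : Differential X} {p : X} (h : HolAt θ p) :
    ∀ᶠ z in 𝓝 (chartAt ℂ p p), HasDerivAt (localPrimitive θ p) (θ.coeff p z) z := by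
  have h' := exists_primitive_of_analyticAt h
  rw [localPrimitive, dif_pos h']
  exact h'.choose_spec

theorem localPrimitive_add {θ θ' : Differential X} {p : X} (h : HolAt θ p) (h' : HolAt θ' p) :
    ∀ᶠ x in 𝓝 p, localPrimitive (θ + θ') p (chartAt ℂ p x) -
        localPrimitive (θ + θ') p (chartAt ℂ p p) =
      (localPrimitive θ p (chartAt ℂ p x) + localPrimitive θ' p (chartAt ℂ p x)) -
        (localPrimitive θ p (chartAt ℂ p p) + localPrimitive θ' p (chartAt ℂ p p)) := by
  refine ((chartAt ℂ p).continuousAt (mem_chart_source ℂ p)).eventually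
    (eventually_sub_eq_of_hasDerivAt (a := (θ + θ').coeff p)
      (B := fun z => localPrimitive θ p z + localPrimitive θ' p z) ?_)
  filter_upwards [(h.add h').hasDerivAt_localPrimitive, h.hasDerivAt_localPrimitive,
    h'.hasDerivAt_localPrimitive] with z h1 h2 h3
  refine ⟨h1, ?_⟩
  rw [coeff_add]
  exact h2.add h3

theorem localPrimitive_smul {θ : Differential X} {p : X} (c : ℂ) (h : HolAt θ p) :
    ∀ᶠ x in 𝓝 p, localPrimitive (c • θ) p (chartAt ℂ p x) -
        localPrimitive (c • θ) p (chartAt ℂ p p) =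
      c * localPrimitive θ p (chartAt ℂ p x) - c * localPrimitive θ p (chartAt ℂ p p) := by
  refine ((chartAt ℂ p).continuousAt (mem_chart_source ℂ p)).eventually
    (eventually_sub_eq_of_hasDerivAt (a := (c • θ).coeff p)
      (B := fun z => c * localPrimitive θ p z) ?_)
  filter_upwards [(h.smul c).hasDerivAt_localPrimitive, h.hasDerivAt_localPrimitive] with z h1 h2
  refine ⟨h1, ?_⟩
  rw [coeff_smul]
  exact h2.const_mul c

theorem IsBoundedBy.jumpAt_eq {D : Set X} {γ : ι → ℝ → X} (hD : IsBoundedBy D γ) (lam : ι → ℂ)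
    {p : X} {k : ι} (hp : p ∈ range (γ k)) : jumpAt γ lam p = lam k := by
  have h : ∃ k, p ∈ range (γ k) := ⟨k, hp⟩
  rw [jumpAt, dif_pos h]
  congr 1
  by_contra hne
  exact disjoint_left.mp (hD.disj _ _ hne) h.choose_spec hp

/-- The local jump primitives of `ω₁ + conj ω₂`. -/
noncomputable def jumpFamily (D : Set X) (γ : ι → ℝ → X) (ω₁ ω₂ : Differential X) (lam : ι → ℂ)
    (p x : X) : ℂ :=
  localPrimitive ω₁ p (chartAt ℂ p x) + conj (localPrimitive ω₂ p (chartAt ℂ p x)) +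
    jumpAt γ lam p * D.indicator 1 x

variable {D : Set X} {γ : ι → ℝ → X}

theorem isJumpPrimitive_of_forall {ω₁ ω₂ : Differential X}
    (hD : IsBoundedBy D γ) (h₁ : ∀ x, HolAt ω₁ x) (h₂ : ∀ x, HolAt ω₂ x) {lam : ι → ℂ} {h : X → ℂ}
    (hh : ∀ p, ∀ᶠ z in 𝓝 p,
      h z - h p = jumpFamily D γ ω₁ ω₂ lam p z - jumpFamily D γ ω₁ ω₂ lam p p) :
    IsJumpPrimitive D γ ω₁ ω₂ lam h := by
  intro p
  refine ⟨fun z => localPrimitive ω₁ p z + (h p - jumpFamily D γ ω₁ ω₂ lam p p),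
    localPrimitive ω₂ p, jumpAt γ lam p, ?_, ?_, fun k hk => hD.jumpAt_eq lam hk⟩
  · filter_upwards [(h₁ p).hasDerivAt_localPrimitive, (h₂ p).hasDerivAt_localPrimitive] with z e₁ e₂
    exact ⟨e₁.add_const _, e₂⟩
  · filter_upwards [hh p] with x hx
    have : jumpFamily D γ ω₁ ω₂ lam p x = localPrimitive ω₁ p (chartAt ℂ p x) +
      conj (localPrimitive ω₂ p (chartAt ℂ p x)) + jumpAt γ lam p * D.indicator 1 x := rfl
    linear_combination hx + this

variable [IsManifold 𝓘(ℂ, ℂ) ω X]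

theorem localPrimitive_consistent {θ : Differential X} (h : ∀ x, HolAt θ x) (p : X) :
    ∀ᶠ q in 𝓝 p, ∀ᶠ x in 𝓝 q,
      localPrimitive θ q (chartAt ℂ q x) - localPrimitive θ q (chartAt ℂ q q) =
        localPrimitive θ p (chartAt ℂ p x) - localPrimitive θ p (chartAt ℂ p q) := by
  have hsrc := mem_chart_source ℂ p
  filter_upwards [((chartAt ℂ p).continuousAt hsrc).eventually
    (h p).hasDerivAt_localPrimitive.eventually_nhds, (chartAt ℂ p).open_source.mem_nhds hsrc]
    with q hq hqs
  have hqq := mem_chart_source ℂ q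
  have hz := chart_mem_target q
  have hzs : (chartAt ℂ q).symm (chartAt ℂ q q) ∈ (chartAt ℂ p).source := by
    rwa [(chartAt ℂ q).left_inv hqq]
  have hτ : ∀ᶠ w in 𝓝 (chartAt ℂ q q),
      HasDerivAt (localPrimitive θ p) (θ.coeff p (trans q p w)) (trans q p w) := by
    refine (differentiableAt_trans hz hzs).continuousAt.eventually
      (p := fun w => HasDerivAt (localPrimitive θ p) (θ.coeff p w) w) ?_
    rwa [trans_chart hqq]
  have key := eventually_sub_eq_of_hasDerivAt (z₀ := chartAt ℂ q q) (a := θ.coeff q)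
    (A := localPrimitive θ q) (B := fun w => localPrimitive θ p (trans q p w)) (by
      filter_upwards [(h q).hasDerivAt_localPrimitive, hτ, eventually_symm_mem_source hz hzs]
        with w h1 h2 h3
      refine ⟨h1, ?_⟩
      rw [coeff_trans θ h3.1 h3.2]
      exact h2.comp w (differentiableAt_trans h3.1 h3.2).hasDerivAt)
  filter_upwards [((chartAt ℂ q).continuousAt hqq).eventually key,
    (chartAt ℂ q).open_source.mem_nhds hqq] with x hx hxs
  rw [hx, trans_chart hxs, trans_chart hqq]

theorem isGermFamily_jumpFamily [T2Space X] [Finite ι] (hD : IsBoundedBy D γ)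
    {ω₁ ω₂ : Differential X} (h₁ : ∀ x, HolAt ω₁ x) (h₂ : ∀ x, HolAt ω₂ x) (lam : ι → ℂ) :
    IsGermFamily (jumpFamily D γ ω₁ ω₂ lam) := by
  intro p
  have hclosed : ∀ k, IsClosed (range (γ k)) := fun k => (hD.curve k).isCompact_range.isClosed
  have hjump : ∀ᶠ q in 𝓝 p, ∀ᶠ x in 𝓝 q,
      jumpAt γ lam q * D.indicator 1 x - jumpAt γ lam q * D.indicator 1 q =
        jumpAt γ lam p * D.indicator 1 x - jumpAt γ lam p * D.indicator 1 q := by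
    have hev : ∀ᶠ q in 𝓝 p, ∀ k, q ∈ range (γ k) → p ∈ range (γ k) := by
      refine eventually_all.mpr fun k => ?_
      by_cases hp : p ∈ range (γ k)
      · exact Eventually.of_forall fun _ _ => hp
      · filter_upwards [(hclosed k).isOpen_compl.mem_nhds hp] with q hq hq' using (hq hq').elim
    filter_upwards [hev] with q hq
    by_cases hqc : ∃ k, q ∈ range (γ k)
    · obtain ⟨k, hk⟩ := hqc
      rw [hD.jumpAt_eq lam hk, hD.jumpAt_eq lam (hq k hk)]
      exact Eventually.of_forall fun _ => rfl
    · push Not at hqc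
      filter_upwards [hD.eventually_indicator_eq hqc] with x hx
      rw [hx]
      ring
  filter_upwards [localPrimitive_consistent h₁ p, localPrimitive_consistent h₂ p, hjump]
    with q e₁ e₂ e₃
  filter_upwards [e₁, e₂, e₃] with x e₁ e₂ e₃
  have e₂' := congrArg conj e₂
  rw [map_sub, map_sub] at e₂'
  simp only [jumpFamily]
  linear_combination e₁ + e₂' + e₃

/-- The obstruction to the existence of a jump primitive consists of the `2 g` periods of the
local ones. -/
theorem exists_period_map [CompactSpace X] [T2Space X] [ConnectedSpace X] [Finite ι] {g : ℕ}
    (hg : HasGenus X g) (hD : IsBoundedBy D γ) :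
    ∃ Θ : (holForms X × holForms X × (ι → ℂ)) →ₗ[ℝ] (Fin (2 * g) → ℂ), ∀ v, Θ v = 0 →
      ∃ h, IsJumpPrimitive D γ (v.1 : Differential X) (v.2.1 : Differential X) v.2.2 h := by
  have : LocallyPathConnectedSpace X := ChartedSpace.locallyPathConnectedSpace ℂ X
  have : PathConnectedSpace X := pathConnectedSpace_iff_connectedSpace.mpr inferInstance
  obtain ⟨x⟩ : Nonempty X := inferInstance
  obtain ⟨ℓ, hℓ⟩ := hg.exists_loops x
  let F : holForms X × holForms X × (ι → ℂ) → X → X → ℂ :=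
    fun v => jumpFamily D γ v.1 v.2.1 v.2.2
  have hF : ∀ v, IsGermFamily (F v) := fun v =>
    isGermFamily_jumpFamily hD v.1.2 v.2.1.2 v.2.2
  refine ⟨⟨⟨fun v i => period (F v) (ℓ i), fun v w => funext fun i => ?_⟩,
    fun r v => funext fun i => ?_⟩, fun v hv => ?_⟩
  · refine period_add (hF v) (hF w) (fun p => ?_) (ℓ i)
    filter_upwards [localPrimitive_add (v.1.2 p) (w.1.2 p),
      localPrimitive_add (v.2.1.2 p) (w.2.1.2 p)] with z e₁ e₂
    have e₂' := congrArg conj e₂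
    simp only [map_sub, map_add] at e₂'
    simp only [F, jumpFamily, Prod.fst_add, Prod.snd_add, Submodule.coe_add, jumpAt_add]
    linear_combination e₁ + e₂'
  · refine period_const_mul (hF v) r (fun p => ?_) (ℓ i)
    filter_upwards [localPrimitive_smul (r : ℂ) (v.1.2 p),
      localPrimitive_smul (r : ℂ) (v.2.1.2 p)] with z e₁ e₂
    have e₂' := congrArg conj e₂
    simp only [map_sub, map_mul, Complex.conj_ofReal] at e₂'
    have c₁ : (((r • v).1 : holForms X) : Differential X) = (r : ℂ) • (v.1 : Differential X) := rfl
    have c₂ : (((r • v).2.1 : holForms X) : Differential X) =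
      (r : ℂ) • (v.2.1 : Differential X) := rfl
    have c₃ : (r • v).2.2 = r • v.2.2 := rfl
    simp only [F, jumpFamily, c₁, c₂, c₃, jumpAt_smul]
    linear_combination e₁ + e₂'
  · obtain ⟨φ, hφ⟩ := (hF v).exists_period_hom x
    have h0 : φ = 0 := hℓ φ fun i => by
      rw [hφ]
      exact congrFun hv i
    obtain ⟨h, hh⟩ := (hF v).exists_function x fun p => by rw [← hφ, h0, AddMonoidHom.zero_apply]
    exact ⟨h, isJumpPrimitive_of_forall hD v.1.2 v.2.1.2 hh⟩

end PeriodMap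

/-! ### Holomorphic differentials without boundary periods -/

section DimensionCount

theorem exists_mem_ker_of_finrank_le {E L M H : Type*} [AddCommGroup E] [Module ℝ E]
    [FiniteDimensional ℝ E] [AddCommGroup L] [Module ℝ L] [FiniteDimensional ℝ L] [AddCommGroup M]
    [Module ℝ M] [FiniteDimensional ℝ M] [AddCommGroup H] [Module ℝ H] [FiniteDimensional ℝ H]
    (Θ : (E × E × L) →ₗ[ℝ] M) (φ : L →ₗ[ℝ] H)
    (hrank : Module.finrank ℝ M + Module.finrank ℝ H ≤ Module.finrank ℝ E + Module.finrank ℝ L)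
    (hinj : ∀ v, Θ v = 0 → v.2.1 = 0 → φ v.2.2 = 0 → v = 0) (w : E) :
    ∃ v, Θ v = 0 ∧ v.2.1 = w := by
  let π : LinearMap.ker Θ →ₗ[ℝ] E × H :=
    (LinearMap.prodMap LinearMap.id φ ∘ₗ LinearMap.snd ℝ E (E × L)) ∘ₗ (LinearMap.ker Θ).subtype
  have hπ : ∀ v, π v = (v.1.2.1, φ v.1.2.2) := fun v => rfl
  have hπinj : Function.Injective π := by
    refine (injective_iff_map_eq_zero π).mpr fun v hv => ?_
    rw [hπ, Prod.mk_eq_zero] at hv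
    exact Subtype.ext (hinj v.1 v.2 hv.1 hv.2)
  have hsurj : Function.Surjective π := by
    have e₁ := LinearMap.finrank_range_add_finrank_ker Θ
    have e₂ := Submodule.finrank_le (LinearMap.range Θ)
    have e₃ := LinearMap.finrank_le_finrank_of_injective hπinj
    rw [Module.finrank_prod] at e₃
    rw [Module.finrank_prod, Module.finrank_prod] at e₁
    refine (LinearMap.injective_iff_surjective_of_finrank_eq_finrank ?_).mp hπinj
    rw [Module.finrank_prod]
    omega
  obtain ⟨v, hv⟩ := hsurj (w, 0)
  rw [hπ, Prod.mk.injEq] at hv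
  exact ⟨v, v.2, hv.1⟩

variable {X : Type*} [TopologicalSpace X] [ChartedSpace ℂ X] [IsManifold 𝓘(ℂ, ℂ) ω X]
  [CompactSpace X] [T2Space X] [ConnectedSpace X] {ι : Type*} [Fintype ι] {D : Set X}
  {γ : ι → ℝ → X}

/-- In a `g`-dimensional space of holomorphic differentials, only `0` has vanishing periods along
the `g + 1` boundary curves of a region which is connected and has connected exterior.

The triples `(ω₁, ω₂, lam)` that possess a jump primitive form a real vector space of dimension at
least `2 dim E + 2`, since the existence of a jump primitive amounts to `2 g` complex conditions. As
`lam` is constant and `ω₁ = 0` once `ω₂ = 0`, every `ω₂` occurs in such a triple. -/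
theorem eq_zero_of_contourIntegral_eq_zero {E : Type*} [AddCommGroup E] [Module ℂ E]
    [FiniteDimensional ℂ E] {g : ℕ} (hg : HasGenus X g)
    (hD : IsRegularBoundary D γ) (hDc : IsPreconnected D) (hDe : IsPreconnected (closure D)ᶜ)
    (hι : Fintype.card ι = g + 1) {Φ : E →ₗ[ℂ] holForms X} (hΦ : Function.Injective Φ)
    (hdim : g ≤ Module.finrank ℂ E) {w : E}
    (hper : ∀ k, contourIntegral (γ k) (Φ w : Differential X) = 0) : w = 0 := by
  have k₀ : ι := (Fintype.card_pos_iff.mp (by omega)).some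
  obtain ⟨Θ, hΘ⟩ : ∃ Θ : (E × E × (ι → ℂ)) →ₗ[ℝ] (Fin (2 * g) → ℂ), ∀ v, Θ v = 0 →
      ∃ h, IsJumpPrimitive D γ (Φ v.1 : Differential X) (Φ v.2.1 : Differential X) v.2.2 h := by
    obtain ⟨Θ, hΘ⟩ := exists_period_map hg hD.toIsBoundedBy
    exact ⟨Θ ∘ₗ (Φ.restrictScalars ℝ).prodMap ((Φ.restrictScalars ℝ).prodMap LinearMap.id),
      fun v hv => hΘ _ hv⟩
  have hrank : Module.finrank ℝ (Fin (2 * g) → ℂ) + Module.finrank ℝ ℂ ≤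
      Module.finrank ℝ E + Module.finrank ℝ (ι → ℂ) := by
    rw [finrank_real_of_complex, finrank_real_of_complex E, finrank_real_of_complex (ι → ℂ),
      finrank_real_of_complex ℂ, Module.finrank_fin_fun, Module.finrank_fintype_fun_eq_card, hι,
      Module.finrank_self]
    omega
  have hΦ0 : ((Φ 0 : holForms X) : Differential X) = 0 := by rw [map_zero]; rfl
  obtain ⟨v, hv, rfl⟩ := exists_mem_ker_of_finrank_le Θ (LinearMap.proj k₀) hrank (by
    rintro ⟨v₁, v₂, lam⟩ hv h0 hlam
    obtain ⟨h, hh⟩ := hΘ _ hv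
    simp only at h0 hh
    rw [h0, hΦ0] at hh
    obtain ⟨h₁, h₂⟩ := hh.eq_zero_of_right_eq_zero hD hDc hDe (fun x => (Φ v₁).2 x)
    have e₁ : v₁ = 0 := hΦ (Subtype.ext (h₁.trans hΦ0.symm))
    have e₂ : lam = 0 := funext fun k => (h₂ k k₀).trans hlam
    rw [h0, e₁, e₂]
    rfl) w
  obtain ⟨h, hh⟩ := hΘ v hv
  have h0 := hh.right_eq_zero hD (fun x => (Φ v.2.1).2 x) (Finset.sum_eq_zero fun k _ => by
    rw [hper k, mul_zero])
  exact hΦ (Subtype.ext (h0.trans hΦ0.symm))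

end DimensionCount

/-! ### Differentials with simple poles -/

section SimplePoles

variable {X : Type*} [TopologicalSpace X] [ChartedSpace ℂ X]

theorem Differential.Equal.eventually {η θ : Differential X} (h : Differential.Equal η θ) (x : X) :
    ∀ᶠ y in 𝓝[≠] x, η y = θ y := by
  filter_upwards [disjoint_principal_right.mp (mem_codiscrete.mp h x)] with y hy
  exact not_not.mp hy

theorem eventually_symm_nhdsNE {x : X} {p : X → Prop} (h : ∀ᶠ y in 𝓝[≠] x, p y) :
    ∀ᶠ z in 𝓝[≠] (chartAt ℂ x x), z ∈ (chartAt ℂ x).target ∧ p ((chartAt ℂ x).symm z) := by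
  have hx := mem_chart_source ℂ x
  have h1 : ∀ᶠ z in 𝓝 (chartAt ℂ x x), (chartAt ℂ x).symm z ∈ {y | y ≠ x → p y} :=
    eventually_symm_mem (chart_mem_target x) (by
      rw [(chartAt ℂ x).left_inv hx]
      exact eventually_nhdsWithin_iff.mp h)
  filter_upwards [mem_nhdsWithin_of_mem_nhds h1,
    mem_nhdsWithin_of_mem_nhds (target_mem_nhds (chart_mem_target x)), self_mem_nhdsWithin]
    with z hz hzt hne
  refine ⟨hzt, hz fun h0 => hne ?_⟩
  exact ((chartAt ℂ x).right_inv hzt).symm.trans (congrArg (chartAt ℂ x) h0)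

/-- `θ` has at most a simple pole at `x`, with residue `r`, and its value at `x` is the constant
term of its Laurent expansion in the chart around `x`. Here `g` is the numerator in
`θ = g(z) / (z - z(x)) dz`. -/
def IsNormalizedAt (θ : Differential X) (x : X) (r : ℂ) : Prop :=
  ∃ g : ℂ → ℂ, AnalyticAt ℂ g (chartAt ℂ x x) ∧ g (chartAt ℂ x x) = r ∧
    deriv g (chartAt ℂ x x) = θ.coeff x (chartAt ℂ x x) ∧
    ∀ᶠ z in 𝓝[≠] (chartAt ℂ x x), θ.coeff x z = g z / (z - chartAt ℂ x x)

theorem IsNormalizedAt.sum {n : ℕ} {θ : Fin n → Differential X} {x : X} {r : Fin n → ℂ}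
    (h : ∀ j, IsNormalizedAt (θ j) x (r j)) (c : Fin n → ℂ) :
    IsNormalizedAt (∑ j, c j • θ j) x (∑ j, c j * r j) := by
  choose g hg hr hd he using h
  refine ⟨fun z => ∑ j, c j * g j z, ?_, ?_, ?_, ?_⟩
  · exact Finset.analyticAt_fun_sum _ fun j _ => analyticAt_const.mul (hg j)
  · simp only [hr]
  · rw [coeff_sum, deriv_fun_sum fun j _ => ((hg j).differentiableAt.const_mul _)]
    refine Finset.sum_congr rfl fun j _ => ?_
    rw [deriv_const_mul _ (hg j).differentiableAt, hd]
  · filter_upwards [eventually_all.mpr he] with z hz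
    rw [coeff_sum, Finset.sum_div]
    refine Finset.sum_congr rfl fun j _ => ?_
    rw [hz j, mul_div_assoc]

theorem analyticAt_dslope {g : ℂ → ℂ} {z : ℂ} (hg : AnalyticAt ℂ g z) :
    AnalyticAt ℂ (dslope g z) z := by
  obtain ⟨p, hp⟩ := hg
  exact hp.has_fpower_series_dslope_fslope.analyticAt

theorem IsNormalizedAt.exists_laurent {θ : Differential X} {x : X} {r : ℂ}
    (h : IsNormalizedAt θ x r) : ∃ f : ℂ → ℂ, AnalyticAt ℂ f (chartAt ℂ x x) ∧
      ∀ᶠ z in 𝓝[≠] (chartAt ℂ x x), θ.coeff x z = r / (z - chartAt ℂ x x) + f z := by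
  obtain ⟨g, hg, hr, -, he⟩ := h
  refine ⟨dslope g (chartAt ℂ x x), analyticAt_dslope hg, ?_⟩
  filter_upwards [he, self_mem_nhdsWithin] with z hz hne
  rw [hz, dslope_of_ne _ hne, slope_def_field, hr]
  ring

theorem IsNormalizedAt.holAt {θ : Differential X} {x : X} (h : IsNormalizedAt θ x 0) :
    HolAt θ x := by
  obtain ⟨g, hg, hr, hd, he⟩ := h
  refine (analyticAt_dslope hg).congr ?_
  rw [eventually_nhdsWithin_iff] at he
  filter_upwards [he] with z hz
  by_cases hne : z = chartAt ℂ x x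
  · rw [hne, dslope_same, hd]
  · rw [hz hne, dslope_of_ne _ hne, slope_def_field, hr, sub_zero]

theorem exists_numerator_of_order {f : ℂ → ℂ} {z₀ : ℂ} (hf : MeromorphicAt f z₀)
    (ho : ((-1 : ℤ) : WithTop ℤ) ≤ meromorphicOrderAt f z₀) :
    ∃ g : ℂ → ℂ, AnalyticAt ℂ g z₀ ∧ (0 ≤ meromorphicOrderAt f z₀ → g z₀ = 0) ∧
      ∀ᶠ z in 𝓝[≠] z₀, f z = g z / (z - z₀) := by
  cases h : meromorphicOrderAt f z₀ with
  | top =>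
    refine ⟨0, analyticAt_const, fun _ => rfl, ?_⟩
    filter_upwards [meromorphicOrderAt_eq_top_iff.mp h] with z hz
    rw [hz, Pi.zero_apply, zero_div]
  | coe n =>
    obtain ⟨g, hg, -, he⟩ := (meromorphicOrderAt_eq_int_iff hf).mp h
    rw [h] at ho
    have hn : -1 ≤ n := by exact_mod_cast ho
    obtain ⟨m, hm⟩ := Int.eq_ofNat_of_zero_le (by omega : 0 ≤ n + 1)
    refine ⟨fun z => (z - z₀) ^ m * g z, by fun_prop, fun h0 => ?_, ?_⟩
    · have : 0 ≤ n := by exact_mod_cast h0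
      have hm0 : m ≠ 0 := by rintro rfl; omega
      simp [hm0]
    · filter_upwards [he, self_mem_nhdsWithin] with z hz hne
      have h0 : z - z₀ ≠ 0 := sub_ne_zero.mpr hne
      rw [hz, smul_eq_mul, eq_div_iff h0, mul_right_comm, ← zpow_add_one₀ h0, hm, zpow_natCast]

variable [IsManifold 𝓘(ℂ, ℂ) ω X]

theorem holAt_of_analyticAt_coeff {η : Differential X} {p : X} {z : ℂ}
    (hz : z ∈ (chartAt ℂ p).target) (h : AnalyticAt ℂ (η.coeff p) z) :
    HolAt η ((chartAt ℂ p).symm z) := by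
  set y := (chartAt ℂ p).symm z with hy
  have hyp : y ∈ (chartAt ℂ p).source := (chartAt ℂ p).map_target hz
  have hyt := chart_mem_target y
  have hys : (chartAt ℂ y).symm (chartAt ℂ y y) ∈ (chartAt ℂ p).source := by
    rwa [(chartAt ℂ y).left_inv (mem_chart_source ℂ y)]
  have hτ := analyticAt_trans hyt hys
  have hzy : trans y p (chartAt ℂ y y) = z := by
    rw [trans_chart (mem_chart_source ℂ y), hy, (chartAt ℂ p).right_inv hz]
  have h' : AnalyticAt ℂ (η.coeff p) (trans y p (chartAt ℂ y y)) := by rwa [hzy]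
  refine ((h'.comp hτ).mul hτ.deriv).congr ?_
  filter_upwards [eventually_symm_mem_source hyt hys] with w hw
  exact (coeff_trans η hw.1 hw.2).symm

/-- A meromorphic differential with at most simple poles can be modified on a finite set so that it
becomes normalised everywhere. -/
theorem exists_isNormalizedAt {η : Differential X} (hη : η.IsMeromorphic)
    (ho : ∀ x, ((-1 : ℤ) : WithTop ℤ) ≤ η.orderAt x) :
    ∃ (θ : Differential X) (r : X → ℂ), Differential.Equal η θ ∧
      ∀ x, IsNormalizedAt θ x (r x) ∧ (0 ≤ η.orderAt x → r x = 0) := by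
  choose g hg hg0 he using fun x => exists_numerator_of_order (hη x) (ho x)
  let θ : Differential X := fun x => deriv (g x) (chartAt ℂ x x) • ContinuousLinearMap.id ℂ ℂ
  have hθ : ∀ x, θ.coeff x (chartAt ℂ x x) = deriv (g x) (chartAt ℂ x x) := by
    intro x
    rw [coeff_self]
    exact mul_one _
  have hhol : ∀ x, ∀ᶠ y in 𝓝[≠] x, HolAt η y := by
    intro x
    have hx := mem_chart_source ℂ x
    have h1 := (hg x).eventually_analyticAt
    have h2 := eventually_eventually_nhdsWithin.mpr (he x)
    have h3 : ∀ᶠ z in 𝓝 (chartAt ℂ x x), z ≠ chartAt ℂ x x → AnalyticAt ℂ (η.coeff x) z := by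
      rw [eventually_nhdsWithin_iff] at h2
      filter_upwards [h1, h2] with z h1 h2 hne
      have h2 := h2 hne
      rw [isOpen_compl_singleton.nhdsWithin_eq hne] at h2
      refine AnalyticAt.congr (h1.fun_div (g := fun w => w - chartAt ℂ x x) (by fun_prop)
        (sub_ne_zero.mpr hne)) ?_
      filter_upwards [h2] with w hw using hw.symm
    rw [eventually_nhdsWithin_iff]
    filter_upwards [((chartAt ℂ x).continuousAt hx).eventually h3,
      (chartAt ℂ x).open_source.mem_nhds hx] with y hy hys hne
    have := holAt_of_analyticAt_coeff ((chartAt ℂ x).map_source hys)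
      (hy fun h0 => hne ((chartAt ℂ x).injOn hys hx h0))
    rwa [(chartAt ℂ x).left_inv hys] at this
  have hval : ∀ y, HolAt η y → η y = θ y := by
    intro y hy
    have h1 : (fun z => η.coeff y z * (z - chartAt ℂ y y)) =ᶠ[𝓝[≠] chartAt ℂ y y] g y := by
      filter_upwards [he y, self_mem_nhdsWithin] with z hz hne
      rw [hz, div_mul_cancel₀ _ (sub_ne_zero.mpr hne)]
    have hy' : AnalyticAt ℂ (η.coeff y) (chartAt ℂ y y) := hy
    have h2 := (AnalyticAt.frequently_eq_iff_eventually_eq (by fun_prop) (hg y)).mp h1.frequently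
    have h3 : HasDerivAt (fun z => η.coeff y z * (z - chartAt ℂ y y))
        (η.coeff y (chartAt ℂ y y)) (chartAt ℂ y y) := by
      have := hy'.differentiableAt.hasDerivAt.fun_mul
        ((hasDerivAt_id (chartAt ℂ y y)).sub_const (chartAt ℂ y y))
      simpa using this
    have h4 : deriv (g y) (chartAt ℂ y y) = η.coeff y (chartAt ℂ y y) := by
      rw [← EventuallyEq.deriv_eq h2, h3.deriv]
    have h5 := eq_of_coeff_eq (η := η) (θ := θ) (chart_mem_target y) (by rw [hθ, h4])
    rwa [(chartAt ℂ y).left_inv (mem_chart_source ℂ y)] at h5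
  have heq : Differential.Equal η θ := by
    refine mem_codiscrete.mpr fun x => disjoint_principal_right.mpr ?_
    filter_upwards [hhol x] with y hy using not_not.mpr (hval y hy)
  refine ⟨θ, fun x => g x (chartAt ℂ x x), heq, fun x =>
    ⟨⟨g x, hg x, rfl, (hθ x).symm, ?_⟩, fun h => hg0 x h⟩⟩
  filter_upwards [he x, eventually_symm_nhdsNE (heq.eventually x)] with z hz hz'
  rw [← hz, coeff_eq, coeff_eq, hz'.2]

end SimplePoles

/-! ### Pullbacks and contour integrals of modified differentials -/

section Pullback

variable {X : Type*} [TopologicalSpace X] [ChartedSpace ℂ X]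

/-- Modifying a differential on a finite set does not change contour integrals. -/
theorem contourIntegral_congr [T2Space X] [CompactSpace X] {η θ : Differential X}
    (h : Differential.Equal η θ) {γ : ℝ → X} (hγ : IsSimpleClosedCurve γ) :
    contourIntegral γ η = contourIntegral γ θ := by
  rw [Differential.Equal, codiscrete_eq_cofinite] at h
  have hfin : {x | ¬η x = θ x}.Finite := h
  rw [contourIntegral, contourIntegral, intervalIntegral.integral_of_le zero_le_one,
    intervalIntegral.integral_of_le zero_le_one, integral_Ioc_eq_integral_Ioo,
    integral_Ioc_eq_integral_Ioo]
  refine setIntegral_congr_ae measurableSet_Ioo ?_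
  have hpre : (Ico (0 : ℝ) 1 ∩ γ ⁻¹' {x | ¬η x = θ x}).Finite :=
    Finite.of_finite_image (hfin.subset (by rintro _ ⟨t, ht, rfl⟩; exact ht.2))
      (hγ.injOn.mono inter_subset_left)
  have hae : ∀ᵐ t ∂(volume : Measure ℝ), t ∉ Ico (0 : ℝ) 1 ∩ γ ⁻¹' {x | ¬η x = θ x} :=
    measure_eq_zero_iff_ae_notMem.mp (hpre.measure_zero volume)
  filter_upwards [hae] with t ht ht'
  have : η (γ t) = θ (γ t) := by
    by_contra hne
    exact ht ⟨Ioo_subset_Ico_self ht', hne⟩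
  rw [this]

theorem contourIntegral_sum [IsManifold 𝓘(ℂ, ℂ) ω X] {n : ℕ} {θ : Fin n → Differential X}
    {γ : ℝ → X} (hγ : IsSimpleClosedCurve γ) (hθ : ∀ j t, HolAt (θ j) (γ t)) (c : Fin n → ℂ) :
    contourIntegral γ (∑ j, c j • θ j) = ∑ j, c j * contourIntegral γ (θ j) := by
  simp only [contourIntegral]
  have h : ∀ t, (∑ j, c j • θ j) (γ t) (velocity γ t) =
      ∑ j, c j * θ j (γ t) (velocity γ t) := by
    intro t
    simp [Finset.sum_apply]
  simp only [h]
  rw [intervalIntegral.integral_finsetSum fun j _ =>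
    ((hγ.continuous_apply_velocity (hθ j)).const_mul (c j)).intervalIntegrable 0 1]
  simp only [intervalIntegral.integral_const_mul]

variable [IsManifold 𝓘(ℂ, ℂ) ω X]

/-- The coordinate expression of a pullback. -/
theorem coeff_pullback {f : X → X} (hf : MDifferentiable 𝓘(ℂ, ℂ) 𝓘(ℂ, ℂ) f) (θ : Differential X)
    {x p : X} {z : ℂ} (hz : z ∈ (chartAt ℂ x).target)
    (hp : f ((chartAt ℂ x).symm z) ∈ (chartAt ℂ p).source) :
    DifferentiableAt ℂ (fun w => chartAt ℂ p (f ((chartAt ℂ x).symm w))) z ∧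
      (θ.pullback f).coeff x z = θ.coeff p (chartAt ℂ p (f ((chartAt ℂ x).symm z))) *
        deriv (fun w => chartAt ℂ p (f ((chartAt ℂ x).symm w))) z := by
  set q := (chartAt ℂ x).symm z with hq
  have hqq := mem_chart_source ℂ q
  have hfq := mem_chart_source ℂ (f q)
  -- The derivative of `f` in the preferred charts.
  let m : ℂ := mfderiv 𝓘(ℂ, ℂ) 𝓘(ℂ, ℂ) f q (1 : ℂ)
  have hm : m = deriv (fun w => chartAt ℂ (f q) (f ((chartAt ℂ q).symm w))) (chartAt ℂ q q) := by
    change (mfderiv 𝓘(ℂ, ℂ) 𝓘(ℂ, ℂ) f q (1 : ℂ) : ℂ) = _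
    rw [(hf q).mfderiv]
    simp only [writtenInExtChartAt, mfld_simps, fderivWithin_univ]
    rfl
  have hd : DifferentiableAt ℂ (fun w => chartAt ℂ (f q) (f ((chartAt ℂ q).symm w)))
      (chartAt ℂ q q) := by
    have := (mdifferentiableAt_iff f q).mp (hf q)
    simpa [writtenInExtChartAt, mfld_simps, Function.comp_def, differentiableWithinAt_univ]
      using this.2
  have hzs : (chartAt ℂ x).symm z ∈ (chartAt ℂ q).source := hqq
  have e₁ : trans x q z = chartAt ℂ q q := rfl
  have d₁ := (differentiableAt_trans hz hzs).hasDerivAt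
  have d₂ : HasDerivAt (fun w => chartAt ℂ (f q) (f ((chartAt ℂ q).symm w))) m (trans x q z) := by
    rw [hm]; exact hd.hasDerivAt
  have hp' : (chartAt ℂ (f q)).symm (chartAt ℂ (f q) (f q)) ∈ (chartAt ℂ p).source := by
    rwa [(chartAt ℂ (f q)).left_inv hfq]
  have e₃ : chartAt ℂ (f q) (f ((chartAt ℂ q).symm (trans x q z))) = chartAt ℂ (f q) (f q) := by
    rw [e₁, (chartAt ℂ q).left_inv hqq]
  have d₃ : HasDerivAt (trans (f q) p) (deriv (trans (f q) p) (chartAt ℂ (f q) (f q)))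
      (chartAt ℂ (f q) (f ((chartAt ℂ q).symm (trans x q z)))) := by
    rw [e₃]
    exact (differentiableAt_trans (chart_mem_target (f q)) hp').hasDerivAt
  have d₄ := d₃.comp z (d₂.comp z d₁)
  have hev : (fun w => chartAt ℂ p (f ((chartAt ℂ x).symm w))) =ᶠ[𝓝 z] (trans (f q) p ∘
      ((fun w => chartAt ℂ (f q) (f ((chartAt ℂ q).symm w))) ∘ trans x q)) := by
    have hcont : ContinuousAt (fun w => f ((chartAt ℂ x).symm w)) z :=
      (hf q).continuousAt.comp ((chartAt ℂ x).continuousAt_symm hz)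
    filter_upwards [eventually_symm_mem_source hz hzs,
      hcont.eventually ((chartAt ℂ (f q)).open_source.mem_nhds hfq)] with w hw hfw
    simp only [Function.comp_apply]
    rw [symm_trans hw.2, trans_chart hfw]
  have d := d₄.congr_of_eventuallyEq hev
  refine ⟨d.differentiableAt, ?_⟩
  rw [d.deriv, coeff_eq, chartVec_eq hz]
  have h1 : (θ.pullback f) q (1 : ℂ) = θ (f q) (1 : ℂ) * m := clm_apply_eq (θ (f q)) m
  have h2 := coeff_trans θ (chart_mem_target (f q)) hp'
  rw [coeff_self, trans_chart hfq] at h2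
  rw [← hq, h1, h2]
  ring

/-- If a differential changes sign under `f`, a residue at `x` can be non-zero only if there is a
pole at `f x`. -/
theorem IsNormalizedAt.eq_zero_of_odd {f : X → X} (hf : MDifferentiable 𝓘(ℂ, ℂ) 𝓘(ℂ, ℂ) f)
    {θ : Differential X} (hodd : Differential.Equal (θ.pullback f) (fun x => -(θ x))) {x : X}
    {r : ℂ} (hx : IsNormalizedAt θ x r) (hfx : HolAt θ (f x)) : r = 0 := by
  obtain ⟨g, hg, hr, -, he⟩ := hx
  set z₀ := chartAt ℂ x x with hz₀
  have hsrc := mem_chart_source ℂ x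
  set σ : ℂ → ℂ := fun w => chartAt ℂ (f x) (f ((chartAt ℂ x).symm w)) with hσ
  have hev : ∀ᶠ z in 𝓝 z₀, z ∈ (chartAt ℂ x).target ∧
      f ((chartAt ℂ x).symm z) ∈ (chartAt ℂ (f x)).source := by
    have hcont : ContinuousAt (fun w => f ((chartAt ℂ x).symm w)) z₀ :=
      (hf _).continuousAt.comp ((chartAt ℂ x).continuousAt_symm (chart_mem_target x))
    have hfz : f ((chartAt ℂ x).symm z₀) ∈ (chartAt ℂ (f x)).source := by
      rw [hz₀, (chartAt ℂ x).left_inv hsrc]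
      exact mem_chart_source ℂ (f x)
    filter_upwards [target_mem_nhds (chart_mem_target x),
      hcont.eventually ((chartAt ℂ (f x)).open_source.mem_nhds hfz)] with z h1 h2 using ⟨h1, h2⟩
  have hσa : AnalyticAt ℂ σ z₀ := Complex.analyticAt_iff_eventually_differentiableAt.mpr
    (hev.mono fun z hz => (coeff_pullback hf θ hz.1 hz.2).1)
  have hσ₀ : σ z₀ = chartAt ℂ (f x) (f x) := by
    rw [hσ]
    simp only [hz₀, (chartAt ℂ x).left_inv hsrc]
  have hcont : ContinuousAt (fun z => (z - z₀) * -(θ.coeff (f x) (σ z) * deriv σ z)) z₀ := by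
    have h1 : ContinuousAt (fun z => θ.coeff (f x) (σ z)) z₀ :=
      ContinuousAt.comp (g := θ.coeff (f x)) (by rw [hσ₀]; exact AnalyticAt.continuousAt hfx)
        hσa.continuousAt
    exact (continuousAt_id.sub continuousAt_const).mul (h1.mul hσa.deriv.continuousAt).neg
  have heq : (fun z => (z - z₀) * -(θ.coeff (f x) (σ z) * deriv σ z)) =ᶠ[𝓝[≠] z₀] g := by
    filter_upwards [he, self_mem_nhdsWithin, mem_nhdsWithin_of_mem_nhds hev,
      eventually_symm_nhdsNE (hodd.eventually x)] with z hz hne hzt hzo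
    have h1 := (coeff_pullback hf θ hzt.1 hzt.2).2
    have h2 : (θ.pullback f).coeff x z = -θ.coeff x z := by
      rw [coeff_eq, coeff_eq, hzo.2, ← mul_neg]
      rfl
    rw [← h1, h2, neg_neg, hz, mul_div_cancel₀ _ (sub_ne_zero.mpr hne)]
  have h1 := (hcont.tendsto.mono_left nhdsWithin_le_nhds).congr' heq
  have h2 := tendsto_nhds_unique h1 (hg.continuousAt.tendsto.mono_left nhdsWithin_le_nhds)
  rw [sub_self, zero_mul] at h2
  rw [← hr, ← h2]

end Pullback

/-! ### The two halves of the surface, and the divisor of poles -/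

section Halves

variable {X : Type*} [TopologicalSpace X] [ChartedSpace ℂ X]

theorem LiesOnLeft.mem_closure {U : Set X} {γ : ℝ → X} (h : LiesOnLeft U γ) (t : ℝ) :
    γ t ∈ closure U := by
  let v : ℂ := velocity γ t
  have hc : Tendsto (fun ε : ℝ => (chartAt ℂ (γ t)).symm
      (chartAt ℂ (γ t) (γ t) + (ε : ℂ) * (Complex.I * v))) (𝓝[>] 0) (𝓝 (γ t)) := by
    have h1 : ContinuousAt (fun ε : ℝ => chartAt ℂ (γ t) (γ t) + (ε : ℂ) * (Complex.I * v)) 0 := by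
      fun_prop
    have h2 := (chartAt ℂ (γ t)).continuousAt_symm (chart_mem_target (γ t))
    have h3 : ContinuousAt (fun ε : ℝ => (chartAt ℂ (γ t)).symm
        (chartAt ℂ (γ t) (γ t) + (ε : ℂ) * (Complex.I * v))) 0 :=
      ContinuousAt.comp (by simpa using h2) h1
    have h4 := h3.tendsto
    simp only [Complex.ofReal_zero, zero_mul, add_zero,
      (chartAt ℂ (γ t)).left_inv (mem_chart_source ℂ (γ t))] at h4
    exact h4.mono_left nhdsWithin_le_nhds
  exact mem_closure_of_tendsto hc (h t)

variable {ι : Type*} {γ : ι → ℝ → X} {Xp Xm : Set X}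

theorem frontier_eq_of_union (hp : IsOpen Xp) (hm : IsOpen Xm) (hdisj : Disjoint Xp Xm)
    (hunion : Xp ∪ Xm = (⋃ k, range (γ k))ᶜ) (hleft : ∀ k, LiesOnLeft Xp (γ k)) :
    frontier Xp = ⋃ k, range (γ k) := by
  have hcl : Disjoint (closure Xp) Xm := hdisj.closure_left hm
  rw [hp.frontier_eq]
  refine Subset.antisymm (fun x hx => ?_) (iUnion_subset fun k => ?_)
  · by_contra hne
    rw [← mem_compl_iff, ← hunion] at hne
    exact hne.elim hx.2 (disjoint_left.mp hcl hx.1)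
  · rintro _ ⟨t, rfl⟩
    refine ⟨(hleft k).mem_closure t, fun h => ?_⟩
    have h1 : γ k t ∈ (⋃ k, range (γ k))ᶜ := hunion ▸ Or.inl h
    exact h1 (mem_iUnion.mpr ⟨k, t, rfl⟩)

theorem compl_closure_eq_of_union (hp : IsOpen Xp) (hm : IsOpen Xm) (hdisj : Disjoint Xp Xm)
    (hunion : Xp ∪ Xm = (⋃ k, range (γ k))ᶜ) (hleft : ∀ k, LiesOnLeft Xp (γ k)) :
    (closure Xp)ᶜ = Xm := by
  have hfr := frontier_eq_of_union hp hm hdisj hunion hleft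
  refine Subset.antisymm (fun x hx => ?_)
    (subset_compl_iff_disjoint_left.mpr (hdisj.closure_left hm))
  have h1 : x ∈ (⋃ k, range (γ k))ᶜ := by
    rw [← hfr]
    exact fun h => hx (frontier_subset_closure h)
  rw [← hunion] at h1
  exact h1.resolve_left fun h => hx (subset_closure h)

/-- An involution that exchanges the two halves and preserves the curves shows that both halves
touch every curve. -/
theorem isRegularBoundary_of_involutive (hγ : ∀ k, IsSimpleClosedCurve (γ k))
    (hγd : ∀ k l, k ≠ l → Disjoint (range (γ k)) (range (γ l)))
    (hp : IsOpen Xp) (hm : IsOpen Xm) (hdisj : Disjoint Xp Xm)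
    (hunion : Xp ∪ Xm = (⋃ k, range (γ k))ᶜ) (hleft : ∀ k, LiesOnLeft Xp (γ k)) {f : X → X}
    (hf : Continuous f) (hpm : MapsTo f Xp Xm) (hfγ : ∀ k, f '' range (γ k) = range (γ k)) :
    IsRegularBoundary Xp γ where
  isOpen := hp
  curve := hγ
  disj := hγd
  left := hleft
  frontier_eq := frontier_eq_of_union hp hm hdisj hunion hleft
  exterior k t := by
    have h1 : γ k t ∈ closure Xm := by
      have h2 : γ k t ∈ f '' range (γ k) := by rw [hfγ]; exact ⟨t, rfl⟩
      obtain ⟨_, ⟨s, rfl⟩, hs⟩ := h2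
      rw [← hs]
      exact map_mem_closure hf ((hleft k).mem_closure s) hpm
    rwa [← compl_closure_eq_of_union hp hm hdisj hunion hleft, closure_compl] at h1

end Halves

section Divisor

variable {X : Type*} {s : ℕ}

theorem sum_single_eq_zero {f : Fin s → X} {x : X} (hx : ∀ k, f k ≠ x) :
    (∑ k, Finsupp.single (f k) (1 : ℤ)) x = 0 := by
  classical
  rw [Finsupp.finsetSum_apply]
  exact Finset.sum_eq_zero fun k _ => Finsupp.single_eq_of_ne' (hx k)

theorem sum_single_le_one {f : Fin s → X} (hf : Function.Injective f) (x : X) :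
    (∑ k, Finsupp.single (f k) (1 : ℤ)) x ≤ 1 := by
  classical
  by_cases h : ∃ k, f k = x
  · obtain ⟨k, rfl⟩ := h
    rw [Finsupp.finsetSum_apply, Finset.sum_eq_single k
      (fun l _ hl => Finsupp.single_eq_of_ne' (hf.ne hl)) (by simp), Finsupp.single_eq_same]
  · push Not at h
    rw [sum_single_eq_zero h]
    exact zero_le_one

end Divisor

/-! ### Linear combinations of odd differentials with simple poles -/

section Combinations

variable {X : Type*} [TopologicalSpace X] [ChartedSpace ℂ X]

theorem eq_zero_of_sum_eq_zero {n : ℕ} {η θ : Fin n → Differential X}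
    (hη : Differential.LinIndep η) (hηθ : ∀ j, Differential.Equal (η j) (θ j)) {c : Fin n → ℂ}
    (hc : ∑ j, c j • θ j = 0) : c = 0 := by
  refine funext (hη c ?_)
  simp only [Differential.Equal] at hηθ ⊢
  filter_upwards [eventually_all.mpr hηθ] with x hx
  simp only [hx]
  have := congrFun hc x
  simpa [Finset.sum_apply] using this

variable [T2Space X] [CompactSpace X]

theorem equal_pullback_sum {n : ℕ} {η θ : Fin n → Differential X} {f : X → X}
    (hf : Function.Injective f) (hηθ : ∀ j, Differential.Equal (η j) (θ j))
    (hη : ∀ j, Differential.Equal ((η j).pullback f) (fun x => -(η j x))) (c : Fin n → ℂ) :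
    Differential.Equal ((∑ j, c j • θ j : Differential X).pullback f)
      (fun x => -(∑ j, c j • θ j : Differential X) x) := by
  simp only [Differential.Equal, codiscrete_eq_cofinite] at hηθ hη ⊢
  filter_upwards [eventually_all.mpr hηθ, eventually_all.mpr hη,
    hf.tendsto_cofinite.eventually (eventually_all.mpr hηθ)] with x h1 h2 h3
  have h : ∀ j, (θ j).pullback f x = -(θ j x) := by
    intro j
    rw [← h1 j, ← h2 j, Differential.pullback, Differential.pullback, h3 j]
  have e : ∀ y w, (∑ j, c j • θ j : Differential X) y w = ∑ j, c j * θ j y w := fun y w => by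
    simp [Finset.sum_apply]
  refine ContinuousLinearMap.ext fun v => ?_
  have hv : ∀ j, θ j (f x) (mfderiv 𝓘(ℂ, ℂ) 𝓘(ℂ, ℂ) f x v) = -(θ j x v) := fun j =>
    DFunLike.congr_fun (h j) v
  calc (∑ j, c j • θ j : Differential X) (f x) (mfderiv 𝓘(ℂ, ℂ) 𝓘(ℂ, ℂ) f x v)
      = -∑ j, c j * θ j x v := by
        rw [e, ← Finset.sum_neg_distrib]
        exact Finset.sum_congr rfl fun j _ => by rw [hv j, mul_neg]
    _ = -((∑ j, c j • θ j : Differential X) x v) := by rw [e]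

end Combinations

end RiemannSurface

/-! ### Non-degeneracy of the period matrix -/

theorem lemma8p1
    -- a compact (connected) Riemann surface of genus `g`
    {X : Type*} [TopologicalSpace X] [T2Space X] [CompactSpace X] [ConnectedSpace X]
    [ChartedSpace ℂ X] [IsManifold 𝓘(ℂ, ℂ) ω X]
    (g s : ℕ) (hg : HasGenus X g)
    -- the curves `C_0, …, C_{g+s}`
    (C : Fin (g + s + 1) → ℝ → X)
    (hC : ∀ m, IsSimpleClosedCurve (C m))
    -- `C_0, …, C_g` are disjoint, divide `X` into `Xp` and `Xm`, and are oriented as the boundary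
    -- of `Xp`
    (Xp Xm : Set X)
    (hC_disj : ∀ k l : Fin (g + 1), k ≠ l →
      Disjoint (Set.range (C (boundaryIdx s k))) (Set.range (C (boundaryIdx s l))))
    (hXp_open : IsOpen Xp) (hXm_open : IsOpen Xm)
    (hXp_conn : IsConnected Xp) (hXm_conn : IsConnected Xm)
    (hX_disj : Disjoint Xp Xm)
    (hX_union : Xp ∪ Xm = (⋃ k : Fin (g + 1), Set.range (C (boundaryIdx s k)))ᶜ)
    (hC_left : ∀ k : Fin (g + 1), LiesOnLeft Xp (C (boundaryIdx s k)))
    -- the holomorphic involution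
    (ι : X → X) (hι : MDifferentiable 𝓘(ℂ, ℂ) 𝓘(ℂ, ℂ) ι) (hι_inv : Function.Involutive ι)
    (hι_pm : Set.MapsTo ι Xp Xm) (hι_mp : Set.MapsTo ι Xm Xp)
    (hι_C : ∀ k : Fin (g + 1),
      ι '' Set.range (C (boundaryIdx s k)) = Set.range (C (boundaryIdx s k)))
    -- the points `P_k^+`; the point `P_k^-` is `ι (P k)`
    (P : Fin s → X) (hP_inj : Function.Injective P) (hP : ∀ k, P k ∈ Xp)
    -- the open disks `U k` around `P_k^+`, bounded by `C_{g+k}`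
    (U : Fin s → Set X) (hU_open : ∀ k, IsOpen (U k))
    (hU_disk : ∀ k, Nonempty (U k ≃ₜ Metric.ball (0 : ℂ) 1))
    (hU_mem : ∀ k, P k ∈ U k)
    (hU_frontier : ∀ k, frontier (U k) = Set.range (C (circleIdx g k)))
    (hU_sub : ∀ k, closure (U k) ⊆ Xp)
    (hU_disj : ∀ k l, k ≠ l → Disjoint (closure (U k)) (closure (U l)))
    (hU_left : ∀ k, LiesOnLeft (U k) (C (circleIdx g k)))
    -- the meromorphic differentials
    (η : Fin (g + s) → Differential X)
    (hη_mero : ∀ j, (η j).IsMeromorphic)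
    (hη_indep : Differential.LinIndep η)
    (hη_odd : ∀ j, Differential.Equal ((η j).pullback ι) (fun x => -(η j x)))
    (hη_div : ∀ j, (η j).DivisorGeNeg
      (∑ k, (Finsupp.single (ι (P k)) (1 : ℤ) + Finsupp.single (P k) (1 : ℤ))))
    (k₀ : Fin (g + s + 1)) :
    (periodMatrix C η k₀).det ≠ 0 := by

  classical
  intro hdet
  obtain ⟨c, hc0, hc⟩ := Matrix.exists_vecMul_eq_zero_iff.mpr hdet
  -- The points `P k` and `ι (P k)`.
  let Q : Fin s ⊕ Fin s → X := Sum.elim P (ι ∘ P)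
  have hQm : ∀ k, ι (P k) ∈ Xm := fun k => hι_pm (hP k)
  have hpm : ∀ {x}, x ∈ Xp → x ∉ Xm := fun h h' => Set.disjoint_left.mp hX_disj h h'
  have hιP_inj : Function.Injective fun k => ι (P k) := hι_inv.injective.comp hP_inj
  have hQ_inj : Function.Injective Q := hP_inj.sumElim hιP_inj fun k l h =>
    hpm (hP k) (h ▸ hQm l)
  let S : Finset X := Finset.univ.map ⟨Q, hQ_inj⟩
  have hS : ∀ x, x ∉ S → (∀ k, P k ≠ x) ∧ ∀ k, ι (P k) ≠ x := by
    intro x hx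
    constructor
    · rintro k rfl
      exact hx (Finset.mem_map.mpr ⟨Sum.inl k, Finset.mem_univ _, rfl⟩)
    · rintro k rfl
      exact hx (Finset.mem_map.mpr ⟨Sum.inr k, Finset.mem_univ _, rfl⟩)
  have hSpm : ∀ x ∈ S, x ∈ Xp ∪ Xm := by
    intro x hx
    obtain ⟨k | k, -, rfl⟩ := Finset.mem_map.mp hx
    · exact Or.inl (hP k)
    · exact Or.inr (hQm k)
  have hsumS : ∀ f : X → ℂ, ∑ x ∈ S, f x = ∑ k, f (P k) + ∑ k, f (ι (P k)) := by
    intro f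
    rw [Finset.sum_map, Fintype.sum_sum_type]
    rfl
  -- The given differentials are normalised by a modification on a finite set.
  have hdiv : ∀ x, (∑ k, (Finsupp.single (ι (P k)) (1 : ℤ) + Finsupp.single (P k) (1 : ℤ))) x =
      (∑ k, Finsupp.single (ι (P k)) (1 : ℤ)) x + (∑ k, Finsupp.single (P k) (1 : ℤ)) x := by
    intro x
    rw [Finset.sum_add_distrib, Finsupp.add_apply]
  have hord : ∀ j x, ((-1 : ℤ) : WithTop ℤ) ≤ (η j).orderAt x := by
    intro j x
    refine le_trans ?_ (hη_div j x)
    rw [hdiv]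
    have h1 := sum_single_le_one hιP_inj x
    have h2 := sum_single_le_one hP_inj x
    have h3 : (∑ k, Finsupp.single (ι (P k)) (1 : ℤ)) x +
        (∑ k, Finsupp.single (P k) (1 : ℤ)) x ≤ 1 := by
      by_cases hx : x ∈ Xp
      · rw [sum_single_eq_zero (f := fun k => ι (P k)) (x := x) fun k h => hpm hx (h ▸ hQm k)]
        omega
      · rw [sum_single_eq_zero (f := P) (x := x) fun k h => hx (h ▸ hP k)]
        omega
    exact_mod_cast (by omega :
      (-1 : ℤ) ≤ -((∑ k, Finsupp.single (ι (P k)) (1 : ℤ)) x +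
        (∑ k, Finsupp.single (P k) (1 : ℤ)) x))
  have hord0 : ∀ j, ∀ x, x ∉ S → 0 ≤ (η j).orderAt x := by
    intro j x hx
    have h1 := hη_div j x
    rw [hdiv, sum_single_eq_zero (hS x hx).1, sum_single_eq_zero (hS x hx).2] at h1
    simpa using h1
  choose θ r hηθ hθ using fun j => exists_isNormalizedAt (hη_mero j) (hord j)
  have hr0 : ∀ j x, x ∉ S → r j x = 0 := fun j x hx => (hθ j x).2 (hord0 j x hx)
  have hhol : ∀ j x, x ∉ S → HolAt (θ j) x := fun j x hx => by
    have := (hθ j x).1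
    rw [hr0 j x hx] at this
    exact this.holAt
  let Ω : (Fin (g + s) → ℂ) →ₗ[ℂ] Differential X := Fintype.linearCombination ℂ θ
  have hΩ : ∀ a, Ω a = ∑ j, a j • θ j := fun a => rfl
  let R : (Fin (g + s) → ℂ) → X → ℂ := fun a x => ∑ j, a j * r j x
  have hN : ∀ a x, IsNormalizedAt (Ω a) x (R a x) := fun a x =>
    IsNormalizedAt.sum (fun j => (hθ j x).1) a
  have hΩhol : ∀ a x, x ∉ S → HolAt (Ω a) x := by
    intro a x hx
    have h1 := hN a x
    have h2 : R a x = 0 := Finset.sum_eq_zero fun j _ => by rw [hr0 j x hx, mul_zero]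
    rw [h2] at h1
    exact h1.holAt
  -- No curve meets the poles.
  have hbS : ∀ k t, C (boundaryIdx s k) t ∉ S := by
    intro k t hx
    have h1 := hSpm _ hx
    rw [hX_union] at h1
    exact h1 (Set.mem_iUnion.mpr ⟨k, t, rfl⟩)
  have hcU : ∀ k t, C (circleIdx g k) t ∈ frontier (U k) := fun k t =>
    hU_frontier k ▸ ⟨t, rfl⟩
  have hcS : ∀ k t, C (circleIdx g k) t ∉ S := by
    intro k t hx
    have h1 := hcU k t
    have h2 : C (circleIdx g k) t ∈ closure (U k) := frontier_subset_closure h1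
    obtain ⟨l | l, -, hl⟩ := Finset.mem_map.mp hx
    · change P l = _ at hl
      by_cases hlk : l = k
      · subst hlk
        rw [(hU_open l).frontier_eq] at h1
        exact h1.2 (hl ▸ hU_mem l)
      · exact Set.disjoint_left.mp (hU_disj l k hlk) (subset_closure (hU_mem l)) (hl ▸ h2)
    · change ι (P l) = _ at hl
      exact hpm (hU_sub k h2) (hl ▸ hQm l)
  have hidx : ∀ m : Fin (g + s + 1), (∃ k, m = boundaryIdx s k) ∨ ∃ k, m = circleIdx g k := by
    intro m
    by_cases hm : (m : ℕ) < g + 1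
    · exact Or.inl ⟨⟨m, hm⟩, rfl⟩
    · exact Or.inr ⟨⟨m - (g + 1), by omega⟩, Fin.ext (by simp only [circleIdx]; omega)⟩
  have hCS : ∀ m t, C m t ∉ S := by
    intro m t
    obtain ⟨k, rfl⟩ | ⟨k, rfl⟩ := hidx m
    · exact hbS k t
    · exact hcS k t
  -- All periods of the combination vanish, except possibly the one with index `k₀`.
  have hper : ∀ m, m ≠ k₀ → contourIntegral (C m) (Ω c) = 0 := by
    intro m hm
    obtain ⟨i, rfl⟩ := Fin.exists_succAbove_eq hm
    have h1 := congrFun hc i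
    rw [hΩ, contourIntegral_sum (hC _) (fun j t => hhol j _ (hCS _ t))]
    simp only [← fun j => contourIntegral_congr (hηθ j) (hC (k₀.succAbove i))]
    simpa [Matrix.vecMul, dotProduct, periodMatrix] using h1
  -- The residue theorem for the two kinds of regions.
  have hregp : IsRegularBoundary Xp fun k => C (boundaryIdx s k) :=
    isRegularBoundary_of_involutive (fun k => hC _) hC_disj hXp_open hXm_open hX_disj hX_union
      hC_left hι.continuous hι_pm hι_C
  have hres : ∀ {κ : Type} [Fintype κ] {D : Set X} {γ : κ → ℝ → X}, IsRegularBoundary D γ →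
      (∀ k t, γ k t ∉ S) → ∑ k, contourIntegral (γ k) (Ω c) =
        -(Complex.I * residueConst) * ∑ x ∈ S, D.indicator 1 x * R c x := by
    intro κ _ D γ hD hγ
    refine sum_contourIntegral_eq_residues hD (S := S) (fun x hx k ⟨t, ht⟩ => hγ k t (ht ▸ hx))
      (hΩhol c) fun x _ => ?_
    exact (hN c x).exists_laurent
  have hκ : -(Complex.I * residueConst) ≠ 0 :=
    neg_ne_zero.mpr (mul_ne_zero Complex.I_ne_zero residueConst_ne_zero)
  have hresp : ∑ k, contourIntegral (C (boundaryIdx s k)) (Ω c) =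
      -(Complex.I * residueConst) * ∑ k, R c (P k) := by
    rw [hres hregp hbS, hsumS]
    congr 1
    rw [Finset.sum_eq_zero (f := fun k => Xp.indicator 1 (ι (P k)) * R c (ι (P k))), add_zero]
    · exact Finset.sum_congr rfl fun k _ => by
        rw [Set.indicator_of_mem (hP k), Pi.one_apply, one_mul]
    · intro k _
      rw [Set.indicator_of_notMem fun h => hpm h (hQm k), zero_mul]
  have hresU : ∀ k, contourIntegral (C (circleIdx g k)) (Ω c) =
      -(Complex.I * residueConst) * R c (P k) := by
    intro k
    have hb : IsBoundedBy (U k) fun _ : Unit => C (circleIdx g k) :=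
      { isOpen := hU_open k
        curve := fun _ => hC _
        disj := fun a b h => (h (Subsingleton.elim a b)).elim
        left := fun _ => hU_left k
        frontier_eq := by rw [hU_frontier, Set.iUnion_const] }
    have hne : closure (U k) ≠ Set.univ := by
      intro h
      obtain ⟨x, hx⟩ := hXm_conn.nonempty
      exact hpm (hU_sub k (h ▸ Set.mem_univ x)) hx
    have h1 := hres (hb.isRegularBoundary_of_unique hne) (fun _ => hcS k)
    rw [Fintype.sum_unique, hsumS, Finset.sum_eq_single k, Finset.sum_eq_zero, add_zero,
      Set.indicator_of_mem (hU_mem k), Pi.one_apply, one_mul] at h1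
    · exact h1
    · intro l _
      rw [Set.indicator_of_notMem fun h => hpm (hU_sub k (subset_closure h)) (hQm l), zero_mul]
    · intro l _ hl
      rw [Set.indicator_of_notMem fun h => Set.disjoint_left.mp (hU_disj l k hl)
        (subset_closure (hU_mem l)) (subset_closure h), zero_mul]
    · simp
  -- Hence all residues and all periods along the boundary vanish.
  have hRb : (∀ k, R c (P k) = 0) ∧ ∀ k, contourIntegral (C (boundaryIdx s k)) (Ω c) = 0 := by
    obtain ⟨i, hi⟩ | ⟨i, hi⟩ := hidx k₀
    · have hR : ∀ k, R c (P k) = 0 := by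
        intro k
        have h1 := hresU k
        rw [hper _ (by rw [hi]; intro h; have := congrArg Fin.val h
                       simp only [circleIdx, boundaryIdx] at this; omega)] at h1
        exact (mul_eq_zero.mp h1.symm).resolve_left hκ
      refine ⟨hR, fun k => ?_⟩
      by_cases hk : k = i
      · subst hk
        rw [Finset.sum_eq_zero (f := fun k => R c (P k)) fun k _ => hR k, mul_zero,
          Finset.sum_eq_single k] at hresp
        · exact hresp
        · intro l _ hl
          refine hper _ fun h => hl (Fin.ext ?_)
          simpa [boundaryIdx] using congrArg Fin.val (h.trans hi)
        · simp
      · refine hper _ fun h => hk (Fin.ext ?_)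
        simpa [boundaryIdx] using congrArg Fin.val (h.trans hi)
    · have hb : ∀ k, contourIntegral (C (boundaryIdx s k)) (Ω c) = 0 := by
        intro k
        refine hper _ fun h => ?_
        have := congrArg Fin.val (h.trans hi)
        simp only [circleIdx, boundaryIdx] at this
        omega
      refine ⟨fun k => ?_, hb⟩
      have hother : ∀ l, l ≠ i → R c (P l) = 0 := by
        intro l hl
        have h1 := hresU l
        rw [hper _ fun h => hl (Fin.ext (by
          simpa [circleIdx] using congrArg Fin.val (h.trans hi)))] at h1
        exact (mul_eq_zero.mp h1.symm).resolve_left hκ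
      by_cases hk : k = i
      · subst hk
        rw [Finset.sum_eq_zero fun l _ => hb l, Finset.sum_eq_single k
          (fun l _ hl => hother l hl) (by simp)] at hresp
        exact (mul_eq_zero.mp hresp.symm).resolve_left hκ
      · exact hother k hk
  -- The combinations without residues form a space of holomorphic differentials.
  let L : (Fin (g + s) → ℂ) →ₗ[ℂ] (Fin s → ℂ) :=
    LinearMap.pi fun k => Fintype.linearCombination ℂ fun j => r j (P k)
  have hL : ∀ a k, L a k = R a (P k) := fun a k => rfl
  have hKhol : ∀ a : LinearMap.ker L, Ω a ∈ holForms X := by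
    intro a x
    have hRP : ∀ k, R a (P k) = 0 := fun k => congrFun a.2 k
    have hholP : ∀ k, HolAt (Ω a) (P k) := fun k => by
      have h1 := hN a (P k)
      rw [hRP] at h1
      exact h1.holAt
    by_cases hx : x ∈ S
    · obtain ⟨k | k, -, rfl⟩ := Finset.mem_map.mp hx
      · exact hholP k
      · have h1 := hN a (ι (P k))
        have h2 := h1.eq_zero_of_odd hι (equal_pullback_sum hι_inv.injective hηθ hη_odd a)
          (by rw [hι_inv]; exact hholP k)
        rw [h2] at h1
        exact h1.holAt
    · exact hΩhol a x hx
  let Φ : LinearMap.ker L →ₗ[ℂ] holForms X :=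
    (Ω ∘ₗ (LinearMap.ker L).subtype).codRestrict (holForms X) hKhol
  have hΦ : Function.Injective Φ := by
    refine (injective_iff_map_eq_zero Φ).mpr fun a ha => Subtype.ext ?_
    exact eq_zero_of_sum_eq_zero hη_indep hηθ (congrArg Subtype.val ha)
  have hdim : g ≤ Module.finrank ℂ (LinearMap.ker L) := by
    have h1 := LinearMap.finrank_range_add_finrank_ker L
    have h2 := Submodule.finrank_le (LinearMap.range L)
    rw [Module.finrank_fin_fun] at h1 h2
    omega
  have hXm := compl_closure_eq_of_union hXp_open hXm_open hX_disj hX_union hC_left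
  have hfin := eq_zero_of_contourIntegral_eq_zero hg hregp hXp_conn.isPreconnected
    (hXm ▸ hXm_conn.isPreconnected) (Fintype.card_fin _) hΦ hdim
    (w := ⟨c, funext fun k => hRb.1 k⟩) hRb.2
  exact hc0 (congrArg Subtype.val hfin)
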